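/- **Setting.** Let $d\in\mathbb N$, $s\in[1,\infty]$ and $M>0$, and put $\frac{s-1}{s}=1$ for $s=\infty$. All functions live on the torus $\mathbb T^d=\mathbb R^d/\mathbb Z^d$. We consider * divergence-free velocity fields $u:[0,\infty)\times\mathbb T^d\to\mathbb R^d$ that are Lipschitz in space for almost every time, with $u\in L^1_{loc}([0,\infty);L^\infty(\mathbb T^d))$ and $\|\nabla u\|_{L^s_tL^\infty_x}\le 1$; * mean-zero initial data $\theta_0\in H^1(\mathbb T^d)$ with $\frac1M\le\|\theta_0\|_{L^2}\le M$ and $\frac1M\le\|\nabla\theta_0\|_{L^2}\le M$. For $0<\kappa<1$, let $\theta^\kappa$ be the distributional solution of $\partial_t\theta^\kappa+u\cdot\nabla\theta^\kappa=\kappa\Delta\theta^\kappa$, and let $\theta$ be that of $\partial_t\theta+u\cdot\nabla\theta=0$, both with initial datum $\theta_0$, locally bounded in time with values in $L^2(\mathbb T^d)$ and weakly continuous in time. Write $\|f\|_{\dot H^{-1}}^2=\sum_{k\in\mathbb Z^d\setminus\{0\}}\frac{|\hat f(k)|^2}{4\pi^2|k|^2}$, where $\hat f(k)=\int_{\mathbb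 T^d}f(x)e^{-2\pi i k\cdot x}\,dx$, and $$T_{\kappa,s}=\begin{cases}\left(\log\frac1\kappa\right)^{\frac{s}{s-1}}&\text{if }s>1,\\ \frac1\kappa&\text{if }s=1.\end{cases}$$ **Theorem 1.1.** 1. For all $A,C,c>0$ there are $c',C'>0$, depending only on $d,s,M,A,C,c$, such that for all $\kappa\in(0,1)$ and all $u,\theta_0$ as above: if $\|\theta(t)\|_{\dot H^{-1}}\le C e^{-At^{(s-1)/s}}$ for all $0\le t\le c\,T_{\kappa,s}$, then $\|\theta^\kappa(t)\|_{\dot H^{-1}}\le C' e^{-At^{(s-1)/s}}$ for all $0\le t\le c'\,T_{\kappa,s}$. 2. For all $A,C,c>0$ there are $c',C'>0$, depending only on $d,s,M,A,C,c$, such that for all $\kappa\in(0,1)$ and all $u,\theta_0$ as above: if $e^{-At^{(s-1)/s}}\le C\|\theta(t)\|_{\dot H^{-1}}$ for all $0\le t\le c\,T_{\kappa,s}$, then $e^{-At^{(s-1)/s}}\le C'\|\theta^\kappa(t)\|_{\dot H^{-1}}$ for all $0\le t\le c'\,T_{\kappa,s}$. 3. There are $c,C>0$, depending only on $d,s,M$,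 such that for all $\kappa\in(0,1)$ and all $u,\theta_0$ as above, $1\le C\|\theta^\kappa(t)\|_{L^2}$ for all $0\le t\le c\,T_{\kappa,s}$. -/

import Mathlib

open MeasureTheory Set
open scoped ENNReal NNReal ContDiff InnerProductSpace

noncomputable section

namespace PassiveScalar

/-- The Euclidean space `ℝ^d`. Functions on the torus `𝕋^d = ℝ^d / ℤ^d` are represented by
`ℤ^d`-periodic functions on it. -/
abbrev Space (d : ℕ) : Type := EuclideanSpace ℝ (Fin d)

/-- The integer vector `k ∈ ℤ^d`, as a point of `ℝ^d`. -/
def latticePoint {d : ℕ} (k : Fin d → ℤ) : Space d :=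
  WithLp.toLp 2 (fun i => (k i : ℝ))

/-- `ℤ^d`-periodic functions, that is, functions on the torus. -/
def IsPeriodic {d : ℕ} {α : Type*} (f : Space d → α) : Prop :=
  ∀ (x : Space d) (k : Fin d → ℤ), f (x + latticePoint k) = f x

/-- The periodic box `[0,1)^d`. -/
def box (d : ℕ) : Set (Space d) := {x | ∀ i, x i ∈ Ico (0 : ℝ) 1}

/-- Lebesgue measure on the periodic box, that is, the Haar probability measure of the torus. -/
def torusMeasure (d : ℕ) : Measure (Space d) := volume.restrict (box d)

/-- Test functions: smooth functions on the torus. -/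
structure IsTestFunction {d : ℕ} (φ : Space d → ℝ) : Prop where
  smooth : ContDiff ℝ ∞ φ
  periodic : IsPeriodic φ

/-- The vector field `G` on the torus is the weak gradient of `f`, and both are in `L²`. -/
structure IsWeakGradient {d : ℕ} (f : Space d → ℝ) (G : Space d → Space d) : Prop where
  periodic : IsPeriodic f
  memLp : MemLp f 2 (torusMeasure d)
  periodic_grad : IsPeriodic G
  memLp_grad : MemLp G 2 (torusMeasure d)
  integral_eq : ∀ φ : Space d → ℝ, IsTestFunction φ →
    ∫ x, f x • gradient φ x ∂torusMeasure d = -∫ x, φ x • G x ∂torusMeasure d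

/-- The Fourier coefficient `∫_{𝕋^d} f(x) e^{-2πi k·x} dx`. -/
def fourierCoefficient {d : ℕ} (f : Space d → ℝ) (k : Fin d → ℤ) : ℂ :=
  ∫ x, (f x : ℂ) * Complex.exp (-(2 * Real.pi * ⟪latticePoint k, x⟫_ℝ : ℝ) * Complex.I)
    ∂torusMeasure d

/-- The homogeneous negative Sobolev norm
`‖f‖_{Ḣ^{-1}} = (∑_{k ≠ 0} |f̂(k)|² / (2π|k|)²)^{1/2}`, that is, `‖∇φ‖_{L²}` with `-Δφ = f`. -/
def hNegOneNorm {d : ℕ} (f : Space d → ℝ) : ℝ≥0∞ :=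
  (∑' k : {k : Fin d → ℤ // k ≠ 0},
    ‖fourierCoefficient f k.1‖ₑ ^ 2 / ENNReal.ofReal ((2 * Real.pi * ‖latticePoint k.1‖) ^ 2))
      ^ (1 / 2 : ℝ)

/-- The `L²` norm on the torus. -/
def l2Norm {d : ℕ} (f : Space d → ℝ) : ℝ≥0∞ := eLpNorm f 2 (torusMeasure d)

/-- `‖∇v‖_{L^∞}` for a Lipschitz vector field `v`: the essential supremum of the operator norm
of the (almost everywhere existing) derivative. -/
def gradSupNorm {d : ℕ} (v : Space d → Space d) : ℝ≥0∞ :=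
  essSup (fun x => ENNReal.ofReal ‖fderiv ℝ v x‖) (torusMeasure d)

/-- Divergence-free vector fields `u` on `[0,∞) × 𝕋^d` that are Lipschitz in space, locally
integrable in time with values in `L^∞`, and satisfy `‖∇u‖_{L^s_t L^∞_x} ≤ 1`. -/
structure IsAdmissibleVelocity {d : ℕ} (s : ℝ≥0∞) (u : ℝ → Space d → Space d) : Prop where
  measurable : Measurable (Function.uncurry u)
  periodic : ∀ t, 0 ≤ t → IsPeriodic (u t)
  lipschitz : ∀ᵐ t ∂volume.restrict (Ioi (0 : ℝ)), ∃ K : ℝ≥0, LipschitzWith K (u t)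
  divergence_free : ∀ᵐ t ∂volume.restrict (Ioi (0 : ℝ)), ∀ φ : Space d → ℝ, IsTestFunction φ →
    ∫ x, ⟪u t x, gradient φ x⟫_ℝ ∂torusMeasure d = 0
  locally_integrable : ∀ T : ℝ, ∫⁻ t in Ioc 0 T, eLpNorm (u t) (⊤ : ℝ≥0∞) (torusMeasure d) < ⊤
  gradient_bound :
    eLpNorm (fun t => gradSupNorm (u t)) s (volume.restrict (Ioi (0 : ℝ))) ≤ 1

/-- Mean-zero `θ₀ ∈ H¹(𝕋^d)` with `‖θ₀‖_{L²} ∼ 1` and `‖∇θ₀‖_{L²} ∼ 1`, where the constant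
implicit in `∼` is `M`. -/
structure IsInitialDatum {d : ℕ} (M : ℝ) (θ₀ : Space d → ℝ) : Prop where
  mean_zero : ∫ x, θ₀ x ∂torusMeasure d = 0
  norm_lower : ENNReal.ofReal M⁻¹ ≤ l2Norm θ₀
  norm_upper : l2Norm θ₀ ≤ ENNReal.ofReal M
  gradient : ∃ G : Space d → Space d, IsWeakGradient θ₀ G ∧
    ENNReal.ofReal M⁻¹ ≤ eLpNorm G 2 (torusMeasure d) ∧
    eLpNorm G 2 (torusMeasure d) ≤ ENNReal.ofReal M

/-- `θ` is the (weakly continuous in time) distributional solution, in the class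
`L^∞_loc([0,∞); L²(𝕋^d))`, of `∂ₜθ + u·∇θ = κ Δθ` with initial datum `θ₀`, for a divergence-free
`u`. For `κ = 0` this is the transport equation. -/
structure IsSolution {d : ℕ} (κ : ℝ) (u : ℝ → Space d → Space d) (θ₀ : Space d → ℝ)
    (θ : ℝ → Space d → ℝ) : Prop where
  measurable : Measurable (Function.uncurry θ)
  periodic : ∀ t, 0 ≤ t → IsPeriodic (θ t)
  bounded : ∀ T : ℝ, ∃ K : ℝ≥0, ∀ t ∈ Icc 0 T, l2Norm (θ t) ≤ K
  equation : ∀ φ : Space d → ℝ, IsTestFunction φ → ∀ t, 0 ≤ t →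
    ∫ x, θ t x * φ x ∂torusMeasure d =
      (∫ x, θ₀ x * φ x ∂torusMeasure d) +
        ∫ τ in (0 : ℝ)..t, ∫ x, θ τ x *
          (⟪u τ x, gradient φ x⟫_ℝ + κ * Laplacian.laplacian φ x) ∂torusMeasure d

/-- The exponent `(s-1)/s = 1 - 1/s`, with value `1` at `s = ∞`. -/
def timeExponent (s : ℝ≥0∞) : ℝ := 1 - (s⁻¹).toReal

open Classical in
/-- The time scale `T_{κ,s}`: `(log (1/κ))^{s/(s-1)}` if `s > 1`, and `1/κ` if `s = 1`. -/
def timeScale (κ : ℝ) (s : ℝ≥0∞) : ℝ :=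
  if s = 1 then 1 / κ else Real.log (1 / κ) ^ (timeExponent s)⁻¹

/-- `‖θ(t)‖_{Ḣ^{-1}} ≤ C e^{-A t^{(s-1)/s}}` for `0 ≤ t ≤ T`. -/
def HNegOneUpperBound {d : ℕ} (s : ℝ≥0∞) (A C T : ℝ) (θ : ℝ → Space d → ℝ) : Prop :=
  ∀ t, 0 ≤ t → t ≤ T →
    hNegOneNorm (θ t) ≤ ENNReal.ofReal (C * Real.exp (-(A * t ^ timeExponent s)))

/-- `e^{-A t^{(s-1)/s}} ≤ C ‖θ(t)‖_{Ḣ^{-1}}` for `0 ≤ t ≤ T`. -/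
def HNegOneLowerBound {d : ℕ} (s : ℝ≥0∞) (A C T : ℝ) (θ : ℝ → Space d → ℝ) : Prop :=
  ∀ t, 0 ≤ t → t ≤ T →
    ENNReal.ofReal (Real.exp (-(A * t ^ timeExponent s))) ≤
      ENNReal.ofReal C * hNegOneNorm (θ t)

end PassiveScalar

end

open PassiveScalar

/-! Write p = (s-1)/s. By Hölder in time the bound on `∇u` gives `∫₀ᵗ ‖∇u‖_{L^∞} ≤ t^p`, so every
functional whose logarithm grows at rate at most `2‖∇u‖_{L^∞}` gains at most the factor `exp(2 t^p)`
by time t. Two functionals are controlled in this way.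

The difference `w = θ^κ - θ` starts from zero and solves `∂ₜw + div(u w) = κΔθ^κ`. In `Ḣ⁻¹` the
transport term costs the rate `2‖∇u‖_{L^∞}`, and the forcing pairs with `(-Δ)⁻¹w` to give `κ⟨θ^κ,
w⟩`, which the `L²` bounds control. Grönwall yields `‖w(t)‖²_{Ḣ⁻¹} ≤ 4M² κt exp(2 t^p)`
(`IsSolution.weightedEnergy_sub_le`). Up to a small multiple of `T_{κ,s}`, the quantity `κt
exp((2+2A) t^p)` is as small as desired (`exists_mul_exp_le_of_le_timeScale`), so `w` is small
compared with `exp(-A t^p)` in `Ḣ⁻¹`, and bounds pass from `θ` to `θ^κ` in both directions. For the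
third claim, the Dirichlet energy of `θ^κ` is at most `M² exp(2 t^p)`, so the total dissipation is
at most `2κt M² exp(2 t^p)`, again small (`IsSolution.le_integral_sq`).

Since solutions are merely weak `L²` solutions and `u` is merely Lipschitz, both estimates rest on
one regularised balance, `IsForcedSolution.abs_energy_balance_le`. The equation is tested with `ψ =
m(D)f`, where `(a - εΔ)ψ = f`. In `∫ f u·∇ψ` the part `a ∫ ψ u·∇ψ` vanishes, and the rest is `-ε ∫
Δψ u·∇ψ`, bounded by `ε‖∇u‖_{L^∞}‖∇ψ‖²` after integration by parts. The choice a = 0, ε = 1 gives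
`Ḣ⁻¹`; a = 1 with small ε gives the energy inequality and the growth of the Dirichlet energy. The
balance is proved on finitely many Fourier modes, then passed to the limit. -/

noncomputable section

namespace PassiveScalar

open Filter Topology

section

variable {d : ℕ}

/-! ### The periodic box and the torus -/

/-- The quotient map `ℝ^d → 𝕋^d`. -/
def toTorus (x : Space d) : UnitAddTorus (Fin d) := fun i => (x i : UnitAddCircle)

/-- The section of `toTorus` with values in the box `[0,1)^d`. -/
def torusSection (z : UnitAddTorus (Fin d)) : Space d :=
  WithLp.toLp 2 (fun i => ((AddCircle.equivIco 1 0 (z i) : Ico (0 : ℝ) (0 + 1)) : ℝ))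

lemma toTorus_add (x y : Space d) : toTorus (x + y) = toTorus x + toTorus y := by
  funext i; simp [toTorus]

lemma measurable_toTorus : Measurable (toTorus (d := d)) :=
  measurable_pi_lambda _ fun i => AddCircle.measurable_mk'.comp
    ((measurable_pi_apply i).comp (WithLp.measurable_ofLp 2 _))

lemma measurable_torusSection : Measurable (torusSection (d := d)) :=
  (WithLp.measurable_toLp 2 _).comp (measurable_pi_lambda _ fun i =>
    measurable_subtype_coe.comp
      ((AddCircle.measurableEquivIco 1 0).measurable.comp (measurable_pi_apply i)))

lemma toTorus_torusSection (z : UnitAddTorus (Fin d)) : toTorus (torusSection z) = z := by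
  funext i
  exact AddCircle.coe_equivIco

lemma torusSection_toTorus_of_mem {x : Space d} (hx : x ∈ box d) :
    torusSection (toTorus x) = x := by
  ext i
  exact AddCircle.equivIco_coe_of_mem (by simpa using hx i)

lemma exists_eq_add_latticePoint {x y : Space d} (h : toTorus x = toTorus y) :
    ∃ k : Fin d → ℤ, y = x + latticePoint k := by
  have h1 : ∀ i, ∃ k : ℤ, y i = x i + k := by
    intro i
    have h2 : (y i : UnitAddCircle) = x i := (congrFun h i).symm
    have h3 : ((y i - x i : ℝ) : UnitAddCircle) = 0 := by
      rw [AddCircle.coe_sub, h2, sub_self]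
    obtain ⟨k, hk⟩ := (AddCircle.coe_eq_zero_iff (1 : ℝ)).1 h3
    exact ⟨k, by simp at hk; linarith⟩
  choose k hk using h1
  exact ⟨k, by ext i; simpa [latticePoint] using hk i⟩

lemma IsPeriodic.comp_torusSection {α : Type*} {f : Space d → α} (hf : IsPeriodic f)
    (x : Space d) : f (torusSection (toTorus x)) = f x := by
  obtain ⟨k, hk⟩ := exists_eq_add_latticePoint (toTorus_torusSection (toTorus x))
  conv_rhs => rw [hk, hf]

lemma measurableSet_box : MeasurableSet (box d) := by
  have : box d = ⋂ i, (fun x : Space d => x i) ⁻¹' Ico (0 : ℝ) 1 := by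
    ext x; simp [box]
  rw [this]
  exact MeasurableSet.iInter fun i =>
    ((measurable_pi_apply i).comp (WithLp.measurable_ofLp 2 _)) measurableSet_Ico

/-- The Haar probability measure of the torus. -/
def haarTorus (d : ℕ) : Measure (UnitAddTorus (Fin d)) :=
  Measure.pi fun _ : Fin d => AddCircle.haarAddCircle

instance : IsProbabilityMeasure (haarTorus d) := by unfold haarTorus; infer_instance

instance : (haarTorus d).IsAddRightInvariant := by unfold haarTorus; infer_instance

/-- Transfers integrals over the box to the compact group, where translation invariance and
Parseval's identity hold. Half-open intervals of either kind give the same measure. -/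
lemma measurePreserving_toTorus :
    MeasurePreserving (toTorus (d := d)) (torusMeasure d) (haarTorus d) := by
  have h1 : MeasurePreserving (fun x : Space d => (x : Fin d → ℝ)) (torusMeasure d)
      (Measure.pi fun _ : Fin d => (volume : Measure ℝ).restrict (Ioc 0 (0 + 1))) := by
    have := (PiLp.volume_preserving_ofLp (Fin d)).restrict_preimage
      (s := Set.pi univ fun _ : Fin d => Ico (0 : ℝ) 1)
      (MeasurableSet.univ_pi fun _ => measurableSet_Ico)
    rw [volume_pi, Measure.restrict_pi_pi] at this
    have h2 : (fun x : Space d => (x : Fin d → ℝ)) ⁻¹'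
      (Set.pi univ fun _ : Fin d => Ico (0 : ℝ) 1) = box d := by
      ext x; simp [box]
    rw [h2] at this
    simpa [restrict_Ico_eq_restrict_Ioc, torusMeasure] using this
  have h3 := measurePreserving_pi (fun _ : Fin d => (volume : Measure ℝ).restrict (Ioc 0 (0 + 1)))
    (fun _ => (volume : Measure UnitAddCircle)) (fun _ => UnitAddCircle.measurePreserving_mk 0)
  have h4 : (volume : Measure UnitAddCircle) = AddCircle.haarAddCircle := by
    rw [AddCircle.volume_eq_smul_haarAddCircle]; simp
  rw [h4] at h3
  exact h3.comp h1

instance : IsProbabilityMeasure (torusMeasure d) := by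
  refine ⟨?_⟩
  have h : torusMeasure d (toTorus ⁻¹' univ) = 1 := by
    rw [measurePreserving_toTorus.measure_preimage MeasurableSet.univ.nullMeasurableSet]
    simp
  simpa using h

lemma ae_torusSection_toTorus :
    ∀ᵐ x ∂torusMeasure d, torusSection (toTorus x) = x := by
  rw [torusMeasure, ae_restrict_iff' measurableSet_box]
  exact ae_of_all _ fun x hx => torusSection_toTorus_of_mem hx

lemma measurePreserving_torusSection :
    MeasurePreserving (torusSection (d := d)) (haarTorus d) (torusMeasure d) := by
  refine ⟨measurable_torusSection, ?_⟩
  rw [← measurePreserving_toTorus.map_eq, Measure.map_map measurable_torusSection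
    measurable_toTorus]
  conv_rhs => rw [← Measure.map_id (μ := torusMeasure d)]
  exact Measure.map_congr ae_torusSection_toTorus

/-- The integral of a periodic function over the box is translation invariant. -/
lemma integral_comp_add_of_isPeriodic {F : Type*} [NormedAddCommGroup F] [NormedSpace ℝ F]
    {f : Space d → F} (hf : IsPeriodic f) (hm : StronglyMeasurable f) (y : Space d) :
    ∫ x, f (x + y) ∂torusMeasure d = ∫ x, f x ∂torusMeasure d := by
  have hm' : StronglyMeasurable (f ∘ torusSection) := hm.comp_measurable measurable_torusSection
  have key : ∀ y : Space d, ∫ x, f (x + y) ∂torusMeasure d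
      = ∫ z, (f ∘ torusSection) (z + toTorus y) ∂haarTorus d := by
    intro y
    rw [← measurePreserving_toTorus.map_eq, integral_map (φ := toTorus) measurable_toTorus.aemeasurable
      (f := fun z => (f ∘ torusSection) (z + toTorus y))
      (hm'.comp_measurable (measurable_add_const _)).aestronglyMeasurable]
    refine integral_congr_ae (ae_of_all _ fun x => ?_)
    simp only [Function.comp, ← toTorus_add]
    exact (hf.comp_torusSection _).symm
  rw [key y, integral_add_right_eq_self (f ∘ torusSection)]
  have := key 0
  rw [integral_add_right_eq_self (f ∘ torusSection)] at this
  simpa using this.symm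

/-- The torus measure and Lebesgue measure have the same null sets among periodic sets. -/
lemma ae_torusMeasure_of_ae {p : Space d → Prop} (h : ∀ᵐ x, p x) : ∀ᵐ x ∂torusMeasure d, p x :=
  ae_restrict_of_ae h

/-! ### Fourier coefficients -/

/-- The index set of the real trigonometric functions `cos (2π k·x)` and `sin (2π k·x)`. -/
abbrev WaveIndex (d : ℕ) : Type := (Fin d → ℤ) × Bool

/-- The phase of a real trigonometric function. -/
def wavePhase (b : Bool) : ℝ := if b then Real.pi / 2 else 0

/-- The functions `cos (2π k·x)` and `sin (2π k·x)`. -/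
def wave (j : WaveIndex d) (x : Space d) : ℝ :=
  Real.cos (2 * Real.pi * ⟪latticePoint j.1, x⟫_ℝ - wavePhase j.2)

/-- The coefficient of `f` with respect to a real trigonometric function. -/
def waveCoeff (f : Space d → ℝ) (j : WaveIndex d) : ℝ := ∫ x, f x * wave j x ∂torusMeasure d

lemma wave_false (k : Fin d → ℤ) (x : Space d) :
    wave (k, false) x = Real.cos (2 * Real.pi * ⟪latticePoint k, x⟫_ℝ) := by
  simp [wave, wavePhase]

lemma wave_true (k : Fin d → ℤ) (x : Space d) :
    wave (k, true) x = Real.sin (2 * Real.pi * ⟪latticePoint k, x⟫_ℝ) := by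
  simp [wave, wavePhase, Real.cos_sub]

lemma abs_wave_le_one (j : WaveIndex d) (x : Space d) : |wave j x| ≤ 1 := Real.abs_cos_le_one _

lemma contDiff_wave (j : WaveIndex d) : ContDiff ℝ ∞ (wave j) := by
  unfold wave
  exact Real.contDiff_cos.comp ((contDiff_const.mul (contDiff_const.inner ℝ contDiff_id)).sub
    contDiff_const)

lemma continuous_wave (j : WaveIndex d) : Continuous (wave j) := (contDiff_wave j).continuous

lemma integrable_mul_wave {f : Space d → ℝ} (hf : Integrable f (torusMeasure d))
    (j : WaveIndex d) : Integrable (fun x => f x * wave j x) (torusMeasure d) :=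
  hf.mul_bdd (c := 1) (continuous_wave j).aestronglyMeasurable
    (ae_of_all _ fun x => abs_wave_le_one j x)

lemma inner_latticePoint (k : Fin d → ℤ) (x : Space d) :
    ⟪latticePoint k, x⟫_ℝ = ∑ i, (k i : ℝ) * x i := by
  simp [latticePoint, PiLp.inner_apply, mul_comm]

lemma mFourier_toTorus (k : Fin d → ℤ) (x : Space d) :
    UnitAddTorus.mFourier k (toTorus x)
      = Complex.exp ((2 * Real.pi * ⟪latticePoint k, x⟫_ℝ : ℝ) * Complex.I) := by
  simp only [UnitAddTorus.mFourier, ContinuousMap.coe_mk, toTorus, fourier_coe_apply,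
    ← Complex.exp_sum, inner_latticePoint]
  congr 1
  push_cast
  rw [Finset.mul_sum, Finset.sum_mul]
  refine Finset.sum_congr rfl fun i _ => ?_
  ring

lemma fourierCoefficient_eq {f : Space d → ℝ} (hf : Integrable f (torusMeasure d))
    (k : Fin d → ℤ) :
    fourierCoefficient f k = waveCoeff f (k, false) - waveCoeff f (k, true) * Complex.I := by
  unfold fourierCoefficient waveCoeff
  rw [← integral_complex_ofReal, ← integral_complex_ofReal, ← integral_mul_const, ← integral_sub]
  · refine integral_congr_ae (ae_of_all _ fun x => ?_)
    simp only [wave_false, wave_true]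
    rw [Complex.exp_mul_I, Complex.cos_neg, Complex.sin_neg]
    push_cast
    ring
  · exact (integrable_mul_wave hf _).ofReal
  · exact (integrable_mul_wave hf _).ofReal.mul_const _

lemma norm_fourierCoefficient_sq {f : Space d → ℝ} (hf : Integrable f (torusMeasure d))
    (k : Fin d → ℤ) :
    ‖fourierCoefficient f k‖ ^ 2 = waveCoeff f (k, false) ^ 2 + waveCoeff f (k, true) ^ 2 := by
  rw [fourierCoefficient_eq hf, ← Complex.normSq_eq_norm_sq, Complex.normSq_apply]
  simp
  ring

/-- Parseval on the group torus, pulled back along the measure-preserving section. -/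
lemma hasSum_norm_fourierCoefficient_sq {f : Space d → ℝ} (hf : MemLp f 2 (torusMeasure d)) :
    HasSum (fun k => ‖fourierCoefficient f k‖ ^ 2) (∫ x, f x ^ 2 ∂torusMeasure d) := by
  set g : UnitAddTorus (Fin d) → ℂ := fun z => (f (torusSection z) : ℂ) with hg
  have hgm : MemLp g 2 (haarTorus d) :=
    (hf.ofReal (K := ℂ)).comp_measurePreserving measurePreserving_torusSection
  have key := UnitAddTorus.hasSum_sq_mFourierCoeff (hgm.toLp g)
  have e1 : ∫ t, ‖hgm.toLp g t‖ ^ 2 ∂haarTorus d = ∫ x, f x ^ 2 ∂torusMeasure d := by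
    rw [← measurePreserving_torusSection.map_eq, integral_map
      measurable_torusSection.aemeasurable]
    · refine integral_congr_ae ?_
      filter_upwards [hgm.coeFn_toLp] with z hz
      rw [hz, hg]; simp
    · rw [measurePreserving_torusSection.map_eq]
      exact hf.1.pow 2
  have e2 : ∀ k, UnitAddTorus.mFourierCoeff (hgm.toLp g) k = fourierCoefficient f k := by
    intro k
    unfold UnitAddTorus.mFourierCoeff fourierCoefficient
    rw [← measurePreserving_torusSection.map_eq, integral_map
      measurable_torusSection.aemeasurable]
    · refine integral_congr_ae ?_
      filter_upwards [hgm.coeFn_toLp] with z hz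
      rw [hz, hg, smul_eq_mul, mul_comm]
      congr 1
      conv_lhs => rw [← toTorus_torusSection z, mFourier_toTorus]
      congr 3
      simp [inner_latticePoint]
    · rw [measurePreserving_torusSection.map_eq]
      refine (hf.ofReal (K := ℂ)).1.mul (Continuous.aestronglyMeasurable ?_)
      fun_prop
  simp only [← e2]
  rw [← e1]
  exact key

/-- Parseval's identity for the real trigonometric functions. -/
lemma hasSum_waveCoeff_sq {f : Space d → ℝ} (hf : MemLp f 2 (torusMeasure d)) :
    HasSum (fun j => waveCoeff f j ^ 2) (∫ x, f x ^ 2 ∂torusMeasure d) := by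
  have hfi : Integrable f (torusMeasure d) := hf.integrable (by norm_num)
  have h1 := hasSum_norm_fourierCoefficient_sq hf
  -- Each frequency contributes one cosine and one sine square. The waves of k and -k agree up to
  -- sign, so the system is a Parseval frame and not an orthonormal basis; this redundancy replaces
  -- the usual factor √2.
  simp only [norm_fourierCoefficient_sq hfi] at h1
  have h2 : Summable (fun j : WaveIndex d => waveCoeff f j ^ 2) := by
    rw [summable_prod_of_nonneg (fun j => sq_nonneg _)]
    refine ⟨fun k => Summable.of_finite, ?_⟩
    refine h1.summable.congr fun k => ?_
    simp [tsum_fintype, add_comm]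
  have h3 := h2.hasSum.prod_fiberwise (g := fun k => waveCoeff f (k, false) ^ 2 +
    waveCoeff f (k, true) ^ 2) (fun k => by
      have := hasSum_fintype (fun b => waveCoeff f (k, b) ^ 2)
      simpa [add_comm] using this)
  rw [h1.unique h3]
  exact h2.hasSum

end

section

variable {d : ℕ}

/-! ### Periodic functions -/

lemma IsPeriodic.exists_norm_le {F : Type*} [NormedAddCommGroup F] {f : Space d → F}
    (hf : IsPeriodic f) (hc : Continuous f) : ∃ C, ∀ x, ‖f x‖ ≤ C := by
  have hK : IsCompact ((WithLp.toLp 2 : (Fin d → ℝ) → Space d) ''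
      (Set.pi univ fun _ => Icc (0 : ℝ) 1)) :=
    (isCompact_univ_pi fun _ => isCompact_Icc).image (PiLp.continuous_toLp 2 _)
  obtain ⟨C, hC⟩ := hK.exists_bound_of_continuousOn hc.continuousOn
  refine ⟨C, fun x => ?_⟩
  rw [← hf.comp_torusSection x]
  refine hC _ ⟨_, fun i _ => ?_, rfl⟩
  have := (AddCircle.equivIco 1 0 (toTorus x i)).2
  exact ⟨this.1, by simpa using this.2.le⟩

lemma IsPeriodic.fderiv {F : Type*} [NormedAddCommGroup F] [NormedSpace ℝ F] {f : Space d → F}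
    (hf : IsPeriodic f) : IsPeriodic (fderiv ℝ f) := by
  intro x k
  rw [← fderiv_comp_add_right]
  congr 1
  funext y
  exact hf y k

lemma IsPeriodic.exists_lipschitz {F : Type*} [NormedAddCommGroup F] [NormedSpace ℝ F]
    {f : Space d → F} (hf : IsPeriodic f) (hc : ContDiff ℝ 1 f) :
    ∃ C, ∀ x y, ‖f x - f y‖ ≤ C * ‖x - y‖ := by
  obtain ⟨C, hC⟩ := hf.fderiv.exists_norm_le (hc.continuous_fderiv one_ne_zero)
  refine ⟨C, fun x y => ?_⟩
  exact Convex.norm_image_sub_le_of_norm_fderiv_le (𝕜 := ℝ) (s := univ)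
    (fun z _ => (hc.differentiable one_ne_zero) z) (fun z _ => hC z) convex_univ (mem_univ _)
    (mem_univ _)

/-- Integration by parts on the torus, for a Lipschitz and a smooth vector field. -/
lemma integral_fderiv_inner_add_eq_zero {v W : Space d → Space d} {K : ℝ≥0}
    (hv : LipschitzWith K v) (hvp : IsPeriodic v) (hW : ContDiff ℝ 1 W) (hWp : IsPeriodic W)
    (e : Space d) :
    Integrable (fun x => ⟪fderiv ℝ v x e, W x⟫_ℝ + ⟪v x, fderiv ℝ W x e⟫_ℝ) (torusMeasure d) ∧
    ∫ x, (⟪fderiv ℝ v x e, W x⟫_ℝ + ⟪v x, fderiv ℝ W x e⟫_ℝ) ∂torusMeasure d = 0 := by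
  obtain ⟨Cv, hCv⟩ := hvp.exists_norm_le hv.continuous
  obtain ⟨CW, hCW⟩ := hWp.exists_norm_le hW.continuous
  obtain ⟨L, hL⟩ := hWp.exists_lipschitz hW
  obtain ⟨CDW, hCDW⟩ := hWp.fderiv.exists_norm_le (hW.continuous_fderiv one_ne_zero)
  have hCv0 : 0 ≤ Cv := (norm_nonneg _).trans (hCv 0)
  have hint0 : Integrable (fun x => ⟪fderiv ℝ v x e, W x⟫_ℝ + ⟪v x, fderiv ℝ W x e⟫_ℝ)
      (torusMeasure d) := by
    refine Integrable.add ?_ ?_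
    · refine Integrable.of_bound (C := K * ‖e‖ * CW) ?_ (ae_of_all _ fun x => ?_)
      · exact ((measurable_fderiv_apply_const ℝ v e).inner
          hW.continuous.measurable).aestronglyMeasurable
      · refine (norm_inner_le_norm _ _).trans ?_
        gcongr
        · exact (ContinuousLinearMap.le_opNorm _ _).trans
            (by gcongr; exact norm_fderiv_le_of_lipschitz ℝ hv)
        · exact hCW x
    · refine Integrable.of_bound (C := Cv * (CDW * ‖e‖)) (Continuous.aestronglyMeasurable ?_)
        (ae_of_all _ fun x => ?_)
      · exact hv.continuous.inner ((hW.continuous_fderiv one_ne_zero).clm_apply continuous_const)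
      · refine (norm_inner_le_norm _ _).trans ?_
        gcongr
        · exact hCv x
        · exact (ContinuousLinearMap.le_opNorm _ _).trans (by gcongr; exact hCDW x)
  refine ⟨hint0, ?_⟩
  set P : Space d → ℝ := fun x => ⟪v x, W x⟫_ℝ with hP
  have hPc : Continuous P := hv.continuous.inner hW.continuous
  have hPp : IsPeriodic P := fun x k => by simp only [hP, hvp x k, hWp x k]
  have hPL : ∀ x y, |P x - P y| ≤ (K * CW + Cv * L) * ‖x - y‖ := by
    intro x y
    have e1 : P x - P y = ⟪v x - v y, W x⟫_ℝ + ⟪v y, W x - W y⟫_ℝ := by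
      simp only [hP, inner_sub_left, inner_sub_right]; ring
    rw [e1]
    have h1 : |⟪v x - v y, W x⟫_ℝ| ≤ (K * ‖x - y‖) * CW :=
      (abs_real_inner_le_norm _ _).trans (mul_le_mul (hv.norm_sub_le x y) (hCW x)
        (norm_nonneg _) (by positivity))
    have h2 : |⟪v y, W x - W y⟫_ℝ| ≤ Cv * (L * ‖x - y‖) :=
      (abs_real_inner_le_norm _ _).trans (mul_le_mul (hCv y) (hL x y)
        (norm_nonneg _) ((norm_nonneg _).trans (hCv y)))
    calc _ ≤ _ := abs_add_le _ _
      _ ≤ _ := add_le_add h1 h2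
      _ = _ := by ring
  -- The product `P` is only Lipschitz, so its derivative is reached through difference quotients
  -- with step `1 / c n`.
  set c : ℕ → ℝ := fun n => (n : ℝ) + 1
  have hc : Tendsto (fun n => ‖c n‖) atTop atTop := by
    refine (tendsto_norm_atTop_atTop).comp ?_
    exact tendsto_atTop_add_const_right _ _ tendsto_natCast_atTop_atTop
  have hc0 : ∀ n, 0 < c n := fun n => by positivity
  have hint : Integrable P (torusMeasure d) := by
    obtain ⟨CP, hCP⟩ := hPp.exists_norm_le hPc
    exact Integrable.of_bound hPc.aestronglyMeasurable CP (ae_of_all _ hCP)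
  -- Translation invariance makes the mean of every difference quotient vanish.
  have hzero : ∀ n, ∫ x, c n • (P (x + (c n)⁻¹ • e) - P x) ∂torusMeasure d = 0 := by
    intro n
    have hint' : Integrable (fun x => P (x + (c n)⁻¹ • e)) (torusMeasure d) := by
      obtain ⟨CP, hCP⟩ := hPp.exists_norm_le hPc
      exact Integrable.of_bound (hPc.comp (continuous_add_const _)).aestronglyMeasurable CP
        (ae_of_all _ fun x => hCP _)
    rw [integral_smul, integral_sub hint' hint,
      integral_comp_add_of_isPeriodic hPp hPc.stronglyMeasurable, sub_self, smul_zero]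
  have hlim : Tendsto (fun n => ∫ x, c n • (P (x + (c n)⁻¹ • e) - P x) ∂torusMeasure d) atTop
      (𝓝 (∫ x, (⟪fderiv ℝ v x e, W x⟫_ℝ + ⟪v x, fderiv ℝ W x e⟫_ℝ) ∂torusMeasure d)) := by
    refine tendsto_integral_of_dominated_convergence (fun _ => (K * CW + Cv * L) * ‖e‖) ?_
      (integrable_const _) ?_ ?_
    · intro n
      exact (Continuous.aestronglyMeasurable (by fun_prop))
    · intro n
      refine ae_of_all _ fun x => ?_
      rw [norm_smul, Real.norm_of_nonneg (hc0 n).le, Real.norm_eq_abs]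
      have := hPL (x + (c n)⁻¹ • e) x
      rw [add_sub_cancel_left, norm_smul, norm_inv, Real.norm_of_nonneg (hc0 n).le] at this
      calc _ ≤ c n * ((K * CW + Cv * L) * ((c n)⁻¹ * ‖e‖)) :=
            mul_le_mul_of_nonneg_left this (hc0 n).le
        _ = _ := by field_simp [(hc0 n).ne']
    -- Rademacher's theorem gives the pointwise limit almost everywhere; the Lipschitz constant of
    -- `P` dominates.
    · filter_upwards [ae_torusMeasure_of_ae hv.ae_differentiableAt] with x hx
      have h1 : HasFDerivAt P _ x := hx.hasFDerivAt.inner ℝ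
        ((hW.differentiable one_ne_zero) x).hasFDerivAt
      have := h1.lim (v := e) (c := c) hc
      convert this using 2
      simp [add_comm]
  simp only [hzero] at hlim
  exact tendsto_nhds_unique hlim tendsto_const_nhds

/-! ### Test functions -/

lemma inner_gradient {f : Space d → ℝ} (x y : Space d) :
    ⟪gradient f x, y⟫_ℝ = fderiv ℝ f x y := by
  simp [gradient]

lemma contDiff_gradient {f : Space d → ℝ} (hf : ContDiff ℝ ∞ f) : ContDiff ℝ ∞ (gradient f) :=
  (InnerProductSpace.toDual ℝ (Space d)).symm.contDiff.comp (hf.fderiv_right (m := ∞) le_rfl)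

lemma IsPeriodic.gradient {f : Space d → ℝ} (hf : IsPeriodic f) : IsPeriodic (gradient f) := by
  intro x k
  simp only [_root_.gradient, hf.fderiv x k]

lemma inner_fderiv_gradient {f : Space d → ℝ} (hf : ContDiff ℝ ∞ f) (x y z : Space d) :
    ⟪fderiv ℝ (gradient f) x y, z⟫_ℝ = fderiv ℝ (fderiv ℝ f) x y z := by
  have h : DifferentiableAt ℝ (fderiv ℝ f) x :=
    ((hf.fderiv_right (m := 1) (by norm_cast)).differentiable one_ne_zero) x
  have h1 : HasFDerivAt (fun x => ⟪gradient f x, z⟫_ℝ) _ x :=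
    ((((contDiff_gradient hf).differentiable (by simp)) x).hasFDerivAt).inner ℝ
      (hasFDerivAt_const z x)
  have h2 : HasFDerivAt (fun x => ⟪gradient f x, z⟫_ℝ)
      ((ContinuousLinearMap.apply ℝ ℝ z).comp (fderiv ℝ (fderiv ℝ f) x)) x := by
    simp only [inner_gradient]
    exact ((ContinuousLinearMap.apply ℝ ℝ z).hasFDerivAt (x := fderiv ℝ f x)).comp x h.hasFDerivAt
  have := congrArg (fun A : Space d →L[ℝ] ℝ => A y) (h1.unique h2)
  simpa using this

lemma inner_fderiv_gradient_symm {f : Space d → ℝ} (hf : ContDiff ℝ ∞ f) (x y z : Space d) :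
    ⟪fderiv ℝ (gradient f) x y, z⟫_ℝ = ⟪fderiv ℝ (gradient f) x z, y⟫_ℝ := by
  rw [inner_fderiv_gradient hf, inner_fderiv_gradient hf]
  have : IsSymmSndFDerivAt ℝ f x := (hf.contDiffAt).isSymmSndFDerivAt (by simp; exact ENat.LEInfty.out)
  exact this.eq y z

lemma laplacian_eq_sum_inner {f : Space d → ℝ} (hf : ContDiff ℝ ∞ f) (x : Space d) :
    Laplacian.laplacian f x = ∑ i, ⟪fderiv ℝ (gradient f) x (EuclideanSpace.basisFun (Fin d) ℝ i),
      EuclideanSpace.basisFun (Fin d) ℝ i⟫_ℝ := by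
  rw [InnerProductSpace.laplacian_eq_iteratedFDeriv_orthonormalBasis f
    (EuclideanSpace.basisFun (Fin d) ℝ)]
  refine Finset.sum_congr rfl fun i _ => ?_
  rw [inner_fderiv_gradient hf, iteratedFDeriv_two_apply]
  rfl

/-- The integrand is half of `v·∇(ψ²)`, so it is annihilated by the divergence-free condition. -/
lemma IsTestFunction.integral_inner_mul_self {v : Space d → Space d}
    (hdiv : ∀ φ : Space d → ℝ, IsTestFunction φ → ∫ x, ⟪v x, gradient φ x⟫_ℝ ∂torusMeasure d = 0)
    {ψ : Space d → ℝ} (hψ : IsTestFunction ψ) :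
    ∫ x, ψ x * ⟪v x, gradient ψ x⟫_ℝ ∂torusMeasure d = 0 := by
  have h := hdiv (fun x => ψ x * ψ x)
    ⟨hψ.smooth.mul hψ.smooth, fun x k => by simp only [hψ.periodic x k]⟩
  have e : ∀ x, ⟪v x, gradient (fun x => ψ x * ψ x) x⟫_ℝ = 2 * (ψ x * ⟪v x, gradient ψ x⟫_ℝ) := by
    intro x
    have hd : DifferentiableAt ℝ ψ x := hψ.smooth.differentiable (by simp) x
    rw [real_inner_comm, inner_gradient, real_inner_comm, inner_gradient, fderiv_fun_mul hd hd]
    simp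
    ring
  simp only [e, integral_const_mul] at h
  linarith

/-! ### The gradient bound and the commutator estimate. -/

lemma gradSupNorm_le {v : Space d → Space d} {K : ℝ≥0} (hv : LipschitzWith K v) :
    gradSupNorm v ≤ K := by
  refine essSup_le_of_ae_le _ (ae_of_all _ fun x => ?_)
  rw [← ENNReal.ofReal_coe_nnreal]
  exact ENNReal.ofReal_le_ofReal (norm_fderiv_le_of_lipschitz ℝ hv)

lemma ae_norm_fderiv_le {v : Space d → Space d} {K : ℝ≥0} (hv : LipschitzWith K v) :
    ∀ᵐ x ∂torusMeasure d, ‖fderiv ℝ v x‖ ≤ (gradSupNorm v).toReal := by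
  have h := ae_le_essSup (μ := torusMeasure d) (f := fun x => ENNReal.ofReal ‖fderiv ℝ v x‖)
  filter_upwards [h] with x hx
  exact (ENNReal.ofReal_le_iff_le_toReal
    (ne_top_of_le_ne_top ENNReal.coe_ne_top (gradSupNorm_le hv))).1 hx

/-- The commutator estimate: for a Lipschitz divergence-free field `v`,
`|∫ (v·∇ψ) Δψ| ≤ ‖∇v‖_{L^∞} ‖∇ψ‖_{L²}²`. -/
lemma IsTestFunction.abs_integral_inner_mul_laplacian_le {v : Space d → Space d} {K : ℝ≥0}
    (hv : LipschitzWith K v) (hvp : IsPeriodic v)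
    (hdiv : ∀ φ : Space d → ℝ, IsTestFunction φ → ∫ x, ⟪v x, gradient φ x⟫_ℝ ∂torusMeasure d = 0)
    {ψ : Space d → ℝ} (hψ : IsTestFunction ψ) :
    |∫ x, Laplacian.laplacian ψ x * ⟪v x, gradient ψ x⟫_ℝ ∂torusMeasure d|
      ≤ (gradSupNorm v).toReal * ∫ x, ‖gradient ψ x‖ ^ 2 ∂torusMeasure d := by
  set D := gradient ψ with hD
  have hDs : ContDiff ℝ ∞ D := contDiff_gradient hψ.smooth
  have hDp : IsPeriodic D := hψ.periodic.gradient
  have hDd : ∀ x, HasFDerivAt D (fderiv ℝ D x) x := fun x =>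
    (hDs.differentiable (by simp) x).hasFDerivAt
  have hDDc : Continuous (fderiv ℝ D) := hDs.continuous_fderiv (by simp)
  set b := EuclideanSpace.basisFun (Fin d) ℝ
  obtain ⟨CD, hCD⟩ := hDp.exists_norm_le hDs.continuous
  obtain ⟨CDD, hCDD⟩ := hDp.fderiv.exists_norm_le hDDc
  obtain ⟨Cv, hCv⟩ := hvp.exists_norm_le hv.continuous
  have hCD0 : 0 ≤ CD := (norm_nonneg _).trans (hCD 0)
  have hCv0 : 0 ≤ Cv := (norm_nonneg _).trans (hCv 0)
  have hCDD0 : 0 ≤ CDD := (norm_nonneg _).trans (hCDD 0)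
  have i1 : Integrable (fun x => ⟪fderiv ℝ v x (D x), D x⟫_ℝ) (torusMeasure d) := by
    refine Integrable.of_bound (C := K * CD * CD) ?_ (ae_of_all _ fun x => ?_)
    · have hm : Measurable (fun x => fderiv ℝ v x (D x)) :=
        (isBoundedBilinearMap_apply.continuous.measurable).comp
          ((measurable_fderiv ℝ v).prodMk hDs.continuous.measurable)
      exact (hm.inner hDs.continuous.measurable).aestronglyMeasurable
    · refine (norm_inner_le_norm _ _).trans ?_
      gcongr
      · refine (ContinuousLinearMap.le_opNorm _ _).trans ?_
        gcongr
        · exact norm_fderiv_le_of_lipschitz ℝ hv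
        · exact hCD x
      · exact hCD x
  have i2 : Integrable (fun x => ⟪v x, fderiv ℝ D x (D x)⟫_ℝ) (torusMeasure d) := by
    refine Integrable.of_bound (C := Cv * (CDD * CD)) (Continuous.aestronglyMeasurable ?_)
      (ae_of_all _ fun x => ?_)
    · exact hv.continuous.inner (hDDc.clm_apply hDs.continuous)
    · refine (norm_inner_le_norm _ _).trans ?_
      gcongr
      · exact hCv x
      · refine (ContinuousLinearMap.le_opNorm _ _).trans ?_
        gcongr
        · exact hCDD x
        · exact hCD x
  have i3 : Integrable (fun x => Laplacian.laplacian ψ x * ⟪v x, D x⟫_ℝ) (torusMeasure d) := by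
    have hl : Laplacian.laplacian ψ = fun x => ∑ i, ⟪fderiv ℝ D x (b i), b i⟫_ℝ :=
      funext fun x => laplacian_eq_sum_inner hψ.smooth x
    have hlc : Continuous (Laplacian.laplacian ψ) := by
      rw [hl]
      exact continuous_finsetSum _ fun i _ =>
        (hDDc.clm_apply continuous_const).inner continuous_const
    have hlp : IsPeriodic (Laplacian.laplacian ψ) := by
      rw [hl]; intro x k; simp only [hDp.fderiv x k]
    obtain ⟨C, hC⟩ := hlp.exists_norm_le hlc
    refine Integrable.of_bound (C := C * (Cv * CD)) (Continuous.aestronglyMeasurable ?_)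
      (ae_of_all _ fun x => ?_)
    · exact hlc.mul (hv.continuous.inner hDs.continuous)
    · rw [norm_mul]
      refine mul_le_mul (hC x) ((norm_inner_le_norm _ _).trans ?_) (norm_nonneg _)
        ((norm_nonneg _).trans (hC 0))
      gcongr
      · exact hCv x
      · exact hCD x
  -- Integration by parts in direction j against the field `∂ⱼψ ∇ψ`; summing over j produces the
  -- Laplacian term together with a term in `∇v` and a Hessian term.
  have hj : ∀ j : Fin d, Integrable (fun x => ⟪fderiv ℝ v x (b j), ⟪D x, b j⟫_ℝ • D x⟫_ℝ +
      ⟪v x, fderiv ℝ (fun x => ⟪D x, b j⟫_ℝ • D x) x (b j)⟫_ℝ) (torusMeasure d) ∧ ∫ x, (⟪fderiv ℝ v x (b j), ⟪D x, b j⟫_ℝ • D x⟫_ℝ +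
      ⟪v x, fderiv ℝ (fun x => ⟪D x, b j⟫_ℝ • D x) x (b j)⟫_ℝ) ∂torusMeasure d = 0 := fun j =>
    integral_fderiv_inner_add_eq_zero (W := fun x => ⟪D x, b j⟫_ℝ • D x) hv hvp
      (((hDs.of_le (by norm_cast)).inner ℝ contDiff_const).smul (hDs.of_le (by norm_cast)))
      (fun x k => by simp only [hDp x k]) (b j)
  have hexp : ∀ x, ∑ j, (⟪fderiv ℝ v x (b j), ⟪D x, b j⟫_ℝ • D x⟫_ℝ +
      ⟪v x, fderiv ℝ (fun x => ⟪D x, b j⟫_ℝ • D x) x (b j)⟫_ℝ) =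
      ⟪fderiv ℝ v x (D x), D x⟫_ℝ + ⟪v x, fderiv ℝ D x (D x)⟫_ℝ
        + Laplacian.laplacian ψ x * ⟪v x, D x⟫_ℝ := by
    intro x
    have hlin : ∀ (A : Space d →L[ℝ] Space d) (y z : Space d),
        ∑ j, ⟪y, b j⟫_ℝ * ⟪A (b j), z⟫_ℝ = ⟪A y, z⟫_ℝ := by
      intro A y z
      conv_rhs => rw [← b.sum_repr' y]
      simp only [map_sum, map_smul, sum_inner, real_inner_smul_left]
      exact Finset.sum_congr rfl fun j _ => by rw [real_inner_comm]
    rw [laplacian_eq_sum_inner hψ.smooth x, Finset.sum_add_distrib, add_assoc]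
    congr 1
    · simp only [inner_smul_right, hlin]
    · have hdj : ∀ j, fderiv ℝ (fun x => ⟪D x, b j⟫_ℝ • D x) x (b j) =
          ⟪D x, b j⟫_ℝ • fderiv ℝ D x (b j) + ⟪fderiv ℝ D x (b j), b j⟫_ℝ • D x := by
        intro j
        have h1 : HasFDerivAt (fun x => ⟪D x, b j⟫_ℝ) _ x :=
          (hDd x).inner ℝ (hasFDerivAt_const (b j) x)
        have h2 : HasFDerivAt (fun x => ⟪D x, b j⟫_ℝ • D x) _ x := h1.smul (hDd x)
        rw [h2.fderiv]
        simp
      simp only [hdj, inner_add_right, Finset.sum_add_distrib, inner_smul_right]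
      congr 1
      · simp only [real_inner_comm _ (v x), hlin]
      · rw [Finset.sum_mul]
  have hsum : ∫ x, (⟪fderiv ℝ v x (D x), D x⟫_ℝ + ⟪v x, fderiv ℝ D x (D x)⟫_ℝ
        + Laplacian.laplacian ψ x * ⟪v x, D x⟫_ℝ) ∂torusMeasure d = 0 := by
    simp only [← hexp]
    rw [integral_finsetSum]
    · exact Finset.sum_eq_zero fun j _ => (hj j).2
    · exact fun j _ => (hj j).1
  -- By symmetry of the Hessian, `D²ψ ∇ψ` is half the gradient of `|∇ψ|²`, and a divergence-free
  -- field is orthogonal to gradients.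
  have hgrad : ∫ x, ⟪v x, fderiv ℝ D x (D x)⟫_ℝ ∂torusMeasure d = 0 := by
    have h := hdiv (fun x => ⟪D x, D x⟫_ℝ)
      ⟨hDs.inner ℝ hDs, fun x k => by simp only [hDp x k]⟩
    have e : ∀ x, ⟪v x, gradient (fun x => ⟪D x, D x⟫_ℝ) x⟫_ℝ
        = 2 * ⟪v x, fderiv ℝ D x (D x)⟫_ℝ := by
      intro x
      have h1 : HasFDerivAt (fun x => ⟪D x, D x⟫_ℝ) _ x := (hDd x).inner ℝ (hDd x)
      rw [real_inner_comm, inner_gradient, h1.fderiv]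
      have := inner_fderiv_gradient_symm hψ.smooth x (v x) (D x)
      rw [← hD] at this
      simp only [ContinuousLinearMap.comp_apply, ContinuousLinearMap.prod_apply,
        fderivInnerCLM_apply]
      rw [real_inner_comm, this, real_inner_comm]
      ring
    simp only [e, integral_const_mul] at h
    linarith
  have i12 : Integrable (fun x => ⟪fderiv ℝ v x (D x), D x⟫_ℝ + ⟪v x, fderiv ℝ D x (D x)⟫_ℝ)
    (torusMeasure d) := i1.add i2
  rw [integral_add i12 i3, integral_add i1 i2, hgrad] at hsum
  have : ∫ x, Laplacian.laplacian ψ x * ⟪v x, D x⟫_ℝ ∂torusMeasure d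
      = - ∫ x, ⟪fderiv ℝ v x (D x), D x⟫_ℝ ∂torusMeasure d := by linarith
  rw [this, abs_neg, ← integral_const_mul, ← Real.norm_eq_abs]
  have hDi : Integrable (fun x => ‖D x‖ ^ 2) (torusMeasure d) := by
    refine Integrable.of_bound (C := CD ^ 2) (Continuous.aestronglyMeasurable
      (hDs.continuous.norm.pow 2)) (ae_of_all _ fun x => ?_)
    rw [Real.norm_of_nonneg (by positivity)]
    gcongr
    exact hCD x
  refine norm_integral_le_of_norm_le (hDi.const_mul _) ?_
  filter_upwards [ae_norm_fderiv_le hv] with x hx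
  calc _ ≤ ‖fderiv ℝ v x (D x)‖ * ‖D x‖ := norm_inner_le_norm _ _
    _ ≤ (‖fderiv ℝ v x‖ * ‖D x‖) * ‖D x‖ := by gcongr; exact ContinuousLinearMap.le_opNorm _ _
    _ ≤ ((gradSupNorm v).toReal * ‖D x‖) * ‖D x‖ := by gcongr
    _ = _ := by ring

end

section

variable {d : ℕ}

/-! ### Measurability of essential suprema in time -/

/-- The essential supremum is at most c exactly when the slice of the superlevel set is null, and
the measure of slices depends measurably on the parameter. -/
lemma measurable_essSup_right {α β : Type*} [MeasurableSpace α] [MeasurableSpace β]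
    {μ : Measure β} [SFinite μ] {f : α → β → ℝ≥0∞} (hf : Measurable (Function.uncurry f)) :
    Measurable (fun t => essSup (f t) μ) := by
  refine measurable_of_Iic fun c => ?_
  have h : (fun t => essSup (f t) μ) ⁻¹' Iic c
      = {t | μ (Prod.mk t ⁻¹' {p : α × β | c < Function.uncurry f p}) = 0} := by
    ext t
    simp only [mem_preimage, mem_Iic, mem_ofPred_eq]
    have h1 : essSup (f t) μ ≤ c ↔ ∀ᵐ x ∂μ, f t x ≤ c :=
      ⟨fun h => (ae_le_essSup (f := f t)).mono fun x hx => hx.trans h,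
        fun h => essSup_le_of_ae_le _ h⟩
    rw [h1, ae_iff]
    simp [Function.uncurry]
  rw [h]
  exact measurable_measure_prodMk_left (measurableSet_lt measurable_const hf)
    (measurableSet_singleton 0)

/-- The operator norm of the derivative, as a supremum over a dense sequence of directions of
limits of difference quotients. -/
def directionalSup (v : Space d → Space d) (x : Space d) : ℝ≥0∞ :=
  ⨆ n : ℕ, limsup (fun m : ℕ => ‖((m : ℝ) + 1) •
    (v (x + ((m : ℝ) + 1)⁻¹ • TopologicalSpace.denseSeq (Space d) n) - v x)‖ₑ) atTop
      / ‖TopologicalSpace.denseSeq (Space d) n‖ₑ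

/-- A bound on a dense set of directions extends by continuity. A zero direction is harmless, since
`0 / 0 = 0` in `ℝ≥0∞`. -/
lemma enorm_eq_iSup_denseSeq (A : Space d →L[ℝ] Space d) :
    ⨆ n : ℕ, ‖A (TopologicalSpace.denseSeq (Space d) n)‖ₑ /
      ‖TopologicalSpace.denseSeq (Space d) n‖ₑ = ‖A‖ₑ := by
  set e := TopologicalSpace.denseSeq (Space d)
  refine le_antisymm (iSup_le fun n => ENNReal.div_le_of_le_mul (A.le_opENorm _)) ?_
  set S := ⨆ n : ℕ, ‖A (e n)‖ₑ / ‖e n‖ₑ with hS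
  by_cases hST : S = ⊤
  · rw [hST]; exact le_top
  have hle : ∀ n, ‖A (e n)‖ ≤ S.toReal * ‖e n‖ := by
    intro n
    by_cases h0 : e n = 0
    · simp [h0]
    have h1 : ‖A (e n)‖ₑ ≤ S * ‖e n‖ₑ := by
      rw [← ENNReal.div_le_iff (by simpa using h0) enorm_ne_top]
      exact le_iSup (fun n => ‖A (e n)‖ₑ / ‖e n‖ₑ) n
    have h2 := ENNReal.toReal_mono (ENNReal.mul_ne_top hST enorm_ne_top) h1
    simpa [ENNReal.toReal_mul] using h2
  have hall : ∀ y, ‖A y‖ ≤ S.toReal * ‖y‖ := by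
    have hc : IsClosed {y : Space d | ‖A y‖ ≤ S.toReal * ‖y‖} :=
      isClosed_le (by fun_prop) (by fun_prop)
    have hd : Dense (range e) := TopologicalSpace.denseRange_denseSeq _
    intro y
    have : closure (range e) ⊆ {y : Space d | ‖A y‖ ≤ S.toReal * ‖y‖} :=
      closure_minimal (by rintro _ ⟨n, rfl⟩; exact hle n) hc
    exact this (hd y)
  have h3 : ‖A‖ ≤ S.toReal := A.opNorm_le_bound ENNReal.toReal_nonneg hall
  rw [← ofReal_norm]
  exact (ENNReal.ofReal_le_iff_le_toReal hST).2 h3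

lemma directionalSup_eq {v : Space d → Space d} {x : Space d} (h : DifferentiableAt ℝ v x) :
    directionalSup v x = ENNReal.ofReal ‖fderiv ℝ v x‖ := by
  rw [ofReal_norm, ← enorm_eq_iSup_denseSeq]
  unfold directionalSup
  congr 1
  funext n
  congr 1
  refine Tendsto.limsup_eq ?_
  refine Tendsto.enorm ?_
  refine h.hasFDerivAt.lim (TopologicalSpace.denseSeq (Space d) n) (c := fun m : ℕ => (m : ℝ) + 1) ?_
  exact tendsto_norm_atTop_atTop.comp
    (tendsto_atTop_add_const_right _ _ tendsto_natCast_atTop_atTop)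

/-- Only countably many suprema and limsups of difference quotients of `u` are involved, so joint
measurability in time and space is inherited from `u`. -/
lemma measurable_directionalSup {u : ℝ → Space d → Space d}
    (hu : Measurable (Function.uncurry u)) :
    Measurable (Function.uncurry fun t => directionalSup (u t)) := by
  unfold directionalSup Function.uncurry
  refine Measurable.iSup fun n => Measurable.div_const (Measurable.limsup fun m => ?_) _
  have h1 : Measurable fun a : ℝ × Space d =>
      u a.1 (a.2 + ((m : ℝ) + 1)⁻¹ • TopologicalSpace.denseSeq (Space d) n) :=
    hu.comp (measurable_fst.prodMk (measurable_snd.add_const _))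
  exact ((h1.sub hu).const_smul ((m : ℝ) + 1)).enorm

/-! ### Integrability in time of the velocity and its gradient. -/

namespace IsAdmissibleVelocity

variable {s : ℝ≥0∞} {u : ℝ → Space d → Space d}

/-- For almost every time the slice is Lipschitz, so by Rademacher the jointly measurable
`directionalSup` equals the norm of the derivative almost everywhere. -/
lemma aemeasurable_gradSupNorm (hu : IsAdmissibleVelocity s u) :
    AEMeasurable (fun t => gradSupNorm (u t)) (volume.restrict (Ioi 0)) := by
  refine ⟨_, measurable_essSup_right (μ := torusMeasure d) (measurable_directionalSup hu.measurable), ?_⟩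
  filter_upwards [hu.lipschitz] with t ⟨K, hK⟩
  refine essSup_congr_ae ?_
  filter_upwards [ae_torusMeasure_of_ae hK.ae_differentiableAt] with x hx
  exact (directionalSup_eq hx).symm

/-- Hölder in time. This is the source of the exponent `(s-1)/s` in all estimates. -/
lemma lintegral_gradSupNorm_le (hs : 1 ≤ s) (hu : IsAdmissibleVelocity s u) {t : ℝ}
    (ht : 0 ≤ t) :
    ∫⁻ τ in Ioc 0 t, gradSupNorm (u τ) ≤ ENNReal.ofReal (t ^ timeExponent s) := by
  have hle : volume.restrict (Ioc 0 t) ≤ volume.restrict (Ioi (0 : ℝ)) :=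
    Measure.restrict_mono Ioc_subset_Ioi_self le_rfl
  have h := eLpNorm_le_eLpNorm_mul_rpow_measure_univ hs
    ((hu.aemeasurable_gradSupNorm.mono_measure hle).aestronglyMeasurable)
  rw [eLpNorm_one_eq_lintegral_enorm] at h
  simp only [enorm_eq_self] at h
  refine h.trans ?_
  have h1 : eLpNorm (fun t => gradSupNorm (u t)) s (volume.restrict (Ioc 0 t)) ≤ 1 :=
    (eLpNorm_mono_measure _ hle).trans hu.gradient_bound
  have h2 : (1 : ℝ) / (1 : ℝ≥0∞).toReal - 1 / s.toReal = timeExponent s := by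
    simp [timeExponent]
  have h3 : 0 ≤ timeExponent s := by
    have : (s⁻¹).toReal ≤ 1 := by
      have := ENNReal.toReal_mono ENNReal.one_ne_top (ENNReal.inv_le_one.2 hs)
      simpa using this
    unfold timeExponent; linarith
  rw [h2]
  calc _ ≤ 1 * (volume.restrict (Ioc 0 t) univ) ^ timeExponent s := by gcongr
    _ = _ := by simp [ENNReal.ofReal_rpow_of_nonneg ht h3]

/-- The function `τ ↦ ‖∇u(τ)‖_{L^∞}` is integrable on bounded intervals. -/
lemma integrableOn_gradSupNorm (hs : 1 ≤ s) (hu : IsAdmissibleVelocity s u) {t : ℝ}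
    (ht : 0 ≤ t) : IntegrableOn (fun τ => (gradSupNorm (u τ)).toReal) (Ioc 0 t) := by
  have hle : volume.restrict (Ioc 0 t) ≤ volume.restrict (Ioi (0 : ℝ)) :=
    Measure.restrict_mono Ioc_subset_Ioi_self le_rfl
  exact integrable_toReal_of_lintegral_ne_top (hu.aemeasurable_gradSupNorm.mono_measure hle)
    (ne_top_of_le_ne_top ENNReal.ofReal_ne_top (hu.lintegral_gradSupNorm_le hs ht))

lemma integral_gradSupNorm_le (hs : 1 ≤ s) (hu : IsAdmissibleVelocity s u) {t : ℝ}
    (ht : 0 ≤ t) : ∫ τ in (0 : ℝ)..t, (gradSupNorm (u τ)).toReal ≤ t ^ timeExponent s := by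
  have hle : volume.restrict (Ioc 0 t) ≤ volume.restrict (Ioi (0 : ℝ)) :=
    Measure.restrict_mono Ioc_subset_Ioi_self le_rfl
  rw [intervalIntegral.integral_of_le ht, integral_toReal
    (hu.aemeasurable_gradSupNorm.mono_measure hle)]
  · have := ENNReal.toReal_mono ENNReal.ofReal_ne_top (hu.lintegral_gradSupNorm_le hs ht)
    rwa [ENNReal.toReal_ofReal (by positivity)] at this
  · exact ae_lt_top' (hu.aemeasurable_gradSupNorm.mono_measure hle)
      (ne_top_of_le_ne_top ENNReal.ofReal_ne_top (hu.lintegral_gradSupNorm_le hs ht))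

lemma measurable_eLpNorm_top (hu : IsAdmissibleVelocity s u) :
    Measurable (fun t => eLpNorm (u t) ⊤ (torusMeasure d)) := by
  simp only [eLpNorm_exponent_top, eLpNormEssSup]
  exact measurable_essSup_right (f := fun t x => ‖u t x‖ₑ) hu.measurable.enorm

lemma integrableOn_eLpNorm_top (hu : IsAdmissibleVelocity s u) (t : ℝ) :
    IntegrableOn (fun τ => (eLpNorm (u τ) ⊤ (torusMeasure d)).toReal) (Ioc 0 t) :=
  integrable_toReal_of_lintegral_ne_top hu.measurable_eLpNorm_top.aemeasurable
    (hu.locally_integrable t).ne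

/-- A Lipschitz periodic slice is bounded, so its essential supremum is finite and `toReal` loses
nothing. -/
lemma ae_norm_le (hu : IsAdmissibleVelocity s u) :
    ∀ᵐ τ ∂volume.restrict (Ioi (0 : ℝ)), ∀ᵐ x ∂torusMeasure d,
      ‖u τ x‖ ≤ (eLpNorm (u τ) ⊤ (torusMeasure d)).toReal := by
  filter_upwards [hu.lipschitz, ae_restrict_mem measurableSet_Ioi] with τ ⟨K, hK⟩ hτ
  have hp := hu.periodic τ (le_of_lt hτ)
  obtain ⟨C, hC⟩ := hp.exists_norm_le hK.continuous
  have hfin : eLpNorm (u τ) ⊤ (torusMeasure d) ≠ ⊤ :=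
    (memLp_top_of_bound hK.continuous.aestronglyMeasurable C (ae_of_all _ hC)).2.ne
  filter_upwards [ae_le_eLpNormEssSup (f := u τ) (μ := torusMeasure d)] with x hx
  rw [← eLpNorm_exponent_top] at hx
  simpa using ENNReal.toReal_mono hfin hx

end IsAdmissibleVelocity

end

section

/-! ### Absolutely continuous functions of time -/

/-- The square of an indefinite integral. -/
lemma sq_eq_of_eq_integral {c F : ℝ → ℝ} {c₀ t : ℝ} (ht : 0 ≤ t)
    (hF : IntervalIntegrable F volume 0 t)
    (hc : ∀ s ∈ Icc 0 t, c s = c₀ + ∫ τ in (0 : ℝ)..s, F τ) :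
    c t ^ 2 = c₀ ^ 2 + 2 * ∫ τ in (0 : ℝ)..t, c τ * F τ := by
  set C : ℝ → ℝ := fun s => c₀ + ∫ τ in (0 : ℝ)..s, F τ with hC
  have hconst : AbsolutelyContinuousOnInterval (fun _ : ℝ => c₀) 0 t :=
    (contDiff_const.contDiffOn).absolutelyContinuousOnInterval
  have hac : AbsolutelyContinuousOnInterval C 0 t :=
    hconst.add (hF.absolutelyContinuousOnInterval_intervalIntegral left_mem_uIcc)
  have hder : ∀ᵐ x, x ∈ uIoc 0 t → deriv C x = F x := by
    filter_upwards [hF.ae_hasDerivAt_integral] with x hx hxt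
    exact ((hx (uIoc_subset_uIcc hxt) 0 left_mem_uIcc).const_add c₀).deriv
  -- `F` is only integrable, so the chain rule for the square is integration by parts for an
  -- absolutely continuous function against itself.
  have h := hac.integral_mul_deriv_eq_deriv_mul hac
  have e1 : ∫ x in (0 : ℝ)..t, C x * deriv C x = ∫ x in (0 : ℝ)..t, c x * F x := by
    refine intervalIntegral.integral_congr_ae ?_
    filter_upwards [hder] with x hx hxt
    rw [hx hxt, hc x ?_]
    rw [uIoc_of_le ht] at hxt
    exact ⟨hxt.1.le, hxt.2⟩
  have e2 : ∫ x in (0 : ℝ)..t, deriv C x * C x = ∫ x in (0 : ℝ)..t, C x * deriv C x := by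
    simp only [mul_comm]
  rw [e2, e1] at h
  have h0 : C 0 = c₀ := by simp [hC]
  have hct : c t = C t := hc t (right_mem_Icc.2 ht)
  rw [h0] at h
  rw [hct]
  linarith

/-- Grönwall's inequality in integral form, with an integrable rate. -/
lemma le_mul_exp_integral_of_le {y g : ℝ → ℝ} {c T : ℝ}
    (hy : ∀ t ∈ Icc 0 T, 0 ≤ y t) (hg : ∀ t, 0 ≤ g t)
    (hgi : IntegrableOn g (Ioc 0 T)) (hgy : IntegrableOn (fun t => g t * y t) (Ioc 0 T))
    (hle : ∀ t ∈ Icc 0 T, y t ≤ c + ∫ τ in (0 : ℝ)..t, g τ * y τ) :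
    ∀ t ∈ Icc 0 T, y t ≤ c * Real.exp (∫ τ in (0 : ℝ)..t, g τ) := by
  set G : ℝ → ℝ := fun t => ∫ τ in (0 : ℝ)..t, g τ with hG
  -- No continuity of `y` is assumed; the argument runs on the monotone majorant `Y`.
  set Y : ℝ → ℝ := fun t => c + ∫ τ in (0 : ℝ)..t, g τ * y τ with hY
  have hii : ∀ {f : ℝ → ℝ}, IntegrableOn f (Ioc 0 T) → ∀ a b, 0 ≤ a → a ≤ b → b ≤ T →
      IntervalIntegrable f volume a b := fun hf a b h0 hab hbT => by
    rw [intervalIntegrable_iff_integrableOn_Ioc_of_le hab]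
    exact hf.mono_set (Ioc_subset_Ioc h0 hbT)
  have hGd : ∀ a b, 0 ≤ a → a ≤ b → b ≤ T → G b - G a = ∫ τ in a..b, g τ := fun a b h0 hab hbT =>
    intervalIntegral.integral_interval_sub_left (hii hgi 0 b le_rfl (h0.trans hab) hbT)
      (hii hgi 0 a le_rfl h0 (hab.trans hbT))
  have hYd : ∀ a b, 0 ≤ a → a ≤ b → b ≤ T → Y b - Y a = ∫ τ in a..b, g τ * y τ :=
    fun a b h0 hab hbT => by
      rw [← intervalIntegral.integral_interval_sub_left (hii hgy 0 b le_rfl (h0.trans hab) hbT)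
        (hii hgy 0 a le_rfl h0 (hab.trans hbT))]
      simp [hY]
  have hYmono : ∀ a b, 0 ≤ a → a ≤ b → b ≤ T → Y a ≤ Y b := fun a b h0 hab hbT => by
    have : 0 ≤ Y b - Y a := by
      rw [hYd a b h0 hab hbT]
      exact intervalIntegral.integral_nonneg hab fun τ hτ =>
        mul_nonneg (hg τ) (hy τ ⟨h0.trans hτ.1, hτ.2.trans hbT⟩)
    linarith
  -- On `[a, b]` one has `y ≤ Y ≤ Y b`, which gives one step of a discrete Grönwall inequality.
  have hYstep : ∀ a b, 0 ≤ a → a ≤ b → b ≤ T → Y b * (1 - (G b - G a)) ≤ Y a :=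
    fun a b h0 hab hbT => by
      have : Y b - Y a ≤ (G b - G a) * Y b := by
        rw [hYd a b h0 hab hbT, hGd a b h0 hab hbT, ← intervalIntegral.integral_mul_const]
        refine intervalIntegral.integral_mono_on hab (hii hgy a b h0 hab hbT)
          ((hii hgi a b h0 hab hbT).mul_const _) fun τ hτ => ?_
        refine mul_le_mul_of_nonneg_left ?_ (hg τ)
        exact (hle τ ⟨h0.trans hτ.1, hτ.2.trans hbT⟩).trans
          (hYmono τ b (h0.trans hτ.1) hτ.2 hbT)
      linarith
  intro t ht
  have hYpos : ∀ t ∈ Icc 0 T, 0 ≤ Y t := fun t ht => (hy t ht).trans (hle t ht)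
  have hGc : ContinuousOn G (Icc 0 T) := by
    have := intervalIntegral.continuousOn_primitive_interval'
      (hii hgi 0 T le_rfl (ht.1.trans ht.2) le_rfl) left_mem_uIcc
    rwa [uIcc_of_le (ht.1.trans ht.2)] at this
  have hG0 : G 0 = 0 := by simp [hG]
  have hY0 : Y 0 = c := by simp [hY]
  -- The interval is cut where `G` is a multiple of `η`, using the intermediate value theorem; each
  -- piece costs the factor `1 - η`. With `η = G t / n` the product tends to `exp (-G t)`.
  have hind : ∀ (η : ℝ), 0 ≤ η → η ≤ 1 → ∀ n : ℕ, ∀ t ∈ Icc 0 T, G t = n * η →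
      Y t * (1 - η) ^ n ≤ c := by
    intro η hη hη1 n
    induction n with
    | zero =>
      intro t ht h
      have h1 := hYstep 0 t le_rfl ht.1 ht.2
      rw [hG0, h, hY0] at h1
      simpa using h1
    | succ n ih =>
      intro t ht h
      push_cast at h
      have hmem : n * η ∈ Icc (G 0) (G t) := ⟨by rw [hG0]; positivity, by rw [h]; linarith⟩
      obtain ⟨a, ha, hGa⟩ := intermediate_value_Icc ht.1
        (hGc.mono (Icc_subset_Icc_right ht.2)) hmem
      have h1 := hYstep a t ha.1 ha.2 ht.2
      have h2 := ih a ⟨ha.1, ha.2.trans ht.2⟩ hGa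
      have h3 : G t - G a = η := by rw [hGa, h]; ring
      rw [h3] at h1
      have : 0 ≤ (1 - η) ^ n := pow_nonneg (by linarith) n
      calc Y t * (1 - η) ^ (n + 1) = (Y t * (1 - η)) * (1 - η) ^ n := by ring
        _ ≤ Y a * (1 - η) ^ n := by gcongr
        _ ≤ c := h2
  have hGt : 0 ≤ G t := by
    have := hGd 0 t le_rfl ht.1 ht.2
    rw [hG0, sub_zero] at this
    rw [this]
    exact intervalIntegral.integral_nonneg ht.1 fun τ _ => hg τ
  have hlim : Tendsto (fun n : ℕ => Y t * (1 + -G t / n) ^ n) atTop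
      (𝓝 (Y t * Real.exp (-G t))) :=
    (Real.tendsto_one_add_div_pow_exp (-G t)).const_mul _
  have hfin : Y t * Real.exp (-G t) ≤ c := by
    refine le_of_tendsto hlim ?_
    filter_upwards [eventually_ge_atTop (max 1 ⌈G t⌉₊)] with n hn
    have hn1 : (1 : ℝ) ≤ n := by exact_mod_cast (le_max_left _ _).trans hn
    have hn2 : G t ≤ n := (Nat.le_ceil _).trans (by exact_mod_cast (le_max_right _ _).trans hn)
    have hn0 : (0 : ℝ) < n := by linarith
    have := hind (G t / n) (by positivity) ((div_le_one hn0).2 hn2) n t ht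
      (by field_simp)
    rwa [sub_eq_add_neg, ← neg_div] at this
  refine (hle t ht).trans ?_
  calc Y t = (Y t * Real.exp (-G t)) * Real.exp (G t) := by
        rw [mul_assoc, ← Real.exp_add]; simp
    _ ≤ c * Real.exp (G t) := by gcongr

/-! ### The time scale -/

lemma timeExponent_one : timeExponent 1 = 0 := by simp [timeExponent]

lemma timeExponent_pos {s : ℝ≥0∞} (hs : 1 ≤ s) (h1 : s ≠ 1) : 0 < timeExponent s := by
  have h : s⁻¹ < 1 := ENNReal.inv_lt_one.2 (lt_of_le_of_ne hs (Ne.symm h1))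
  have := ENNReal.toReal_strict_mono ENNReal.one_ne_top h
  simp only [ENNReal.toReal_one] at this
  unfold timeExponent
  linarith

lemma timeScale_nonneg {κ : ℝ} (hκ : 0 < κ) (hκ1 : κ < 1) (s : ℝ≥0∞) : 0 ≤ timeScale κ s := by
  unfold timeScale
  split_ifs
  · positivity
  · exact Real.rpow_nonneg (Real.log_nonneg (by rw [le_div_iff₀ hκ]; linarith)) _

/-- Up to a small multiple of the time scale `T_{κ,s}`, the effect of the diffusion is small. -/
lemma exists_mul_exp_le_of_le_timeScale {s : ℝ≥0∞} (hs : 1 ≤ s) {B η : ℝ} (hB : 0 < B)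
    (hη : 0 < η) : ∃ c' : ℝ, 0 < c' ∧ ∀ κ : ℝ, 0 < κ → κ < 1 → ∀ t : ℝ, 0 ≤ t →
      t ≤ c' * timeScale κ s → κ * t * Real.exp (B * t ^ timeExponent s) ≤ η := by
  by_cases h1 : s = 1
  · subst h1
    -- For s = 1 the time exponent is 0, so the exponential is the constant `exp B` (also at t = 0,
    -- as `0 ^ 0 = 1`).
    refine ⟨η * Real.exp (-B), by positivity, fun κ hκ _ t _ htT => ?_⟩
    rw [timeExponent_one, Real.rpow_zero, mul_one]
    rw [timeScale, if_pos rfl, mul_one_div, le_div_iff₀ hκ] at htT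
    calc κ * t * Real.exp B ≤ (η * Real.exp (-B)) * Real.exp B :=
          mul_le_mul_of_nonneg_right (by linarith) (Real.exp_pos _).le
      _ = η := by rw [mul_assoc, ← Real.exp_add]; simp
  · set p := timeExponent s with hp
    have hp0 : 0 < p := timeExponent_pos hs h1
    set q := p⁻¹ with hq
    have hq0 : 0 < q := inv_pos.2 hp0
    set c₁ : ℝ := (1 / (2 * B)) ^ q
    set c₂ : ℝ := η / (2 * q) ^ q
    have hc₁ : 0 < c₁ := by positivity
    have hc₂ : 0 < c₂ := by positivity
    refine ⟨min c₁ c₂, lt_min hc₁ hc₂, fun κ hκ hκ1 t ht htT => ?_⟩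
    set ℓ := Real.log (1 / κ) with hℓ
    have hℓ0 : 0 < ℓ := Real.log_pos (by rw [lt_div_iff₀ hκ]; linarith)
    rw [timeScale, if_neg h1, ← hp, ← hℓ, ← hq] at htT
    have hκe : κ = Real.exp (-ℓ) := by
      rw [hℓ, one_div, Real.log_inv, neg_neg, Real.exp_log hκ]
    have ht1 : t ≤ c₁ * ℓ ^ q := htT.trans (by gcongr; exact min_le_left _ _)
    have ht2 : t ≤ c₂ * ℓ ^ q := htT.trans (by gcongr; exact min_le_right _ _)
    -- The constant `c₁` makes the exponential at most `κ^{-1/2}`, since `κ = exp (-ℓ)`.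
    have htp : B * t ^ p ≤ ℓ / 2 := by
      have : t ^ p ≤ (c₁ * ℓ ^ q) ^ p := Real.rpow_le_rpow ht ht1 hp0.le
      have e : (c₁ * ℓ ^ q) ^ p = 1 / (2 * B) * ℓ := by
        rw [Real.mul_rpow hc₁.le (by positivity), ← Real.rpow_mul (by positivity),
          ← Real.rpow_mul hℓ0.le, hq, inv_mul_cancel₀ hp0.ne', Real.rpow_one, Real.rpow_one]
      rw [e] at this
      calc B * t ^ p ≤ B * (1 / (2 * B) * ℓ) := by gcongr
        _ = ℓ / 2 := by field_simp
    -- The remaining factor `κ^{1/2}` absorbs the power of `ℓ` in t: apply `x ≤ exp x` at `x =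
    -- ℓ/(2q)` and raise to the power q. The constant `c₂` normalises the result to `η`.
    have hkey : ℓ ^ q * Real.exp (-(ℓ / 2)) ≤ (2 * q) ^ q := by
      have h3 : ℓ ≤ (2 * q) * Real.exp (ℓ / (2 * q)) := by
        have := Real.add_one_le_exp (ℓ / (2 * q))
        calc ℓ = (2 * q) * (ℓ / (2 * q)) := by field_simp
          _ ≤ _ := by gcongr; linarith
      have h4 := Real.rpow_le_rpow hℓ0.le h3 hq0.le
      rw [Real.mul_rpow (by positivity) (by positivity), ← Real.exp_mul] at h4
      have h5 : ℓ / (2 * q) * q = ℓ / 2 := by field_simp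
      rw [h5] at h4
      calc _ ≤ ((2 * q) ^ q * Real.exp (ℓ / 2)) * Real.exp (-(ℓ / 2)) := by gcongr
        _ = _ := by rw [mul_assoc, ← Real.exp_add]; simp
    calc κ * t * Real.exp (B * t ^ p) ≤ κ * (c₂ * ℓ ^ q) * Real.exp (ℓ / 2) := by gcongr
      _ = c₂ * (ℓ ^ q * (Real.exp (-ℓ) * Real.exp (ℓ / 2))) := by rw [← hκe]; ring
      _ = c₂ * (ℓ ^ q * Real.exp (-(ℓ / 2))) := by rw [← Real.exp_add]; ring_nf
      _ ≤ c₂ * (2 * q) ^ q := by gcongr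
      _ = η := by simp only [c₂]; field_simp

end

section

variable {d : ℕ}

/-! ### Trigonometric polynomials -/

/-- The eigenvalue `(2π|k|)²` of `-Δ` at a real trigonometric function. -/
def waveEigenvalue (j : WaveIndex d) : ℝ := (2 * Real.pi * ‖latticePoint j.1‖) ^ 2

lemma waveEigenvalue_nonneg (j : WaveIndex d) : 0 ≤ waveEigenvalue j := sq_nonneg _

lemma waveEigenvalue_eq_sum (j : WaveIndex d) :
    waveEigenvalue j = ∑ i, (2 * Real.pi * j.1 i) ^ 2 := by
  rw [waveEigenvalue, mul_pow, EuclideanSpace.norm_sq_eq, Finset.mul_sum]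
  refine Finset.sum_congr rfl fun i _ => ?_
  simp [latticePoint, mul_pow]

/-- Exchange of sine and cosine. -/
def waveFlip : WaveIndex d ≃ WaveIndex d := Equiv.prodCongr (Equiv.refl _) Equiv.boolNot

/-- The sign occurring in the derivative of sine and cosine. -/
def waveSign (b : Bool) : ℝ := if b then 1 else -1

lemma waveSign_sq (b : Bool) : waveSign b ^ 2 = 1 := by cases b <;> simp [waveSign]

lemma isPeriodic_wave (j : WaveIndex d) : IsPeriodic (wave j) := by
  intro x k
  have h : ⟪latticePoint j.1, latticePoint k⟫_ℝ = ((∑ i, j.1 i * k i : ℤ) : ℝ) := by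
    rw [inner_latticePoint]; simp [latticePoint]
  unfold wave
  rw [inner_add_right, h, mul_add, add_sub_right_comm, mul_comm (2 * Real.pi) ((_ : ℤ) : ℝ),
    Real.cos_add_int_mul_two_pi]

lemma isTestFunction_wave (j : WaveIndex d) : IsTestFunction (wave j) :=
  ⟨contDiff_wave j, isPeriodic_wave j⟩

lemma fderiv_wave (j : WaveIndex d) (x y : Space d) :
    fderiv ℝ (wave j) x y
      = waveSign j.2 * wave (waveFlip j) x * (2 * Real.pi * ⟪latticePoint j.1, y⟫_ℝ) := by
  have h1 : HasFDerivAt (fun x : Space d => 2 * Real.pi * ⟪latticePoint j.1, x⟫_ℝ - wavePhase j.2)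
      ((2 * Real.pi) • innerSL ℝ (latticePoint j.1)) x :=
    (((innerSL ℝ (latticePoint j.1)).hasFDerivAt (x := x)).const_mul (2 * Real.pi)).sub_const _
  have h2 : HasFDerivAt (wave j) _ x := h1.cos
  rw [h2.fderiv]
  obtain ⟨k, b⟩ := j
  cases b
  · simp [waveFlip, waveSign, wave, wavePhase, Real.cos_sub]
  · simp [waveFlip, waveSign, wave, wavePhase, Real.sin_sub]

lemma gradient_wave (j : WaveIndex d) (x : Space d) :
    gradient (wave j) x
      = (waveSign j.2 * wave (waveFlip j) x * (2 * Real.pi)) • latticePoint j.1 := by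
  refine ext_inner_right ℝ fun y => ?_
  rw [inner_gradient, fderiv_wave, real_inner_smul_left]
  ring

lemma gradient_wave_apply (j : WaveIndex d) (x : Space d) (i : Fin d) :
    gradient (wave j) x i = (waveSign j.2 * (2 * Real.pi * j.1 i)) * wave (waveFlip j) x := by
  rw [gradient_wave]
  simp [latticePoint]
  ring

lemma norm_gradient_wave_le (j : WaveIndex d) (x : Space d) :
    ‖gradient (wave j) x‖ ≤ 2 * Real.pi * ‖latticePoint j.1‖ := by
  rw [gradient_wave, norm_smul]
  gcongr
  have h1 : |waveSign j.2| = 1 := by cases j.2 <;> simp [waveSign]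
  have h2 := abs_wave_le_one (waveFlip j) x
  rw [Real.norm_eq_abs, abs_mul, abs_mul, h1, one_mul, abs_of_pos Real.two_pi_pos]
  have := Real.two_pi_pos
  nlinarith

lemma laplacian_wave (j : WaveIndex d) (x : Space d) :
    Laplacian.laplacian (wave j) x = -(waveEigenvalue j * wave j x) := by
  have hg : ∀ y, HasFDerivAt (gradient (wave j)) ((waveSign j.2 * (2 * Real.pi)) •
      (fderiv ℝ (wave (waveFlip j)) y).smulRight (latticePoint j.1)) y := by
    intro y
    have h1 : HasFDerivAt (wave (waveFlip j)) (fderiv ℝ (wave (waveFlip j)) y) y :=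
      ((contDiff_wave _).differentiable (by simp) y).hasFDerivAt
    have h2 := (h1.smul_const (latticePoint j.1)).const_smul (waveSign j.2 * (2 * Real.pi))
    refine h2.congr_of_eventuallyEq (Eventually.of_forall fun z => ?_)
    rw [gradient_wave]
    simp only [smul_smul, Pi.smul_apply]
    congr 1; ring
  rw [laplacian_eq_sum_inner (contDiff_wave j)]
  have hff : waveFlip (waveFlip j) = j := by
    obtain ⟨k, b⟩ := j
    cases b <;> rfl
  have hs : waveSign j.2 * waveSign (waveFlip j).2 = -1 := by
    obtain ⟨k, b⟩ := j
    cases b <;> simp [waveSign, waveFlip]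
  have h1 : (waveFlip j).1 = j.1 := rfl
  simp only [(hg x).fderiv, _root_.smul_apply, ContinuousLinearMap.smulRight_apply,
    fderiv_wave, hff, real_inner_smul_left, h1]
  rw [waveEigenvalue_eq_sum, Finset.sum_mul, ← Finset.sum_neg_distrib]
  refine Finset.sum_congr rfl fun i _ => ?_
  have h2 : ⟪latticePoint j.1, EuclideanSpace.basisFun (Fin d) ℝ i⟫_ℝ = j.1 i := by
    rw [inner_latticePoint]; simp
  rw [h2]
  linear_combination (wave j x * (2 * Real.pi * j.1 i) ^ 2) * hs

/-- The trigonometric polynomial with given coefficients. -/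
def trigPoly (S : Finset (WaveIndex d)) (b : WaveIndex d → ℝ) (x : Space d) : ℝ :=
  ∑ j ∈ S, b j * wave j x

variable {S : Finset (WaveIndex d)} {b : WaveIndex d → ℝ}

lemma isTestFunction_trigPoly : IsTestFunction (trigPoly S b) := by
  refine ⟨?_, fun x k => ?_⟩
  · unfold trigPoly
    exact ContDiff.sum fun j _ => contDiff_const.mul (contDiff_wave j)
  · simp only [trigPoly, isPeriodic_wave _ x k]

lemma gradient_trigPoly (x : Space d) :
    gradient (trigPoly S b) x = ∑ j ∈ S, b j • gradient (wave j) x := by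
  refine ext_inner_right ℝ fun y => ?_
  have hd : HasFDerivAt (trigPoly S b) (∑ j ∈ S, b j • fderiv ℝ (wave j) x) x :=
    HasFDerivAt.fun_sum fun j _ =>
      (((contDiff_wave j).differentiable (by simp) x).hasFDerivAt).const_mul (b j)
  rw [inner_gradient, hd.fderiv, sum_inner]
  simp [real_inner_smul_left]

lemma laplacian_trigPoly (x : Space d) :
    Laplacian.laplacian (trigPoly S b) x = -trigPoly S (fun j => waveEigenvalue j * b j) x := by
  have hd : gradient (trigPoly S b) = fun x => ∑ j ∈ S, b j • gradient (wave j) x :=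
    funext gradient_trigPoly
  have hD : HasFDerivAt (gradient (trigPoly S b))
      (∑ j ∈ S, b j • fderiv ℝ (gradient (wave j)) x) x := by
    rw [hd]
    exact HasFDerivAt.fun_sum fun j _ =>
      (((contDiff_gradient (contDiff_wave j)).differentiable (by simp) x).hasFDerivAt).const_smul
        (b j)
  rw [laplacian_eq_sum_inner isTestFunction_trigPoly.smooth, hD.fderiv]
  simp only [_root_.sum_apply, _root_.smul_apply, sum_inner,
    real_inner_smul_left]
  rw [Finset.sum_comm, trigPoly, ← Finset.sum_neg_distrib]
  refine Finset.sum_congr rfl fun j _ => ?_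
  rw [← Finset.mul_sum, ← laplacian_eq_sum_inner (contDiff_wave j), laplacian_wave]
  ring

lemma memLp_of_continuous_isPeriodic {F : Type*} [NormedAddCommGroup F] {f : Space d → F}
    (hc : Continuous f) (hp : IsPeriodic f) (p : ℝ≥0∞) : MemLp f p (torusMeasure d) := by
  obtain ⟨C, hC⟩ := hp.exists_norm_le hc
  exact MemLp.of_bound hc.aestronglyMeasurable C (ae_of_all _ hC)

lemma IsTestFunction.memLp {φ : Space d → ℝ} (hφ : IsTestFunction φ) (p : ℝ≥0∞) :
    MemLp φ p (torusMeasure d) :=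
  memLp_of_continuous_isPeriodic hφ.smooth.continuous hφ.periodic p

/-- The dual form of Bessel's inequality. -/
lemma integral_sum_mul_wave_sq_le (S : Finset (WaveIndex d)) (b : WaveIndex d → ℝ)
    (e : WaveIndex d ≃ WaveIndex d) :
    ∫ x, (∑ j ∈ S, b j * wave (e j) x) ^ 2 ∂torusMeasure d ≤ ∑ j ∈ S, b j ^ 2 := by
  set h : Space d → ℝ := fun x => ∑ j ∈ S, b j * wave (e j) x with hh
  have hc : Continuous h := continuous_finsetSum _ fun j _ =>
    continuous_const.mul (continuous_wave _)
  have hp : IsPeriodic h := fun x k => by simp only [hh, isPeriodic_wave _ x k]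
  have hL : MemLp h 2 (torusMeasure d) := memLp_of_continuous_isPeriodic hc hp 2
  have hi : Integrable h (torusMeasure d) := hL.integrable (by norm_num)
  have h1 : ∫ x, h x ^ 2 ∂torusMeasure d = ∑ j ∈ S, b j * waveCoeff h (e j) := by
    have : ∀ x, h x ^ 2 = ∑ j ∈ S, b j * (h x * wave (e j) x) := by
      intro x
      rw [sq]
      nth_rewrite 2 [hh]
      rw [Finset.mul_sum]
      exact Finset.sum_congr rfl fun j _ => by ring
    simp only [this]
    rw [integral_finsetSum _ fun j _ => (integrable_mul_wave hi _).const_mul _]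
    simp only [integral_const_mul, waveCoeff]
  have h2 : ∑ j ∈ S, waveCoeff h (e j) ^ 2 ≤ ∫ x, h x ^ 2 ∂torusMeasure d :=
    sum_le_hasSum S (fun j _ => sq_nonneg _) (e.hasSum_iff.2 (hasSum_waveCoeff_sq hL))
  -- By Young, half of the right side is again at most half of `∫ h²`, by Parseval, and is absorbed.
  -- Only an inequality can hold, because the frame is redundant.
  have h3 : ∑ j ∈ S, b j * waveCoeff h (e j)
      ≤ ∑ j ∈ S, (b j ^ 2 / 2 + waveCoeff h (e j) ^ 2 / 2) :=
    Finset.sum_le_sum fun j _ => by nlinarith [sq_nonneg (b j - waveCoeff h (e j))]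
  rw [Finset.sum_add_distrib, ← Finset.sum_div, ← Finset.sum_div] at h3
  linarith

/-- The i-th component is a polynomial in the flipped waves with coefficients multiplied by `±2πkᵢ`;
summing the dual Bessel bound over i reassembles the eigenvalue. -/
lemma integral_norm_gradient_trigPoly_sq_le :
    ∫ x, ‖gradient (trigPoly S b) x‖ ^ 2 ∂torusMeasure d
      ≤ ∑ j ∈ S, waveEigenvalue j * b j ^ 2 := by
  have h1 : ∀ x, ‖gradient (trigPoly S b) x‖ ^ 2
      = ∑ i, (∑ j ∈ S, (b j * (waveSign j.2 * (2 * Real.pi * j.1 i))) *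
        wave (waveFlip j) x) ^ 2 := by
    intro x
    rw [EuclideanSpace.norm_sq_eq]
    refine Finset.sum_congr rfl fun i _ => ?_
    rw [Real.norm_eq_abs, sq_abs, gradient_trigPoly]
    simp [gradient_wave_apply, mul_assoc]
  simp only [h1]
  rw [integral_finsetSum]
  · calc _ ≤ ∑ i, ∑ j ∈ S, (b j * (waveSign j.2 * (2 * Real.pi * j.1 i))) ^ 2 :=
          Finset.sum_le_sum fun i _ => integral_sum_mul_wave_sq_le S _ waveFlip
      _ = _ := by
          rw [Finset.sum_comm]
          refine Finset.sum_congr rfl fun j _ => ?_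
          rw [waveEigenvalue_eq_sum, Finset.sum_mul]
          refine Finset.sum_congr rfl fun i _ => ?_
          rw [mul_pow, mul_pow, waveSign_sq]
          ring
  · intro i _
    have hp : IsPeriodic fun x => (∑ j ∈ S, (b j * (waveSign j.2 * (2 * Real.pi * j.1 i))) *
        wave (waveFlip j) x) ^ 2 := fun x k => by simp only [isPeriodic_wave _ x k]
    exact (memLp_of_continuous_isPeriodic (Continuous.pow (continuous_finsetSum _ fun j _ =>
      continuous_const.mul (continuous_wave _)) 2) hp 1).integrable le_rfl

/-- Expanding the square, the cross term is exactly `-2∑c²`, while the dual Bessel inequality bounds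
the square of the polynomial by `∑c²`. -/
lemma integral_sub_trigPoly_sq_le {f : Space d → ℝ} (hf : MemLp f 2 (torusMeasure d)) :
    ∫ x, (f x - trigPoly S (waveCoeff f) x) ^ 2 ∂torusMeasure d
      ≤ ∫ x, f x ^ 2 ∂torusMeasure d - ∑ j ∈ S, waveCoeff f j ^ 2 := by
  have hfi : Integrable f (torusMeasure d) := hf.integrable (by norm_num)
  set h := trigPoly S (waveCoeff f) with hh
  have hL : MemLp h 2 (torusMeasure d) := isTestFunction_trigPoly.memLp 2
  have i1 : Integrable (fun x => f x ^ 2) (torusMeasure d) := hf.integrable_sq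
  have i2 : Integrable (fun x => h x ^ 2) (torusMeasure d) := hL.integrable_sq
  have i3 : Integrable (fun x => f x * h x) (torusMeasure d) := hf.integrable_mul hL
  have e1 : ∫ x, f x * h x ∂torusMeasure d = ∑ j ∈ S, waveCoeff f j ^ 2 := by
    have : ∀ x, f x * h x = ∑ j ∈ S, waveCoeff f j * (f x * wave j x) := by
      intro x
      rw [hh, trigPoly, Finset.mul_sum]
      exact Finset.sum_congr rfl fun j _ => by ring
    simp only [this]
    rw [integral_finsetSum _ fun j _ => (integrable_mul_wave hfi _).const_mul _]
    refine Finset.sum_congr rfl fun j _ => ?_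
    rw [integral_const_mul, sq, waveCoeff]
  have e2 : ∫ x, h x ^ 2 ∂torusMeasure d ≤ ∑ j ∈ S, waveCoeff f j ^ 2 :=
    integral_sum_mul_wave_sq_le S (waveCoeff f) (Equiv.refl _)
  have e3 : ∀ x, (f x - h x) ^ 2 = f x ^ 2 - 2 * (f x * h x) + h x ^ 2 := fun x => by ring
  simp only [e3]
  have i4 : Integrable (fun x => f x ^ 2 - 2 * (f x * h x)) (torusMeasure d) :=
    i1.sub (i3.const_mul 2)
  rw [integral_add i4 i2, integral_sub i1 (i3.const_mul 2), integral_const_mul, e1]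
  linarith

/-! ### Flux through the velocity field. -/

/-- The Cauchy–Schwarz inequality. -/
lemma integral_mul_le_sqrt_mul_sqrt {α : Type*} [MeasurableSpace α] {μ : Measure α} {f g : α → ℝ}
    (hf : MemLp f 2 μ) (hg : MemLp g 2 μ) (hf0 : ∀ x, 0 ≤ f x) (hg0 : ∀ x, 0 ≤ g x) :
    ∫ x, f x * g x ∂μ ≤ √(∫ x, f x ^ 2 ∂μ) * √(∫ x, g x ^ 2 ∂μ) := by
  have h := integral_mul_le_Lp_mul_Lq_of_nonneg (μ := μ) (f := f) (g := g)
    Real.HolderConjugate.two_two (ae_of_all _ hf0) (ae_of_all _ hg0)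
    (by simpa using hf) (by simpa using hg)
  simpa [Real.sqrt_eq_rpow] using h

/-- The regularised energy flux through a Lipschitz divergence-free velocity field. -/
lemma abs_sum_mul_flux_le {v : Space d → Space d} {K : ℝ≥0}
    (hv : LipschitzWith K v) (hvp : IsPeriodic v)
    (hdiv : ∀ φ : Space d → ℝ, IsTestFunction φ → ∫ x, ⟪v x, gradient φ x⟫_ℝ ∂torusMeasure d = 0)
    {U : ℝ} (hU0 : 0 ≤ U) (hU : ∀ᵐ x ∂torusMeasure d, ‖v x‖ ≤ U)
    {f : Space d → ℝ} (hf : MemLp f 2 (torusMeasure d)) {a ε : ℝ} (hε : 0 ≤ ε)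
    {m : WaveIndex d → ℝ}
    (hm : ∀ j, (a + ε * waveEigenvalue j) * (m j * waveCoeff f j) = waveCoeff f j)
    (S : Finset (WaveIndex d)) :
    |∑ j ∈ S, m j * waveCoeff f j * ∫ x, f x * ⟪v x, gradient (wave j) x⟫_ℝ ∂torusMeasure d|
      ≤ ε * ((gradSupNorm v).toReal * ∑ j ∈ S, waveEigenvalue j * (m j * waveCoeff f j) ^ 2)
        + √(∫ x, f x ^ 2 ∂torusMeasure d - ∑ j ∈ S, waveCoeff f j ^ 2) *
          (U * √(∑ j ∈ S, waveEigenvalue j * (m j * waveCoeff f j) ^ 2)) := by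
  -- These are the coefficients of the test function `ψ = m(D)f` cut to the modes in `S`. The
  -- hypothesis on m covers both the resolvent (a = 1) and the inverse Laplacian (a = 0, ε = 1, no
  -- zero mode).
  set b : WaveIndex d → ℝ := fun j => m j * waveCoeff f j with hb
  set ψ := trigPoly S b with hψ
  have hψt : IsTestFunction ψ := isTestFunction_trigPoly
  set r : Space d → ℝ := fun x => f x - trigPoly S (waveCoeff f) x with hr
  have hrL : MemLp r 2 (torusMeasure d) := hf.sub (isTestFunction_trigPoly.memLp 2)
  have hgs : Continuous (gradient ψ) := (contDiff_gradient hψt.smooth).continuous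
  have hgp : IsPeriodic (gradient ψ) := hψt.periodic.gradient
  have hvL : ∀ {W : Space d → Space d}, Continuous W → IsPeriodic W → ∀ p,
      MemLp (fun x => ⟪v x, W x⟫_ℝ) p (torusMeasure d) := fun hWc hWp p =>
    memLp_of_continuous_isPeriodic (hv.continuous.inner hWc)
      (fun x k => by simp only [hvp x k, hWp x k]) p
  have hB : MemLp (fun x => ⟪v x, gradient ψ x⟫_ℝ) 2 (torusMeasure d) := hvL hgs hgp 2
  have e1 : ∑ j ∈ S, b j * ∫ x, f x * ⟪v x, gradient (wave j) x⟫_ℝ ∂torusMeasure d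
      = ∫ x, f x * ⟪v x, gradient ψ x⟫_ℝ ∂torusMeasure d := by
    have : ∀ x, f x * ⟪v x, gradient ψ x⟫_ℝ
        = ∑ j ∈ S, b j * (f x * ⟪v x, gradient (wave j) x⟫_ℝ) := by
      intro x
      rw [hψ, gradient_trigPoly, inner_sum, Finset.mul_sum]
      refine Finset.sum_congr rfl fun j _ => ?_
      rw [inner_smul_right]; ring
    simp only [this]
    rw [integral_finsetSum]
    · simp only [integral_const_mul]
    · intro j _
      exact (hf.integrable_mul (hvL (contDiff_gradient (contDiff_wave j)).continuous
        (isPeriodic_wave j).gradient 2)).const_mul _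
  -- On the modes in `S`, f equals `(a - εΔ)ψ`; the rest is the truncation error `r`.
  have e2 : ∀ x, f x = a * ψ x - ε * Laplacian.laplacian ψ x + r x := by
    intro x
    simp only [hr, hψ, laplacian_trigPoly, trigPoly]
    have : ∑ j ∈ S, waveCoeff f j * wave j x
        = a * ∑ j ∈ S, b j * wave j x + ε * ∑ j ∈ S, waveEigenvalue j * b j * wave j x := by
      rw [Finset.mul_sum, Finset.mul_sum, ← Finset.sum_add_distrib]
      refine Finset.sum_congr rfl fun j _ => ?_
      linear_combination -(wave j x) * hm j
    rw [this]; ring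
  have hlapL : MemLp (Laplacian.laplacian ψ) 2 (torusMeasure d) := by
    have : Laplacian.laplacian ψ = fun x => -trigPoly S (fun j => waveEigenvalue j * b j) x :=
      funext laplacian_trigPoly
    rw [this]
    exact (isTestFunction_trigPoly.memLp 2).neg
  have i1 : Integrable (fun x => a * (ψ x * ⟪v x, gradient ψ x⟫_ℝ)) (torusMeasure d) :=
    ((hψt.memLp 2).integrable_mul hB).const_mul a
  have i2 : Integrable (fun x => ε * (Laplacian.laplacian ψ x * ⟪v x, gradient ψ x⟫_ℝ))
      (torusMeasure d) := (hlapL.integrable_mul hB).const_mul ε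
  have i3 : Integrable (fun x => r x * ⟪v x, gradient ψ x⟫_ℝ) (torusMeasure d) :=
    hrL.integrable_mul hB
  have i12 : Integrable (fun x => a * (ψ x * ⟪v x, gradient ψ x⟫_ℝ) -
    ε * (Laplacian.laplacian ψ x * ⟪v x, gradient ψ x⟫_ℝ)) (torusMeasure d) := i1.sub i2
  -- The `a`-term drops out by incompressibility; the Laplacian term is handled by the commutator
  -- estimate, and the `r`-term by the tail of Parseval's sum.
  have e3 : ∫ x, f x * ⟪v x, gradient ψ x⟫_ℝ ∂torusMeasure d
      = -(ε * ∫ x, Laplacian.laplacian ψ x * ⟪v x, gradient ψ x⟫_ℝ ∂torusMeasure d)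
        + ∫ x, r x * ⟪v x, gradient ψ x⟫_ℝ ∂torusMeasure d := by
    have : ∀ x, f x * ⟪v x, gradient ψ x⟫_ℝ = a * (ψ x * ⟪v x, gradient ψ x⟫_ℝ) -
        ε * (Laplacian.laplacian ψ x * ⟪v x, gradient ψ x⟫_ℝ) + r x * ⟪v x, gradient ψ x⟫_ℝ := by
      intro x
      rw [e2 x]; ring
    simp only [this]
    rw [integral_add i12 i3, integral_sub i1 i2, integral_const_mul, integral_const_mul,
      hψt.integral_inner_mul_self hdiv]
    ring
  have hgrad : ∫ x, ‖gradient ψ x‖ ^ 2 ∂torusMeasure d ≤ ∑ j ∈ S, waveEigenvalue j * b j ^ 2 :=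
    integral_norm_gradient_trigPoly_sq_le
  rw [e1, e3]
  refine (abs_add_le _ _).trans (add_le_add ?_ ?_)
  · rw [abs_neg, abs_mul, abs_of_nonneg hε]
    gcongr
    exact (hψt.abs_integral_inner_mul_laplacian_le hv hvp hdiv).trans (by gcongr)
  · have hgL : MemLp (fun x => ‖gradient ψ x‖) 2 (torusMeasure d) :=
      memLp_of_continuous_isPeriodic hgs.norm (fun x k => by simp only [hgp x k]) 2
    have hrn : MemLp (fun x => |r x|) 2 (torusMeasure d) := hrL.norm
    have h1 : |∫ x, r x * ⟪v x, gradient ψ x⟫_ℝ ∂torusMeasure d|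
        ≤ ∫ x, U * (|r x| * ‖gradient ψ x‖) ∂torusMeasure d := by
      rw [← Real.norm_eq_abs]
      refine norm_integral_le_of_norm_le ((hrn.integrable_mul hgL).const_mul U) ?_
      filter_upwards [hU] with x hx
      rw [norm_mul, Real.norm_eq_abs]
      calc |r x| * ‖⟪v x, gradient ψ x⟫_ℝ‖ ≤ |r x| * (U * ‖gradient ψ x‖) := by
            gcongr
            exact (norm_inner_le_norm _ _).trans (by gcongr)
        _ = _ := by ring
    refine h1.trans ?_
    rw [integral_const_mul]
    have h2 := integral_mul_le_sqrt_mul_sqrt hrn hgL (fun x => abs_nonneg _)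
      (fun x => norm_nonneg _)
    simp only [sq_abs] at h2
    have h3 : √(∫ x, r x ^ 2 ∂torusMeasure d)
        ≤ √(∫ x, f x ^ 2 ∂torusMeasure d - ∑ j ∈ S, waveCoeff f j ^ 2) :=
      Real.sqrt_le_sqrt (integral_sub_trigPoly_sq_le hf)
    have h4 := Real.sqrt_le_sqrt hgrad
    calc _ ≤ U * (√(∫ x, r x ^ 2 ∂torusMeasure d) *
          √(∫ x, ‖gradient ψ x‖ ^ 2 ∂torusMeasure d)) := by gcongr
      _ ≤ U * (√(∫ x, f x ^ 2 ∂torusMeasure d - ∑ j ∈ S, waveCoeff f j ^ 2) *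
          √(∑ j ∈ S, waveEigenvalue j * b j ^ 2)) := by gcongr
      _ = _ := by ring

end

section

variable {d : ℕ}

/-! ### Weighted energies -/

/-- The quadratic functional of `f` with Fourier weights `w`. -/
def weightedEnergy (w : WaveIndex d → ℝ) (f : Space d → ℝ) : ℝ := ∑' j, w j * waveCoeff f j ^ 2

lemma summable_weightedEnergy {w : WaveIndex d → ℝ} {B : ℝ} (hw0 : ∀ j, 0 ≤ w j)
    (hwB : ∀ j, w j ≤ B) {f : Space d → ℝ} (hf : MemLp f 2 (torusMeasure d)) :
    Summable (fun j => w j * waveCoeff f j ^ 2) :=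
  Summable.of_nonneg_of_le (fun j => mul_nonneg (hw0 j) (sq_nonneg _))
    (fun j => mul_le_mul_of_nonneg_right (hwB j) (sq_nonneg _))
    ((hasSum_waveCoeff_sq hf).summable.mul_left B)

lemma weightedEnergy_nonneg {w : WaveIndex d → ℝ} (hw0 : ∀ j, 0 ≤ w j) (f : Space d → ℝ) :
    0 ≤ weightedEnergy w f := tsum_nonneg fun j => mul_nonneg (hw0 j) (sq_nonneg _)

lemma weightedEnergy_mono {w w' : WaveIndex d → ℝ} {B : ℝ} (hw0 : ∀ j, 0 ≤ w j)
    (hw : ∀ j, w j ≤ w' j) (hwB : ∀ j, w' j ≤ B) {f : Space d → ℝ}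
    (hf : MemLp f 2 (torusMeasure d)) : weightedEnergy w f ≤ weightedEnergy w' f :=
  Summable.tsum_le_tsum (fun j => mul_le_mul_of_nonneg_right (hw j) (sq_nonneg _))
    (summable_weightedEnergy hw0 (fun j => (hw j).trans (hwB j)) hf)
    (summable_weightedEnergy (fun j => (hw0 j).trans (hw j)) hwB hf)

lemma weightedEnergy_le {w : WaveIndex d → ℝ} {B : ℝ} (hw0 : ∀ j, 0 ≤ w j)
    (hwB : ∀ j, w j ≤ B) {f : Space d → ℝ} (hf : MemLp f 2 (torusMeasure d)) :
    weightedEnergy w f ≤ B * ∫ x, f x ^ 2 ∂torusMeasure d := by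
  rw [← (hasSum_waveCoeff_sq hf).tsum_eq, ← tsum_mul_left]
  exact weightedEnergy_mono (w' := fun _ => B) hw0 hwB (fun _ => le_rfl) hf

lemma waveCoeff_sq_le {f : Space d → ℝ} (hf : MemLp f 2 (torusMeasure d)) (j : WaveIndex d) :
    waveCoeff f j ^ 2 ≤ ∫ x, f x ^ 2 ∂torusMeasure d :=
  le_hasSum (hasSum_waveCoeff_sq hf) j fun _ _ => sq_nonneg _

lemma sum_waveCoeff_sq_le {f : Space d → ℝ} (hf : MemLp f 2 (torusMeasure d))
    (S : Finset (WaveIndex d)) :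
    ∑ j ∈ S, waveCoeff f j ^ 2 ≤ ∫ x, f x ^ 2 ∂torusMeasure d :=
  sum_le_hasSum S (fun _ _ => sq_nonneg _) (hasSum_waveCoeff_sq hf)

lemma measurable_waveCoeff {f : ℝ → Space d → ℝ} (hf : Measurable (Function.uncurry f))
    (j : WaveIndex d) : Measurable (fun τ => waveCoeff (f τ) j) := by
  have : Measurable (Function.uncurry fun τ x => f τ x * wave j x) :=
    hf.mul ((continuous_wave j).measurable.comp measurable_snd)
  exact (this.stronglyMeasurable.integral_prod_right (ν := torusMeasure d)).measurable

/-- The terms are nonnegative, so the sum may be taken in `ℝ≥0∞`; no summability is needed, as both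
sides are 0 when the series diverges. -/
lemma measurable_weightedEnergy {f : ℝ → Space d → ℝ} (hf : Measurable (Function.uncurry f))
    {w : WaveIndex d → ℝ} (hw0 : ∀ j, 0 ≤ w j) :
    Measurable (fun τ => weightedEnergy w (f τ)) := by
  have h : (fun τ => weightedEnergy w (f τ))
      = fun τ => (∑' j, ENNReal.ofReal (w j * waveCoeff (f τ) j ^ 2)).toReal := by
    funext τ
    rw [ENNReal.tsum_toReal_eq fun _ => ENNReal.ofReal_ne_top]
    refine tsum_congr fun j => ?_
    rw [ENNReal.toReal_ofReal (mul_nonneg (hw0 j) (sq_nonneg _))]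
  rw [h]
  refine ENNReal.measurable_toReal.comp (Measurable.tsum fun j => ?_)
  exact (((measurable_waveCoeff hf j).pow_const 2).const_mul _).ennreal_ofReal

/-! ### The energy balance -/

/-- The flux `∫ f u·∇w` through the velocity field, for a trigonometric function `w`. -/
def waveFlux (u : ℝ → Space d → Space d) (f : ℝ → Space d → ℝ) (j : WaveIndex d) (τ : ℝ) : ℝ :=
  ∫ x, f τ x * ⟪u τ x, gradient (wave j) x⟫_ℝ ∂torusMeasure d

/-- Solutions of `∂ₜf + div (u f) = κ Δg`, in terms of Fourier coefficients. -/
structure IsForcedSolution (κ : ℝ) (u : ℝ → Space d → Space d) (f g : ℝ → Space d → ℝ) :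
    Prop where
  measurable_left : Measurable (Function.uncurry f)
  measurable_right : Measurable (Function.uncurry g)
  bounded : ∀ T : ℝ, ∃ K : ℝ, ∀ t ∈ Icc 0 T,
    (MemLp (f t) 2 (torusMeasure d) ∧ ∫ x, f t x ^ 2 ∂torusMeasure d ≤ K) ∧
    (MemLp (g t) 2 (torusMeasure d) ∧ ∫ x, g t x ^ 2 ∂torusMeasure d ≤ K)
  coeff_eq : ∀ j t, 0 ≤ t → waveCoeff (f t) j = waveCoeff (f 0) j +
    ∫ τ in (0 : ℝ)..t, (waveFlux u f j τ - κ * (waveEigenvalue j * waveCoeff (g τ) j))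

/-- For a fixed mode the flux is at most a constant times `‖u‖_{L^∞}`, hence integrable in time for
`L²`-bounded f. -/
lemma abs_integral_mul_inner_le {v : Space d → Space d} {f : Space d → ℝ}
    (hf : MemLp f 2 (torusMeasure d)) {U : ℝ} (hU0 : 0 ≤ U)
    (hU : ∀ᵐ x ∂torusMeasure d, ‖v x‖ ≤ U) (j : WaveIndex d) :
    |∫ x, f x * ⟪v x, gradient (wave j) x⟫_ℝ ∂torusMeasure d|
      ≤ U * (√(∫ x, f x ^ 2 ∂torusMeasure d) * (2 * Real.pi * ‖latticePoint j.1‖)) := by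
  have hN : 0 ≤ 2 * Real.pi * ‖latticePoint j.1‖ := by positivity
  have hf1 : Integrable (fun x => |f x|) (torusMeasure d) := (hf.integrable (by norm_num)).abs
  have h1 : |∫ x, f x * ⟪v x, gradient (wave j) x⟫_ℝ ∂torusMeasure d|
      ≤ ∫ x, |f x| * (U * (2 * Real.pi * ‖latticePoint j.1‖)) ∂torusMeasure d := by
    rw [← Real.norm_eq_abs]
    refine norm_integral_le_of_norm_le (hf1.mul_const _) ?_
    filter_upwards [hU] with x hx
    rw [norm_mul, Real.norm_eq_abs]
    gcongr
    exact (norm_inner_le_norm _ _).trans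
      (mul_le_mul hx (norm_gradient_wave_le j x) (norm_nonneg _) hU0)
  have h2 := integral_mul_le_sqrt_mul_sqrt (μ := torusMeasure d) (f := fun x => |f x|)
    (g := fun _ => 1) hf.norm (memLp_const 1) (fun x => abs_nonneg _) (fun _ => zero_le_one)
  simp only [mul_one, sq_abs, one_pow, integral_const, probReal_univ, smul_eq_mul,
    Real.sqrt_one] at h2
  rw [integral_mul_const] at h1
  calc _ ≤ _ := h1
    _ ≤ √(∫ x, f x ^ 2 ∂torusMeasure d) * (U * (2 * Real.pi * ‖latticePoint j.1‖)) := by gcongr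
    _ = _ := by ring

lemma measurable_waveFlux {u : ℝ → Space d → Space d} {f : ℝ → Space d → ℝ}
    (hu : Measurable (Function.uncurry u)) (hf : Measurable (Function.uncurry f))
    (j : WaveIndex d) : Measurable (waveFlux u f j) := by
  have : Measurable (Function.uncurry fun τ x => f τ x * ⟪u τ x, gradient (wave j) x⟫_ℝ) :=
    hf.mul (hu.inner ((contDiff_gradient (contDiff_wave j)).continuous.measurable.comp
      measurable_snd))
  exact (this.stronglyMeasurable.integral_prod_right (ν := torusMeasure d)).measurable

lemma ae_uIoc_of_ae_Ioi {p : ℝ → Prop} {t : ℝ} (ht : 0 ≤ t)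
    (h : ∀ᵐ τ ∂volume.restrict (Ioi (0 : ℝ)), p τ) : ∀ᵐ τ, τ ∈ uIoc 0 t → p τ := by
  rw [ae_restrict_iff' measurableSet_Ioi] at h
  filter_upwards [h] with τ hτ hmem
  rw [uIoc_of_le ht] at hmem
  exact hτ hmem.1

variable {s : ℝ≥0∞} {u : ℝ → Space d → Space d} {f g : ℝ → Space d → ℝ} {κ : ℝ}

lemma intervalIntegrable_of_measurable_of_bounded {h : ℝ → ℝ} (hm : Measurable h) {K t : ℝ}
    (ht : 0 ≤ t) (hb : ∀ τ ∈ Icc 0 t, |h τ| ≤ K) : IntervalIntegrable h volume 0 t := by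
  rw [intervalIntegrable_iff_integrableOn_Ioc_of_le ht]
  refine Integrable.of_bound hm.aestronglyMeasurable K ?_
  filter_upwards [ae_restrict_mem measurableSet_Ioc] with τ hτ
  exact hb τ ⟨hτ.1.le, hτ.2⟩

lemma IsForcedSolution.intervalIntegrable_waveFlux (hu : IsAdmissibleVelocity s u)
    (h : IsForcedSolution κ u f g) {t : ℝ} (ht : 0 ≤ t) (j : WaveIndex d) :
    IntervalIntegrable (waveFlux u f j) volume 0 t := by
  obtain ⟨K, hK⟩ := h.bounded t
  have hU : IntervalIntegrable (fun τ => (eLpNorm (u τ) ⊤ (torusMeasure d)).toReal *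
      (√K * (2 * Real.pi * ‖latticePoint j.1‖))) volume 0 t := by
    refine IntervalIntegrable.mul_const ?_ _
    rw [intervalIntegrable_iff_integrableOn_Ioc_of_le ht]
    exact hu.integrableOn_eLpNorm_top t
  refine hU.mono_fun (measurable_waveFlux hu.measurable h.measurable_left j).aestronglyMeasurable
    ?_
  refine (ae_restrict_iff' measurableSet_uIoc).2 ?_
  filter_upwards [ae_uIoc_of_ae_Ioi ht hu.ae_norm_le] with τ hτ hmem
  have hmem' := hmem
  rw [uIoc_of_le ht] at hmem'
  have hKτ := (hK τ ⟨hmem'.1.le, hmem'.2⟩).1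
  refine (abs_integral_mul_inner_le hKτ.1 ENNReal.toReal_nonneg (hτ hmem) j).trans ?_
  refine le_trans ?_ (le_abs_self _)
  gcongr
  exact hKτ.2

/-- The energy balance for a finite number of modes. -/
lemma IsForcedSolution.sum_energy_eq (hu : IsAdmissibleVelocity s u)
    (h : IsForcedSolution κ u f g) (m : WaveIndex d → ℝ) {t : ℝ} (ht : 0 ≤ t)
    (S : Finset (WaveIndex d)) :
    ∑ j ∈ S, m j * waveCoeff (f t) j ^ 2 - ∑ j ∈ S, m j * waveCoeff (f 0) j ^ 2 +
      2 * κ * ∫ τ in (0 : ℝ)..t, ∑ j ∈ S,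
        waveEigenvalue j * m j * (waveCoeff (f τ) j * waveCoeff (g τ) j)
      = 2 * ∫ τ in (0 : ℝ)..t, ∑ j ∈ S, m j * waveCoeff (f τ) j * waveFlux u f j τ := by
  obtain ⟨K, hK⟩ := h.bounded t
  have hcK : ∀ j, ∀ τ ∈ Icc 0 t, |waveCoeff (f τ) j| ≤ √K := fun j τ hτ =>
    Real.abs_le_sqrt ((waveCoeff_sq_le (hK τ hτ).1.1 j).trans (hK τ hτ).1.2)
  have hdK : ∀ j, ∀ τ ∈ Icc 0 t, |waveCoeff (g τ) j| ≤ √K := fun j τ hτ =>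
    Real.abs_le_sqrt ((waveCoeff_sq_le (hK τ hτ).2.1 j).trans (hK τ hτ).2.2)
  have hcm := measurable_waveCoeff h.measurable_left
  have hdm := measurable_waveCoeff h.measurable_right
  have hA : ∀ j, IntervalIntegrable (fun τ => waveCoeff (f τ) j * waveFlux u f j τ) volume 0 t := by
    intro j
    refine (((h.intervalIntegrable_waveFlux hu ht j).const_mul √K)).mono_fun
      ((hcm j).mul (measurable_waveFlux hu.measurable h.measurable_left j)).aestronglyMeasurable ?_
    refine (ae_restrict_iff' measurableSet_uIoc).2 (ae_of_all _ fun τ hτ => ?_)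
    rw [uIoc_of_le ht] at hτ
    beta_reduce
    rw [norm_mul, norm_mul, Real.norm_of_nonneg (Real.sqrt_nonneg K)]
    gcongr
    exact hcK j τ ⟨hτ.1.le, hτ.2⟩
  have hcd : ∀ j, IntervalIntegrable (fun τ => waveCoeff (f τ) j * waveCoeff (g τ) j)
      volume 0 t := fun j =>
    intervalIntegrable_of_measurable_of_bounded (K := √K * √K) ((hcm j).mul (hdm j)) ht
      fun τ hτ => by
        rw [Pi.mul_apply, abs_mul]
        exact mul_le_mul (hcK j τ hτ) (hdK j τ hτ) (abs_nonneg _) (Real.sqrt_nonneg _)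
  have hd : ∀ j, IntervalIntegrable (fun τ => κ * (waveEigenvalue j * waveCoeff (g τ) j))
      volume 0 t := fun j =>
    ((intervalIntegrable_of_measurable_of_bounded (hdm j) ht (hdK j)).const_mul _).const_mul _
  have hj : ∀ j ∈ S, m j * waveCoeff (f t) j ^ 2 - m j * waveCoeff (f 0) j ^ 2 +
      2 * κ * ∫ τ in (0 : ℝ)..t, waveEigenvalue j * m j * (waveCoeff (f τ) j * waveCoeff (g τ) j)
      = 2 * ∫ τ in (0 : ℝ)..t, m j * waveCoeff (f τ) j * waveFlux u f j τ := by
    intro j _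
    -- Each Fourier coefficient is absolutely continuous in time, so its square can be
    -- differentiated.
    have e := sq_eq_of_eq_integral (c := fun τ => waveCoeff (f τ) j) ht
      ((h.intervalIntegrable_waveFlux hu ht j).sub (hd j)) (fun τ hτ => h.coeff_eq j τ hτ.1)
    have e2 : ∀ τ, waveCoeff (f τ) j *
        (waveFlux u f j τ - κ * (waveEigenvalue j * waveCoeff (g τ) j))
        = waveCoeff (f τ) j * waveFlux u f j τ -
          κ * waveEigenvalue j * (waveCoeff (f τ) j * waveCoeff (g τ) j) := fun τ => by ring
    simp only [e2] at e
    rw [intervalIntegral.integral_sub (hA j) ((hcd j).const_mul _),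
      intervalIntegral.integral_const_mul] at e
    rw [intervalIntegral.integral_const_mul, e]
    simp only [mul_assoc (m j)]
    rw [intervalIntegral.integral_const_mul]
    ring
  rw [intervalIntegral.integral_finsetSum fun j _ => (hcd j).const_mul _,
    intervalIntegral.integral_finsetSum fun j _ => by
      simpa only [mul_assoc] using (hA j).const_mul (m j),
    Finset.mul_sum, Finset.mul_sum, ← Finset.sum_sub_distrib, ← Finset.sum_add_distrib]
  exact Finset.sum_congr rfl hj

/-- The regularised energy balance: the error comes from the commutator of the regularisation
with the transport term. -/
theorem IsForcedSolution.abs_energy_balance_le (hs : 1 ≤ s) (hu : IsAdmissibleVelocity s u)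
    (h : IsForcedSolution κ u f g) {m : WaveIndex d → ℝ} {a ε B : ℝ} (hε : 0 ≤ ε)
    (hm0 : ∀ j, 0 ≤ m j) (hmB : ∀ j, m j ≤ B) (hlB : ∀ j, waveEigenvalue j * m j ≤ B)
    (hm : ∀ τ, 0 ≤ τ → ∀ j,
      (a + ε * waveEigenvalue j) * (m j * waveCoeff (f τ) j) = waveCoeff (f τ) j)
    {t : ℝ} (ht : 0 ≤ t) :
    |weightedEnergy m (f t) - weightedEnergy m (f 0) + 2 * κ * ∫ τ in (0 : ℝ)..t,
        ∑' j, waveEigenvalue j * m j * (waveCoeff (f τ) j * waveCoeff (g τ) j)|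
      ≤ 2 * ∫ τ in (0 : ℝ)..t, ε * ((gradSupNorm (u τ)).toReal *
          weightedEnergy (fun j => waveEigenvalue j * m j ^ 2) (f τ)) := by
  obtain ⟨K, hK⟩ := h.bounded t
  have hB : 0 ≤ B := (hm0 (0, false)).trans (hmB _)
  have hK0 : 0 ≤ K := (integral_nonneg fun x => sq_nonneg _).trans
    (hK 0 ⟨le_rfl, ht⟩).1.2
  have hIoc : uIoc 0 t = Ioc 0 t := uIoc_of_le ht
  have hcm := measurable_waveCoeff h.measurable_left
  have hdm := measurable_waveCoeff h.measurable_right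
  set w : WaveIndex d → ℝ := fun j => waveEigenvalue j * m j ^ 2 with hw
  have hw0 : ∀ j, 0 ≤ w j := fun j => mul_nonneg (waveEigenvalue_nonneg j) (sq_nonneg _)
  have hwB : ∀ j, w j ≤ B * B := fun j => by
    have : w j = (waveEigenvalue j * m j) * m j := by simp only [hw]; ring
    rw [this]
    exact mul_le_mul (hlB j) (hmB j) (hm0 j) hB
  set γ : ℝ → ℝ := fun τ => (gradSupNorm (u τ)).toReal with hγ
  set U : ℝ → ℝ := fun τ => (eLpNorm (u τ) ⊤ (torusMeasure d)).toReal with hUdef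
  have hγi : IntervalIntegrable γ volume 0 t := by
    rw [intervalIntegrable_iff_integrableOn_Ioc_of_le ht]
    exact hu.integrableOn_gradSupNorm hs ht
  have hUi : IntervalIntegrable U volume 0 t := by
    rw [intervalIntegrable_iff_integrableOn_Ioc_of_le ht]
    exact hu.integrableOn_eLpNorm_top t
  have hnm : Measurable fun τ => ∫ x, f τ x ^ 2 ∂torusMeasure d := by
    have : Measurable (Function.uncurry fun τ x => f τ x ^ 2) := h.measurable_left.pow_const 2
    exact (this.stronglyMeasurable.integral_prod_right (ν := torusMeasure d)).measurable
  -- the energy identity for finitely many modes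
  set W : Finset (WaveIndex d) → ℝ → ℝ := fun S τ => ∑ j ∈ S, w j * waveCoeff (f τ) j ^ 2 with hW
  -- The first term of `R` is the commutator; the second is the truncation error, which vanishes in
  -- the limit because its square root is the tail of Parseval's sum.
  set R : Finset (WaveIndex d) → ℝ → ℝ := fun S τ => ε * (γ τ * W S τ) +
    √(∫ x, f τ x ^ 2 ∂torusMeasure d - ∑ j ∈ S, waveCoeff (f τ) j ^ 2) * (U τ * √(W S τ)) with hR
  have hWm : ∀ S, Measurable (W S) := fun S =>
    Finset.measurable_fun_sum S fun j _ => ((hcm j).pow_const 2).const_mul _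
  have hRm : ∀ S, AEStronglyMeasurable (R S) (volume.restrict (uIoc 0 t)) := by
    intro S
    have h1 : AEStronglyMeasurable γ (volume.restrict (uIoc 0 t)) := by
      rw [hIoc]; exact (hu.integrableOn_gradSupNorm hs ht).aestronglyMeasurable
    have h2 : AEStronglyMeasurable U (volume.restrict (uIoc 0 t)) := by
      rw [hIoc]; exact (hu.integrableOn_eLpNorm_top t).aestronglyMeasurable
    have h3 : Measurable fun τ =>
        √(∫ x, f τ x ^ 2 ∂torusMeasure d - ∑ j ∈ S, waveCoeff (f τ) j ^ 2) :=
      (hnm.sub (Finset.measurable_fun_sum S fun j _ => (hcm j).pow_const 2)).sqrt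
    exact ((h1.mul (hWm S).aestronglyMeasurable).const_mul ε).add
      (h3.aestronglyMeasurable.mul (h2.mul (hWm S).sqrt.aestronglyMeasurable))
  have hW0 : ∀ S τ, 0 ≤ W S τ := fun S τ =>
    Finset.sum_nonneg fun j _ => mul_nonneg (hw0 j) (sq_nonneg _)
  have hWle : ∀ S, ∀ τ ∈ Icc 0 t, W S τ ≤ B * B * K := fun S τ hτ => by
    have h1 : W S τ ≤ weightedEnergy w (f τ) :=
      (summable_weightedEnergy hw0 hwB (hK τ hτ).1.1).sum_le_tsum S
        fun j _ => mul_nonneg (hw0 j) (sq_nonneg _)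
    refine h1.trans ((weightedEnergy_le hw0 hwB (hK τ hτ).1.1).trans ?_)
    exact mul_le_mul_of_nonneg_left (hK τ hτ).1.2 (mul_nonneg hB hB)
  -- A majorant independent of `S`, integrable because `‖∇u‖_{L^∞}` and `‖u‖_{L^∞}` are integrable
  -- on `[0, t]`.
  set bd : ℝ → ℝ := fun τ => ε * (γ τ * (B * B * K)) + √K * (U τ * √(B * B * K)) with hbd
  have hbdi : IntervalIntegrable bd volume 0 t :=
    ((hγi.mul_const _).const_mul _).add ((hUi.mul_const _).const_mul _)
  have hγ0 : ∀ τ, 0 ≤ γ τ := fun τ => ENNReal.toReal_nonneg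
  have hU0 : ∀ τ, 0 ≤ U τ := fun τ => ENNReal.toReal_nonneg
  have hR0 : ∀ S τ, 0 ≤ R S τ := fun S τ => by
    have := hW0 S τ
    have := hγ0 τ
    have := hU0 τ
    positivity
  have hRbd : ∀ S, ∀ τ ∈ Icc 0 t, ‖R S τ‖ ≤ bd τ := fun S τ hτ => by
    rw [Real.norm_of_nonneg (hR0 S τ)]
    have h1 := hWle S τ hτ
    have h2 : ∫ x, f τ x ^ 2 ∂torusMeasure d - ∑ j ∈ S, waveCoeff (f τ) j ^ 2 ≤ K := by
      have := Finset.sum_nonneg (s := S) fun j _ => sq_nonneg (waveCoeff (f τ) j)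
      linarith [(hK τ hτ).1.2]
    have h3 := hγ0 τ
    have h4 := hU0 τ
    simp only [hR, hbd]
    gcongr
  have hRi : ∀ S, IntervalIntegrable (R S) volume 0 t := fun S => by
    refine hbdi.mono_fun (hRm S) ((ae_restrict_iff' measurableSet_uIoc).2
      (ae_of_all _ fun τ hτ => ?_))
    rw [hIoc] at hτ
    exact (hRbd S τ ⟨hτ.1.le, hτ.2⟩).trans (le_abs_self _)
  have hfin : ∀ S : Finset (WaveIndex d),
      |∑ j ∈ S, m j * waveCoeff (f t) j ^ 2 - ∑ j ∈ S, m j * waveCoeff (f 0) j ^ 2 +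
        2 * κ * ∫ τ in (0 : ℝ)..t, ∑ j ∈ S,
          waveEigenvalue j * m j * (waveCoeff (f τ) j * waveCoeff (g τ) j)|
      ≤ 2 * ∫ τ in (0 : ℝ)..t, R S τ := by
    intro S
    rw [h.sum_energy_eq hu m ht S, abs_mul, abs_two]
    gcongr
    rw [← Real.norm_eq_abs]
    refine intervalIntegral.norm_integral_le_of_norm_le ht ?_ (hRi S)
    rw [← hIoc]
    filter_upwards [ae_uIoc_of_ae_Ioi ht hu.ae_norm_le, ae_uIoc_of_ae_Ioi ht hu.lipschitz,
      ae_uIoc_of_ae_Ioi ht hu.divergence_free] with τ h1 h2 h3 hτ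
    obtain ⟨L, hL⟩ := h2 hτ
    have hτ' : τ ∈ Ioc 0 t := hIoc ▸ hτ
    have key := abs_sum_mul_flux_le hL (hu.periodic τ hτ'.1.le) (h3 hτ) (hU0 τ) (h1 hτ)
      (hK τ ⟨hτ'.1.le, hτ'.2⟩).1.1 hε (hm τ hτ'.1.le) S
    rw [Real.norm_eq_abs]
    refine key.trans (le_of_eq ?_)
    simp only [hR, hW, hw, mul_pow, mul_assoc, hγ, hUdef]
  -- the limit of all modes
  have lim1 : ∀ τ ∈ Icc 0 t, Tendsto (fun S => ∑ j ∈ S, m j * waveCoeff (f τ) j ^ 2) atTop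
      (𝓝 (weightedEnergy m (f τ))) := fun τ hτ =>
    (summable_weightedEnergy hm0 hmB (hK τ hτ).1.1).hasSum
  have hsum2 : ∀ τ ∈ Icc 0 t, Summable fun j =>
      waveEigenvalue j * m j * (waveCoeff (f τ) j * waveCoeff (g τ) j) := fun τ hτ => by
    refine Summable.of_norm_bounded (g := fun j => B * (waveCoeff (f τ) j ^ 2 +
      waveCoeff (g τ) j ^ 2)) (((hasSum_waveCoeff_sq (hK τ hτ).1.1).summable.add
        (hasSum_waveCoeff_sq (hK τ hτ).2.1).summable).mul_left B) fun j => ?_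
    rw [norm_mul, Real.norm_of_nonneg (mul_nonneg (waveEigenvalue_nonneg j) (hm0 j))]
    refine mul_le_mul (hlB j) ?_ (norm_nonneg _) hB
    rw [Real.norm_eq_abs]
    refine abs_le.2 ⟨?_, ?_⟩ <;>
      nlinarith [sq_nonneg (waveCoeff (f τ) j + waveCoeff (g τ) j),
        sq_nonneg (waveCoeff (f τ) j - waveCoeff (g τ) j), sq_nonneg (waveCoeff (f τ) j),
        sq_nonneg (waveCoeff (g τ) j)]
  have lim2 : Tendsto (fun S : Finset (WaveIndex d) => ∫ τ in (0 : ℝ)..t, ∑ j ∈ S,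
        waveEigenvalue j * m j * (waveCoeff (f τ) j * waveCoeff (g τ) j)) atTop
      (𝓝 (∫ τ in (0 : ℝ)..t, ∑' j,
        waveEigenvalue j * m j * (waveCoeff (f τ) j * waveCoeff (g τ) j))) := by
    refine intervalIntegral.tendsto_integral_filter_of_dominated_convergence
      (fun _ => B * (K + K)) ?_ ?_ intervalIntegrable_const ?_
    · refine Eventually.of_forall fun S => Measurable.aestronglyMeasurable ?_
      exact Finset.measurable_fun_sum S fun j _ => ((hcm j).mul (hdm j)).const_mul _
    · refine Eventually.of_forall fun S => ae_of_all _ fun τ hτ => ?_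
      rw [hIoc] at hτ
      have hτ' : τ ∈ Icc 0 t := ⟨hτ.1.le, hτ.2⟩
      calc _ ≤ ∑ j ∈ S, B * (waveCoeff (f τ) j ^ 2 + waveCoeff (g τ) j ^ 2) := by
            refine norm_sum_le_of_le _ fun j _ => ?_
            rw [norm_mul, Real.norm_of_nonneg (mul_nonneg (waveEigenvalue_nonneg j) (hm0 j))]
            refine mul_le_mul (hlB j) ?_ (norm_nonneg _) hB
            rw [Real.norm_eq_abs]
            refine abs_le.2 ⟨?_, ?_⟩ <;>
              nlinarith [sq_nonneg (waveCoeff (f τ) j + waveCoeff (g τ) j),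
                sq_nonneg (waveCoeff (f τ) j - waveCoeff (g τ) j),
                sq_nonneg (waveCoeff (f τ) j), sq_nonneg (waveCoeff (g τ) j)]
        _ = B * (∑ j ∈ S, waveCoeff (f τ) j ^ 2 + ∑ j ∈ S, waveCoeff (g τ) j ^ 2) := by
            rw [← Finset.mul_sum, Finset.sum_add_distrib]
        _ ≤ B * (K + K) := by
            gcongr
            · exact (sum_waveCoeff_sq_le (hK τ hτ').1.1 S).trans (hK τ hτ').1.2
            · exact (sum_waveCoeff_sq_le (hK τ hτ').2.1 S).trans (hK τ hτ').2.2
    · refine ae_of_all _ fun τ hτ => ?_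
      rw [hIoc] at hτ
      exact (hsum2 τ ⟨hτ.1.le, hτ.2⟩).hasSum
  have lim3 : Tendsto (fun S : Finset (WaveIndex d) => ∫ τ in (0 : ℝ)..t, R S τ) atTop
      (𝓝 (∫ τ in (0 : ℝ)..t, ε * (γ τ * weightedEnergy w (f τ)))) := by
    refine intervalIntegral.tendsto_integral_filter_of_dominated_convergence bd
      (Eventually.of_forall hRm) (Eventually.of_forall fun S => ae_of_all _ fun τ hτ => ?_)
      hbdi (ae_of_all _ fun τ hτ => ?_)
    · rw [hIoc] at hτ
      exact hRbd S τ ⟨hτ.1.le, hτ.2⟩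
    · rw [hIoc] at hτ
      have hf2 := (hK τ ⟨hτ.1.le, hτ.2⟩).1.1
      have hWl : Tendsto (fun S => W S τ) atTop (𝓝 (weightedEnergy w (f τ))) :=
        (summable_weightedEnergy hw0 hwB hf2).hasSum
      have h1 : Tendsto (fun S : Finset (WaveIndex d) =>
          ∫ x, f τ x ^ 2 ∂torusMeasure d - ∑ j ∈ S, waveCoeff (f τ) j ^ 2) atTop
          (𝓝 (∫ x, f τ x ^ 2 ∂torusMeasure d - ∫ x, f τ x ^ 2 ∂torusMeasure d)) :=
        tendsto_const_nhds.sub (hasSum_waveCoeff_sq hf2)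
      have := ((hWl.const_mul (γ τ)).const_mul ε).add (h1.sqrt.mul (hWl.sqrt.const_mul (U τ)))
      simpa using this
  refine le_of_tendsto_of_tendsto' (((lim1 t ⟨ht, le_rfl⟩).sub (lim1 0 ⟨le_rfl, ht⟩)).add
    (lim2.const_mul (2 * κ))).abs (lim3.const_mul 2) hfin

end

section

variable {d : ℕ}

/-! ### Consequences of the energy balance -/

/-- The Fourier multiplier of `(1 - εΔ)⁻¹`. -/
def resolventWeight (ε : ℝ) (j : WaveIndex d) : ℝ := (1 + ε * waveEigenvalue j)⁻¹

/-- The regularised Dirichlet energy `⟨-Δ(1 - εΔ)⁻¹ f, f⟩`. -/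
def dirichletEnergy (ε : ℝ) (f : Space d → ℝ) : ℝ :=
  weightedEnergy (fun j => waveEigenvalue j * resolventWeight ε j) f

lemma resolventWeight_denom_pos {ε : ℝ} (hε : 0 ≤ ε) (j : WaveIndex d) :
    0 < 1 + ε * waveEigenvalue j := by
  have := mul_nonneg hε (waveEigenvalue_nonneg j); linarith

lemma resolventWeight_nonneg {ε : ℝ} (hε : 0 ≤ ε) (j : WaveIndex d) :
    0 ≤ resolventWeight ε j := (inv_pos.2 (resolventWeight_denom_pos hε j)).le

lemma resolventWeight_le_one {ε : ℝ} (hε : 0 ≤ ε) (j : WaveIndex d) :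
    resolventWeight ε j ≤ 1 :=
  inv_le_one_of_one_le₀ (by have := mul_nonneg hε (waveEigenvalue_nonneg j); linarith)

lemma resolventWeight_mul {ε : ℝ} (hε : 0 ≤ ε) (j : WaveIndex d) :
    (1 + ε * waveEigenvalue j) * resolventWeight ε j = 1 :=
  mul_inv_cancel₀ (resolventWeight_denom_pos hε j).ne'

lemma one_sub_resolventWeight {ε : ℝ} (hε : 0 ≤ ε) (j : WaveIndex d) :
    ε * (waveEigenvalue j * resolventWeight ε j) = 1 - resolventWeight ε j := by
  linarith [resolventWeight_mul hε j]

lemma waveEigenvalue_mul_resolventWeight_nonneg {ε : ℝ} (hε : 0 ≤ ε) (j : WaveIndex d) :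
    0 ≤ waveEigenvalue j * resolventWeight ε j :=
  mul_nonneg (waveEigenvalue_nonneg j) (resolventWeight_nonneg hε j)

lemma waveEigenvalue_mul_resolventWeight_le {ε : ℝ} (hε : 0 < ε) (j : WaveIndex d) :
    waveEigenvalue j * resolventWeight ε j ≤ ε⁻¹ := by
  rw [← mul_le_mul_iff_right₀ hε, one_sub_resolventWeight hε.le, mul_inv_cancel₀ hε.ne']
  linarith [resolventWeight_nonneg hε.le j]

/-- Lowering the regularisation parameter only increases the regularised Dirichlet energy; this
allows two different parameters in the energy inequality. -/
lemma resolventWeight_anti {δ ε : ℝ} (hδ : 0 ≤ δ) (h : δ ≤ ε) (j : WaveIndex d) :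
    resolventWeight ε j ≤ resolventWeight δ j :=
  inv_anti₀ (resolventWeight_denom_pos hδ j)
    (by have := mul_le_mul_of_nonneg_right h (waveEigenvalue_nonneg j); linarith)

lemma weightedEnergy_const_mul (c : ℝ) (w : WaveIndex d → ℝ) (f : Space d → ℝ) :
    weightedEnergy (fun j => c * w j) f = c * weightedEnergy w f := by
  unfold weightedEnergy
  rw [← tsum_mul_left]
  exact tsum_congr fun j => by ring

lemma weightedEnergy_one {f : Space d → ℝ} (hf : MemLp f 2 (torusMeasure d)) :
    weightedEnergy (fun _ => 1) f = ∫ x, f x ^ 2 ∂torusMeasure d := by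
  simp only [weightedEnergy, one_mul]
  exact (hasSum_waveCoeff_sq hf).tsum_eq

lemma tendsto_weightedEnergy {w : ℕ → WaveIndex d → ℝ} {w' : WaveIndex d → ℝ} {B : ℝ}
    (hw0 : ∀ n j, 0 ≤ w n j) (hwB : ∀ n j, w n j ≤ B)
    (hlim : ∀ j, Tendsto (fun n => w n j) atTop (𝓝 (w' j))) {f : Space d → ℝ}
    (hf : MemLp f 2 (torusMeasure d)) :
    Tendsto (fun n => weightedEnergy (w n) f) atTop (𝓝 (weightedEnergy w' f)) := by
  refine tendsto_tsum_of_dominated_convergence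
    ((hasSum_waveCoeff_sq hf).summable.mul_left B) (fun j => (hlim j).mul_const _)
    (Eventually.of_forall fun n j => ?_)
  rw [Real.norm_of_nonneg (mul_nonneg (hw0 n j) (sq_nonneg _))]
  exact mul_le_mul_of_nonneg_right (hwB n j) (sq_nonneg _)

lemma dirichletEnergy_nonneg {ε : ℝ} (hε : 0 ≤ ε) (f : Space d → ℝ) : 0 ≤ dirichletEnergy ε f :=
  weightedEnergy_nonneg (waveEigenvalue_mul_resolventWeight_nonneg hε) f

/-- The defect between the energy and its resolvent regularisation is ε times the Dirichlet energy.
This turns a balance for the former into an estimate for the latter. -/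
lemma mul_dirichletEnergy {ε : ℝ} (hε : 0 < ε) {f : Space d → ℝ}
    (hf : MemLp f 2 (torusMeasure d)) :
    ε * dirichletEnergy ε f
      = ∫ x, f x ^ 2 ∂torusMeasure d - weightedEnergy (resolventWeight ε) f := by
  rw [dirichletEnergy, ← weightedEnergy_const_mul, ← (hasSum_waveCoeff_sq hf).tsum_eq]
  unfold weightedEnergy
  rw [← (hasSum_waveCoeff_sq hf).summable.tsum_sub (summable_weightedEnergy
    (resolventWeight_nonneg hε.le) (resolventWeight_le_one hε.le) hf)]
  refine tsum_congr fun j => ?_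
  beta_reduce
  rw [one_sub_resolventWeight hε.le]; ring

variable {s : ℝ≥0∞} {u : ℝ → Space d → Space d} {f g : ℝ → Space d → ℝ} {κ : ℝ}

lemma IsForcedSolution.memLp (h : IsForcedSolution κ u f g) {t : ℝ} (ht : 0 ≤ t) :
    MemLp (f t) 2 (torusMeasure d) := by
  obtain ⟨K, hK⟩ := h.bounded t
  exact (hK t ⟨ht, le_rfl⟩).1.1

lemma IsForcedSolution.intervalIntegrable_weightedEnergy (h : IsForcedSolution κ u f g)
    {w : WaveIndex d → ℝ} {B : ℝ} (hw0 : ∀ j, 0 ≤ w j) (hwB : ∀ j, w j ≤ B) {t : ℝ}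
    (ht : 0 ≤ t) : IntervalIntegrable (fun τ => weightedEnergy w (f τ)) volume 0 t := by
  obtain ⟨K, hK⟩ := h.bounded t
  have hB : 0 ≤ B := (hw0 (0, false)).trans (hwB _)
  refine intervalIntegrable_of_measurable_of_bounded (K := B * K)
    (measurable_weightedEnergy h.measurable_left hw0) ht fun τ hτ => ?_
  rw [abs_of_nonneg (weightedEnergy_nonneg hw0 _)]
  exact (weightedEnergy_le hw0 hwB (hK τ hτ).1.1).trans
    (mul_le_mul_of_nonneg_left (hK τ hτ).1.2 hB)

lemma IsForcedSolution.integrableOn_rate_mul_weightedEnergy (hs : 1 ≤ s)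
    (hu : IsAdmissibleVelocity s u) (h : IsForcedSolution κ u f g)
    {w : WaveIndex d → ℝ} {B : ℝ} (hw0 : ∀ j, 0 ≤ w j) (hwB : ∀ j, w j ≤ B) {t : ℝ}
    (ht : 0 ≤ t) :
    IntegrableOn (fun τ => (gradSupNorm (u τ)).toReal * weightedEnergy w (f τ)) (Ioc 0 t) := by
  obtain ⟨K, hK⟩ := h.bounded t
  have hB : 0 ≤ B := (hw0 (0, false)).trans (hwB _)
  refine (hu.integrableOn_gradSupNorm hs ht).mul_bdd (c := B * K)
    (measurable_weightedEnergy h.measurable_left hw0).aestronglyMeasurable ?_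
  filter_upwards [ae_restrict_mem measurableSet_Ioc] with τ hτ
  have hτ' : τ ∈ Icc 0 t := ⟨hτ.1.le, hτ.2⟩
  rw [Real.norm_of_nonneg (weightedEnergy_nonneg hw0 _)]
  exact (weightedEnergy_le hw0 hwB (hK τ hτ').1.1).trans
    (mul_le_mul_of_nonneg_left (hK τ hτ').1.2 hB)

/-- The regularised energy balance of an advection-diffusion equation. -/
lemma IsForcedSolution.abs_resolvent_balance_le (hs : 1 ≤ s) (hu : IsAdmissibleVelocity s u)
    (h : IsForcedSolution κ u f f) {ε : ℝ} (hε : 0 < ε) {t : ℝ} (ht : 0 ≤ t) :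
    |weightedEnergy (resolventWeight ε) (f t) - weightedEnergy (resolventWeight ε) (f 0) +
        2 * κ * ∫ τ in (0 : ℝ)..t, dirichletEnergy ε (f τ)|
      ≤ 2 * ∫ τ in (0 : ℝ)..t, (gradSupNorm (u τ)).toReal *
          weightedEnergy (fun j => ε * (waveEigenvalue j * resolventWeight ε j ^ 2)) (f τ) := by
  have key := h.abs_energy_balance_le hs hu (m := resolventWeight ε) (a := 1) (ε := ε)
    (B := max 1 ε⁻¹) hε.le (resolventWeight_nonneg hε.le)
    (fun j => (resolventWeight_le_one hε.le j).trans (le_max_left _ _))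
    (fun j => (waveEigenvalue_mul_resolventWeight_le hε j).trans (le_max_right _ _))
    (fun τ _ j => by rw [← mul_assoc, resolventWeight_mul hε.le, one_mul]) ht
  have e1 : ∀ τ, ∑' j, waveEigenvalue j * resolventWeight ε j *
      (waveCoeff (f τ) j * waveCoeff (f τ) j) = dirichletEnergy ε (f τ) := fun τ =>
    tsum_congr fun j => by rw [sq]
  have e2 : ∀ τ, ε * ((gradSupNorm (u τ)).toReal *
      weightedEnergy (fun j => waveEigenvalue j * resolventWeight ε j ^ 2) (f τ))
      = (gradSupNorm (u τ)).toReal *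
      weightedEnergy (fun j => ε * (waveEigenvalue j * resolventWeight ε j ^ 2)) (f τ) := fun τ => by
    rw [weightedEnergy_const_mul]; ring
  simpa only [e1, e2] using key

lemma commutatorWeight_nonneg {ε : ℝ} (hε : 0 ≤ ε) (j : WaveIndex d) :
    0 ≤ ε * (waveEigenvalue j * resolventWeight ε j ^ 2) :=
  mul_nonneg hε (mul_nonneg (waveEigenvalue_nonneg j) (sq_nonneg _))

lemma commutatorWeight_le {ε : ℝ} (hε : 0 ≤ ε) (j : WaveIndex d) :
    ε * (waveEigenvalue j * resolventWeight ε j ^ 2)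
      ≤ ε * (waveEigenvalue j * resolventWeight ε j) := by
  have h1 := resolventWeight_le_one hε j
  have h2 := resolventWeight_nonneg hε j
  have h3 := waveEigenvalue_nonneg j
  gcongr
  rw [sq]
  exact mul_le_of_le_one_left h2 h1

lemma commutatorWeight_le_one {ε : ℝ} (hε : 0 ≤ ε) (j : WaveIndex d) :
    ε * (waveEigenvalue j * resolventWeight ε j ^ 2) ≤ 1 := by
  refine (commutatorWeight_le hε j).trans ?_
  rw [one_sub_resolventWeight hε]
  linarith [resolventWeight_nonneg hε j]

/-- Dropping one resolvent factor closes the Grönwall loop: the commutator error is bounded by the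
functional being estimated. -/
lemma weightedEnergy_commutatorWeight_le {ε : ℝ} (hε : 0 < ε) {f : Space d → ℝ}
    (hf : MemLp f 2 (torusMeasure d)) :
    weightedEnergy (fun j => ε * (waveEigenvalue j * resolventWeight ε j ^ 2)) f
      ≤ ε * dirichletEnergy ε f := by
  rw [dirichletEnergy, ← weightedEnergy_const_mul]
  refine weightedEnergy_mono (B := 1) (commutatorWeight_nonneg hε.le)
    (commutatorWeight_le hε.le) (fun j => ?_) hf
  rw [one_sub_resolventWeight hε.le]
  linarith [resolventWeight_nonneg hε.le j]

/-- The energy inequality. -/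
theorem IsForcedSolution.energy_le (hs : 1 ≤ s) (hu : IsAdmissibleVelocity s u) (hκ : 0 ≤ κ)
    (h : IsForcedSolution κ u f f) {ε : ℝ} (hε : 0 < ε) {t : ℝ} (ht : 0 ≤ t) :
    ∫ x, f t x ^ 2 ∂torusMeasure d + 2 * κ * ∫ τ in (0 : ℝ)..t, dirichletEnergy ε (f τ)
      ≤ ∫ x, f 0 x ^ 2 ∂torusMeasure d := by
  obtain ⟨K, hK⟩ := h.bounded t
  -- A second parameter `δ n ≤ ε` is sent to zero while ε stays fixed in the dissipation.
  set δ : ℕ → ℝ := fun n => ε * (1 / ((n : ℝ) + 1)) with hδ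
  have hδ0 : ∀ n, 0 < δ n := fun n => by positivity
  have hδε : ∀ n, δ n ≤ ε := fun n => by
    refine mul_le_of_le_one_right hε.le ?_
    rw [div_le_one (by positivity)]
    have : (0 : ℝ) ≤ n := n.cast_nonneg
    linarith
  have hδlim : Tendsto δ atTop (𝓝 0) := by
    have := (tendsto_one_div_add_atTop_nhds_zero_nat (𝕜 := ℝ)).const_mul ε
    simpa [hδ] using this
  have hrlim : ∀ j : WaveIndex d, Tendsto (fun n => resolventWeight (δ n) j) atTop (𝓝 1) := by
    intro j
    have h1 : Tendsto (fun n => 1 + δ n * waveEigenvalue j) atTop (𝓝 (1 + 0 * waveEigenvalue j)) :=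
      (hδlim.mul_const _).const_add 1
    have h2 := h1.inv₀ (by simp)
    simpa [resolventWeight] using h2
  have hstep : ∀ n, weightedEnergy (resolventWeight (δ n)) (f t) +
      2 * κ * ∫ τ in (0 : ℝ)..t, dirichletEnergy ε (f τ) ≤ ∫ x, f 0 x ^ 2 ∂torusMeasure d +
      2 * ∫ τ in (0 : ℝ)..t, (gradSupNorm (u τ)).toReal * weightedEnergy
        (fun j => δ n * (waveEigenvalue j * resolventWeight (δ n) j ^ 2)) (f τ) := by
    intro n
    have h1 := (abs_le.1 (h.abs_resolvent_balance_le hs hu (hδ0 n) ht)).2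
    have h2 : weightedEnergy (resolventWeight (δ n)) (f 0) ≤ ∫ x, f 0 x ^ 2 ∂torusMeasure d := by
      have := weightedEnergy_le (resolventWeight_nonneg (hδ0 n).le)
        (resolventWeight_le_one (hδ0 n).le) (h.memLp le_rfl)
      simpa using this
    have h3 : ∫ τ in (0 : ℝ)..t, dirichletEnergy ε (f τ)
        ≤ ∫ τ in (0 : ℝ)..t, dirichletEnergy (δ n) (f τ) := by
      refine intervalIntegral.integral_mono_on ht
        (h.intervalIntegrable_weightedEnergy (waveEigenvalue_mul_resolventWeight_nonneg hε.le)
          (waveEigenvalue_mul_resolventWeight_le hε) ht)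
        (h.intervalIntegrable_weightedEnergy
          (waveEigenvalue_mul_resolventWeight_nonneg (hδ0 n).le)
          (waveEigenvalue_mul_resolventWeight_le (hδ0 n)) ht) fun τ hτ => ?_
      exact weightedEnergy_mono (waveEigenvalue_mul_resolventWeight_nonneg hε.le)
        (fun j => mul_le_mul_of_nonneg_left (resolventWeight_anti (hδ0 n).le (hδε n) j)
          (waveEigenvalue_nonneg j)) (waveEigenvalue_mul_resolventWeight_le (hδ0 n)) (hK τ hτ).1.1
    have h4 := mul_le_mul_of_nonneg_left h3 (by positivity : 0 ≤ 2 * κ)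
    linarith
  have lim1 : Tendsto (fun n => weightedEnergy (resolventWeight (δ n)) (f t)) atTop
      (𝓝 (∫ x, f t x ^ 2 ∂torusMeasure d)) := by
    rw [← weightedEnergy_one (h.memLp ht)]
    exact tendsto_weightedEnergy (fun n => resolventWeight_nonneg (hδ0 n).le)
      (fun n => resolventWeight_le_one (hδ0 n).le) hrlim (h.memLp ht)
  -- The commutator weight `δλ/(1+δλ)²` is at most 1 and tends to 0 on every mode, so the commutator
  -- error disappears by dominated convergence.
  have lim2 : Tendsto (fun n => ∫ τ in (0 : ℝ)..t, (gradSupNorm (u τ)).toReal * weightedEnergy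
        (fun j => δ n * (waveEigenvalue j * resolventWeight (δ n) j ^ 2)) (f τ)) atTop
      (𝓝 (∫ τ in (0 : ℝ)..t, (gradSupNorm (u τ)).toReal * weightedEnergy (fun _ => 0) (f τ))) := by
    refine intervalIntegral.tendsto_integral_filter_of_dominated_convergence
      (fun τ => (gradSupNorm (u τ)).toReal * K) (Eventually.of_forall fun n => ?_)
      (Eventually.of_forall fun n => ae_of_all _ fun τ hτ => ?_) ?_
      (ae_of_all _ fun τ hτ => ?_)
    · rw [uIoc_of_le ht]
      exact (h.integrableOn_rate_mul_weightedEnergy hs hu (commutatorWeight_nonneg (hδ0 n).le)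
        (commutatorWeight_le_one (hδ0 n).le) ht).aestronglyMeasurable
    · rw [uIoc_of_le ht] at hτ
      have hτ' : τ ∈ Icc 0 t := ⟨hτ.1.le, hτ.2⟩
      have h0 := weightedEnergy_nonneg (commutatorWeight_nonneg (hδ0 n).le) (f τ)
      rw [Real.norm_of_nonneg (mul_nonneg ENNReal.toReal_nonneg h0)]
      refine mul_le_mul_of_nonneg_left ?_ ENNReal.toReal_nonneg
      refine (weightedEnergy_le (commutatorWeight_nonneg (hδ0 n).le)
        (commutatorWeight_le_one (hδ0 n).le) (hK τ hτ').1.1).trans ?_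
      rw [one_mul]
      exact (hK τ hτ').1.2
    · rw [intervalIntegrable_iff_integrableOn_Ioc_of_le ht]
      exact (hu.integrableOn_gradSupNorm hs ht).mul_const K
    · rw [uIoc_of_le ht] at hτ
      refine (tendsto_weightedEnergy (fun n => commutatorWeight_nonneg (hδ0 n).le)
        (fun n => commutatorWeight_le_one (hδ0 n).le) (fun j => ?_)
        (hK τ ⟨hτ.1.le, hτ.2⟩).1.1).const_mul _
      have := hδlim.mul (((hrlim j).pow 2).const_mul (waveEigenvalue j))
      simpa using this
  have hz : ∀ τ, weightedEnergy (fun _ => 0) (f τ) = 0 := fun τ => by simp [weightedEnergy]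
  simp only [hz, mul_zero, intervalIntegral.integral_zero] at lim2
  have := le_of_tendsto_of_tendsto' (lim1.add_const _) ((lim2.const_mul 2).const_add _) hstep
  simpa using this

lemma IsForcedSolution.integral_sq_le (hs : 1 ≤ s) (hu : IsAdmissibleVelocity s u) (hκ : 0 ≤ κ)
    (h : IsForcedSolution κ u f f) {t : ℝ} (ht : 0 ≤ t) :
    ∫ x, f t x ^ 2 ∂torusMeasure d ≤ ∫ x, f 0 x ^ 2 ∂torusMeasure d := by
  have h1 := h.energy_le hs hu hκ one_pos ht
  have h2 : 0 ≤ ∫ τ in (0 : ℝ)..t, dirichletEnergy 1 (f τ) :=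
    intervalIntegral.integral_nonneg ht fun τ _ => dirichletEnergy_nonneg zero_le_one _
  have h3 : 0 ≤ 2 * κ * ∫ τ in (0 : ℝ)..t, dirichletEnergy 1 (f τ) := by positivity
  linarith

/-- The growth of the regularised Dirichlet energy. -/
theorem IsForcedSolution.dirichletEnergy_le (hs : 1 ≤ s) (hu : IsAdmissibleVelocity s u)
    (hκ : 0 ≤ κ) (h : IsForcedSolution κ u f f) {ε : ℝ} (hε : 0 < ε) {t : ℝ} (ht : 0 ≤ t) :
    dirichletEnergy ε (f t) ≤ dirichletEnergy ε (f 0) * Real.exp (2 * t ^ timeExponent s) := by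
  have hB := waveEigenvalue_mul_resolventWeight_le (d := d) hε
  have h0 := waveEigenvalue_mul_resolventWeight_nonneg (d := d) hε.le
  -- The resolvent balance combined with the energy inequality cancels both `L²` norms and the
  -- dissipation. What remains bounds `ε` times the increment of the Dirichlet energy by its
  -- commutator error, and `ε` is divided out.
  have hstep : ∀ r ∈ Icc 0 t, dirichletEnergy ε (f r) ≤ dirichletEnergy ε (f 0) +
      ∫ τ in (0 : ℝ)..r, 2 * (gradSupNorm (u τ)).toReal * dirichletEnergy ε (f τ) := by
    intro r hr
    have h1 := (abs_le.1 (h.abs_resolvent_balance_le hs hu hε hr.1)).1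
    have h2 := h.energy_le hs hu hκ hε hr.1
    have h3 := mul_dirichletEnergy hε (h.memLp hr.1)
    have h4 := mul_dirichletEnergy hε (h.memLp le_rfl)
    have h5 : ∫ τ in (0 : ℝ)..r, (gradSupNorm (u τ)).toReal * weightedEnergy
        (fun j => ε * (waveEigenvalue j * resolventWeight ε j ^ 2)) (f τ)
        ≤ ∫ τ in (0 : ℝ)..r, ε * ((gradSupNorm (u τ)).toReal * dirichletEnergy ε (f τ)) := by
      refine intervalIntegral.integral_mono_on hr.1 ?_ ?_ fun τ hτ => ?_
      · rw [intervalIntegrable_iff_integrableOn_Ioc_of_le hr.1]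
        exact h.integrableOn_rate_mul_weightedEnergy hs hu (commutatorWeight_nonneg hε.le)
          (commutatorWeight_le_one hε.le) hr.1
      · rw [intervalIntegrable_iff_integrableOn_Ioc_of_le hr.1]
        exact (h.integrableOn_rate_mul_weightedEnergy hs hu h0 hB hr.1).const_mul ε
      · rw [mul_left_comm]
        exact mul_le_mul_of_nonneg_left
          (weightedEnergy_commutatorWeight_le hε (h.memLp hτ.1)) ENNReal.toReal_nonneg
    rw [intervalIntegral.integral_const_mul] at h5
    simp only [mul_assoc]
    rw [intervalIntegral.integral_const_mul]
    refine le_of_mul_le_mul_left ?_ hε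
    linarith
  have key := le_mul_exp_integral_of_le (T := t) (y := fun r => dirichletEnergy ε (f r))
    (g := fun τ => 2 * (gradSupNorm (u τ)).toReal) (c := dirichletEnergy ε (f 0))
    (fun r _ => dirichletEnergy_nonneg hε.le _)
    (fun r => mul_nonneg zero_le_two ENNReal.toReal_nonneg)
    ((hu.integrableOn_gradSupNorm hs ht).const_mul 2)
    (by
      have := (h.integrableOn_rate_mul_weightedEnergy hs hu h0 hB ht).const_mul 2
      simpa only [mul_assoc, dirichletEnergy, IntegrableOn] using this)
    hstep t ⟨ht, le_rfl⟩
  refine key.trans (mul_le_mul_of_nonneg_left ?_ (dirichletEnergy_nonneg hε.le _))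
  rw [intervalIntegral.integral_const_mul]
  gcongr
  exact hu.integral_gradSupNorm_le hs ht

/-- A lower bound for the energy of an advection-diffusion equation. -/
theorem IsForcedSolution.le_integral_sq (hs : 1 ≤ s) (hu : IsAdmissibleVelocity s u)
    (hκ : 0 ≤ κ) (h : IsForcedSolution κ u f f) {D : ℝ}
    (hD : ∀ ε, 0 < ε → dirichletEnergy ε (f 0) ≤ D) {t : ℝ} (ht : 0 ≤ t) :
    ∫ x, f 0 x ^ 2 ∂torusMeasure d - 2 * κ * t * (D * Real.exp (2 * t ^ timeExponent s))
      ≤ ∫ x, f t x ^ 2 ∂torusMeasure d := by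
  have hp : 0 ≤ timeExponent s := by
    rcases eq_or_ne s 1 with rfl | h1
    · rw [timeExponent_one]
    · exact (timeExponent_pos hs h1).le
  have hD0 : 0 ≤ D := (dirichletEnergy_nonneg zero_le_one _).trans (hD 1 one_pos)
  set X := D * Real.exp (2 * t ^ timeExponent s) with hX
  have hX0 : 0 ≤ X := by positivity
  have hDX : D ≤ X := le_mul_of_one_le_right hD0 (Real.one_le_exp (by positivity))
  have hbd : ∀ ε, 0 < ε → ∀ τ ∈ Icc 0 t, dirichletEnergy ε (f τ) ≤ X := fun ε hε τ hτ => by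
    refine (h.dirichletEnergy_le hs hu hκ hε hτ.1).trans ?_
    exact mul_le_mul (hD ε hε) (Real.exp_le_exp.2 (mul_le_mul_of_nonneg_left
      (Real.rpow_le_rpow hτ.1 hτ.2 hp) zero_le_two)) (Real.exp_pos _).le hD0
  -- With the Dirichlet energy at most `X` uniformly in ε, the regularisation defect at time 0 and
  -- the commutator error are both of order ε; only the dissipation survives as `ε → 0`.
  have hstep : ∀ ε, 0 < ε → ∫ x, f 0 x ^ 2 ∂torusMeasure d - 2 * κ * t * X
      - ε * (X + 2 * X * t ^ timeExponent s) ≤ ∫ x, f t x ^ 2 ∂torusMeasure d := by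
    intro ε hε
    have h1 := (abs_le.1 (h.abs_resolvent_balance_le hs hu hε ht)).1
    have h2 : ∫ τ in (0 : ℝ)..t, dirichletEnergy ε (f τ) ≤ t * X := by
      have := intervalIntegral.integral_mono_on ht
        (h.intervalIntegrable_weightedEnergy (waveEigenvalue_mul_resolventWeight_nonneg hε.le)
          (waveEigenvalue_mul_resolventWeight_le hε) ht) intervalIntegrable_const (hbd ε hε)
      simpa [dirichletEnergy] using this
    have h3 : ∫ τ in (0 : ℝ)..t, (gradSupNorm (u τ)).toReal * weightedEnergy
        (fun j => ε * (waveEigenvalue j * resolventWeight ε j ^ 2)) (f τ)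
        ≤ t ^ timeExponent s * (ε * X) := by
      calc _ ≤ ∫ τ in (0 : ℝ)..t, (gradSupNorm (u τ)).toReal * (ε * X) := by
            refine intervalIntegral.integral_mono_on ht ?_ ?_ fun τ hτ => ?_
            · rw [intervalIntegrable_iff_integrableOn_Ioc_of_le ht]
              exact h.integrableOn_rate_mul_weightedEnergy hs hu (commutatorWeight_nonneg hε.le)
                (commutatorWeight_le_one hε.le) ht
            · rw [intervalIntegrable_iff_integrableOn_Ioc_of_le ht]
              exact (hu.integrableOn_gradSupNorm hs ht).mul_const _
            · refine mul_le_mul_of_nonneg_left ?_ ENNReal.toReal_nonneg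
              exact (weightedEnergy_commutatorWeight_le hε (h.memLp hτ.1)).trans
                (mul_le_mul_of_nonneg_left (hbd ε hε τ hτ) hε.le)
        _ ≤ _ := by
            rw [intervalIntegral.integral_mul_const]
            gcongr
            exact hu.integral_gradSupNorm_le hs ht
    have h4 : weightedEnergy (resolventWeight ε) (f t) ≤ ∫ x, f t x ^ 2 ∂torusMeasure d := by
      have := weightedEnergy_le (resolventWeight_nonneg hε.le)
        (resolventWeight_le_one hε.le) (h.memLp ht)
      simpa using this
    have h5 := mul_dirichletEnergy hε (h.memLp le_rfl)
    have h6 := mul_le_mul_of_nonneg_left ((hD ε hε).trans hDX) hε.le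
    have h7 := mul_le_mul_of_nonneg_left h2 (by positivity : 0 ≤ 2 * κ)
    nlinarith
  have hlim : Tendsto (fun n : ℕ => ∫ x, f 0 x ^ 2 ∂torusMeasure d - 2 * κ * t * X
      - 1 / ((n : ℝ) + 1) * (X + 2 * X * t ^ timeExponent s)) atTop
      (𝓝 (∫ x, f 0 x ^ 2 ∂torusMeasure d - 2 * κ * t * X
      - 0 * (X + 2 * X * t ^ timeExponent s))) :=
    ((tendsto_one_div_add_atTop_nhds_zero_nat (𝕜 := ℝ)).mul_const _).const_sub _
  rw [zero_mul, sub_zero] at hlim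
  exact le_of_tendsto' hlim fun n => hstep _ (by positivity)

end

section

variable {d : ℕ}

/-! ### Norms in terms of Fourier coefficients -/

lemma eLpNorm_two_eq_ofReal_sqrt {α F : Type*} [MeasurableSpace α] [NormedAddCommGroup F]
    {μ : Measure α} {f : α → F} (hf : MemLp f 2 μ) :
    eLpNorm f 2 μ = ENNReal.ofReal √(∫ x, ‖f x‖ ^ 2 ∂μ) := by
  rw [hf.eLpNorm_eq_integral_rpow_norm (by norm_num) (by norm_num), Real.sqrt_eq_rpow]
  simp

lemma l2Norm_eq {f : Space d → ℝ} (hf : MemLp f 2 (torusMeasure d)) :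
    l2Norm f = ENNReal.ofReal √(∫ x, f x ^ 2 ∂torusMeasure d) := by
  rw [l2Norm, eLpNorm_two_eq_ofReal_sqrt hf]
  simp only [Real.norm_eq_abs, sq_abs]

/-- The weights `1 / (2π|k|)²` of the negative Sobolev norm, with value `0` at `k = 0`. -/
def negSobolevWeight (j : WaveIndex d) : ℝ := (waveEigenvalue j)⁻¹

lemma negSobolevWeight_nonneg (j : WaveIndex d) : 0 ≤ negSobolevWeight j :=
  inv_nonneg.2 (waveEigenvalue_nonneg j)

lemma latticePoint_eq_zero_iff {k : Fin d → ℤ} : latticePoint k = 0 ↔ k = 0 := by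
  constructor
  · intro h
    funext i
    have := congrArg (fun x : Space d => x i) h
    simpa [latticePoint] using this
  · rintro rfl
    ext i; simp [latticePoint]

lemma one_le_norm_latticePoint {k : Fin d → ℤ} (hk : k ≠ 0) : 1 ≤ ‖latticePoint k‖ := by
  obtain ⟨i, hi⟩ := Function.ne_iff.1 hk
  have h1 : (1 : ℝ) ≤ |(k i : ℝ)| := by exact_mod_cast Int.one_le_abs hi
  exact h1.trans (by simpa [latticePoint] using PiLp.norm_apply_le (latticePoint k) i)

lemma waveEigenvalue_eq_zero_iff (j : WaveIndex d) : waveEigenvalue j = 0 ↔ j.1 = 0 := by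
  have := Real.pi_pos.ne'
  simp [waveEigenvalue, latticePoint_eq_zero_iff, this]

lemma negSobolevWeight_le_one (j : WaveIndex d) : negSobolevWeight j ≤ 1 := by
  by_cases h : j.1 = 0
  · rw [negSobolevWeight, (waveEigenvalue_eq_zero_iff j).2 h]; simp
  · refine inv_le_one_of_one_le₀ ?_
    have h1 := one_le_norm_latticePoint h
    have h2 := Real.pi_gt_three
    rw [waveEigenvalue]
    refine one_le_pow₀ ?_
    nlinarith

lemma waveEigenvalue_mul_negSobolevWeight_le_one (j : WaveIndex d) :
    waveEigenvalue j * negSobolevWeight j ≤ 1 := mul_inv_le_one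

lemma hNegOneNorm_eq {f : Space d → ℝ} (hf : MemLp f 2 (torusMeasure d)) :
    hNegOneNorm f = ENNReal.ofReal √(weightedEnergy negSobolevWeight f) := by
  have hfi : Integrable f (torusMeasure d) := hf.integrable (by norm_num)
  set F : (Fin d → ℤ) → ℝ≥0∞ := fun k => ∑' b, ENNReal.ofReal
    (negSobolevWeight (k, b) * waveCoeff f (k, b) ^ 2) with hF
  have h1 : ENNReal.ofReal (weightedEnergy negSobolevWeight f) = ∑' k, F k := by
    rw [weightedEnergy, ENNReal.ofReal_tsum_of_nonneg
      (fun j => mul_nonneg (negSobolevWeight_nonneg j) (sq_nonneg _))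
      (summable_weightedEnergy negSobolevWeight_nonneg negSobolevWeight_le_one hf),
      ENNReal.tsum_prod']
  -- The zero frequency drops out because its weight is `0⁻¹ = 0`.
  have hF0 : F 0 = 0 := by
    have : ∀ b, negSobolevWeight ((0 : Fin d → ℤ), b) = 0 := fun b => by
      rw [negSobolevWeight, (waveEigenvalue_eq_zero_iff _).2 rfl, inv_zero]
    simp [hF, this]
  have h2 : ∑' k, F k = ∑' k : {k : Fin d → ℤ // k ≠ 0}, F k.1 := by
    refine (tsum_subtype_eq_of_support_subset (s := {k | k ≠ 0}) fun k hk => ?_).symm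
    rintro rfl
    exact hk hF0
  have h3 : ∀ k : {k : Fin d → ℤ // k ≠ 0}, ‖fourierCoefficient f k.1‖ₑ ^ 2 /
      ENNReal.ofReal ((2 * Real.pi * ‖latticePoint k.1‖) ^ 2) = F k.1 := by
    intro k
    have hk := one_le_norm_latticePoint k.2
    have hpos : 0 < (2 * Real.pi * ‖latticePoint k.1‖) ^ 2 := by positivity
    rw [← ofReal_norm, ← ENNReal.ofReal_pow (norm_nonneg _), ← ENNReal.ofReal_div_of_pos hpos,
      norm_fourierCoefficient_sq hfi, hF]
    simp only [tsum_fintype, Fintype.sum_bool]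
    rw [← ENNReal.ofReal_add (mul_nonneg (negSobolevWeight_nonneg _) (sq_nonneg _))
      (mul_nonneg (negSobolevWeight_nonneg _) (sq_nonneg _))]
    congr 1
    simp only [negSobolevWeight, waveEigenvalue]
    ring
  rw [hNegOneNorm, tsum_congr h3, ← h2, ← h1, ENNReal.ofReal_rpow_of_nonneg
    (weightedEnergy_nonneg negSobolevWeight_nonneg f) (by norm_num), Real.sqrt_eq_rpow]

/-! ### Initial data -/

namespace IsInitialDatum

variable {M : ℝ} {θ₀ : Space d → ℝ}

lemma memLp (h : IsInitialDatum M θ₀) : MemLp θ₀ 2 (torusMeasure d) :=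
  h.gradient.choose_spec.1.memLp

lemma integral_sq_le (hM : 0 < M) (h : IsInitialDatum M θ₀) :
    ∫ x, θ₀ x ^ 2 ∂torusMeasure d ≤ M ^ 2 := by
  have h1 := h.norm_upper
  rw [l2Norm_eq h.memLp, ENNReal.ofReal_le_ofReal_iff hM.le] at h1
  exact (Real.sqrt_le_left hM.le).1 h1

lemma le_integral_sq (hM : 0 < M) (h : IsInitialDatum M θ₀) :
    M⁻¹ ^ 2 ≤ ∫ x, θ₀ x ^ 2 ∂torusMeasure d := by
  have h1 := h.norm_lower
  rw [l2Norm_eq h.memLp, ENNReal.ofReal_le_ofReal_iff (Real.sqrt_nonneg _)] at h1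
  exact (Real.le_sqrt' (inv_pos.2 hM)).1 h1

end IsInitialDatum

/-- Test the weak gradient with the flipped wave, whose gradient is a multiple of the original wave.
Squaring removes the signs. -/
lemma IsWeakGradient.waveCoeff_apply {f : Space d → ℝ} {G : Space d → Space d}
    (h : IsWeakGradient f G) (j : WaveIndex d) (i : Fin d) :
    waveCoeff (fun x => G x i) (waveFlip j) ^ 2
      = (2 * Real.pi * j.1 i) ^ 2 * waveCoeff f j ^ 2 := by
  have hfi : Integrable f (torusMeasure d) := h.memLp.integrable (by norm_num)
  have hGi : Integrable G (torusMeasure d) := h.memLp_grad.integrable (by norm_num)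
  have hff : waveFlip (waveFlip j) = j := by
    obtain ⟨k, b⟩ := j
    cases b <;> rfl
  set j' := waveFlip j with hj'
  have hint1 : Integrable (fun x => f x • gradient (wave j') x) (torusMeasure d) := by
    have hc := (contDiff_gradient (contDiff_wave j')).continuous
    exact hfi.smul_bdd (2 * Real.pi * ‖latticePoint j'.1‖) hc.aestronglyMeasurable
      (ae_of_all _ (norm_gradient_wave_le j'))
  have hint2 : Integrable (fun x => wave j' x • G x) (torusMeasure d) :=
    hGi.bdd_smul 1 (continuous_wave j').aestronglyMeasurable
      (ae_of_all _ fun x => abs_wave_le_one j' x)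
  have h1 := congrArg (EuclideanSpace.proj (𝕜 := ℝ) i) (h.integral_eq _ (isTestFunction_wave j'))
  rw [map_neg, ← ContinuousLinearMap.integral_comp_comm _ hint1,
    ← ContinuousLinearMap.integral_comp_comm _ hint2] at h1
  simp only [map_smul, PiLp.proj_apply, smul_eq_mul, gradient_wave_apply, hff] at h1
  have e1 : ∀ x, f x * (waveSign j'.2 * (2 * Real.pi * j'.1 i) * wave j x)
      = (waveSign j'.2 * (2 * Real.pi * j'.1 i)) * (f x * wave j x) := fun x => by ring
  have e2 : ∀ x, wave j' x * G x i = G x i * wave j' x := fun x => mul_comm _ _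
  simp only [e1, e2, integral_const_mul] at h1
  have h2 : waveSign j'.2 * (2 * Real.pi * j'.1 i) * waveCoeff f j
      = -waveCoeff (fun x => G x i) j' := h1
  have h3 : j'.1 i = j.1 i := rfl
  rw [← neg_sq (waveCoeff _ j'), ← h2, mul_pow, mul_pow, waveSign_sq, one_mul, h3]

/-- The unregularised sum is controlled by Parseval for the components of the weak gradient; the
resolvent factor is at most 1, so the bound is uniform in ε. -/
lemma IsInitialDatum.dirichletEnergy_le {M : ℝ} {θ₀ : Space d → ℝ} (hM : 0 < M)
    (h : IsInitialDatum M θ₀) {ε : ℝ} (hε : 0 < ε) : dirichletEnergy ε θ₀ ≤ M ^ 2 := by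
  obtain ⟨G, hG, -, hGM⟩ := h.gradient
  have hGi : ∀ i, MemLp (fun x => G x i) 2 (torusMeasure d) := fun i =>
    hG.memLp_grad.continuousLinearMap_comp (EuclideanSpace.proj (𝕜 := ℝ) i)
  have h1 : ∫ x, ‖G x‖ ^ 2 ∂torusMeasure d ≤ M ^ 2 := by
    rw [eLpNorm_two_eq_ofReal_sqrt hG.memLp_grad, ENNReal.ofReal_le_ofReal_iff hM.le] at hGM
    exact (Real.sqrt_le_left hM.le).1 hGM
  have h2 : ∫ x, ‖G x‖ ^ 2 ∂torusMeasure d = ∑ i, ∫ x, G x i ^ 2 ∂torusMeasure d := by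
    rw [← integral_finsetSum _ fun i _ => (hGi i).integrable_sq]
    refine integral_congr_ae (ae_of_all _ fun x => ?_)
    simp [EuclideanSpace.norm_sq_eq]
  refine le_trans ?_ (h2 ▸ h1)
  refine Real.tsum_le_of_sum_le (fun j => mul_nonneg
    (waveEigenvalue_mul_resolventWeight_nonneg hε.le j) (sq_nonneg _)) fun S => ?_
  calc ∑ j ∈ S, waveEigenvalue j * resolventWeight ε j * waveCoeff θ₀ j ^ 2
      ≤ ∑ j ∈ S, ∑ i, waveCoeff (fun x => G x i) (waveFlip j) ^ 2 := by
        refine Finset.sum_le_sum fun j _ => ?_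
        simp only [hG.waveCoeff_apply]
        rw [← Finset.sum_mul, ← waveEigenvalue_eq_sum]
        exact mul_le_mul_of_nonneg_right (mul_le_of_le_one_right (waveEigenvalue_nonneg j)
          (resolventWeight_le_one hε.le j)) (sq_nonneg _)
    _ = ∑ i, ∑ j ∈ S, waveCoeff (fun x => G x i) (waveFlip j) ^ 2 := Finset.sum_comm
    _ ≤ _ := Finset.sum_le_sum fun i _ => sum_le_hasSum S (fun j _ => sq_nonneg _)
        (waveFlip.hasSum_iff.2 (hasSum_waveCoeff_sq (hGi i)))

/-! ### Distributional solutions -/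

variable {s : ℝ≥0∞} {u : ℝ → Space d → Space d} {κ : ℝ} {θ₀ : Space d → ℝ}
  {θ θκ : ℝ → Space d → ℝ}

lemma waveCoeff_sub {f g : Space d → ℝ} (hf : MemLp f 2 (torusMeasure d))
    (hg : MemLp g 2 (torusMeasure d)) (j : WaveIndex d) :
    waveCoeff (fun x => f x - g x) j = waveCoeff f j - waveCoeff g j := by
  unfold waveCoeff
  rw [← integral_sub (integrable_mul_wave (hf.integrable (by norm_num)) j)
    (integrable_mul_wave (hg.integrable (by norm_num)) j)]
  simp only [sub_mul]

lemma integrable_mul_inner_gradient_wave {v : Space d → Space d} (hvm : Measurable v) {U : ℝ}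
    (hU : ∀ᵐ x ∂torusMeasure d, ‖v x‖ ≤ U) {f : Space d → ℝ} (hf : MemLp f 2 (torusMeasure d))
    (j : WaveIndex d) :
    Integrable (fun x => f x * ⟪v x, gradient (wave j) x⟫_ℝ) (torusMeasure d) := by
  have hc := (contDiff_gradient (contDiff_wave j)).continuous
  refine (hf.integrable (by norm_num)).mul_bdd (c := U * (2 * Real.pi * ‖latticePoint j.1‖))
    (hvm.inner hc.measurable).aestronglyMeasurable ?_
  filter_upwards [hU] with x hx
  exact (norm_inner_le_norm _ _).trans (mul_le_mul hx (norm_gradient_wave_le j x) (norm_nonneg _)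
    ((norm_nonneg _).trans hx))

namespace IsSolution

lemma exists_bound (h : IsSolution κ u θ₀ θ) (T : ℝ) : ∃ K : ℝ, ∀ t ∈ Icc 0 T,
    MemLp (θ t) 2 (torusMeasure d) ∧ ∫ x, θ t x ^ 2 ∂torusMeasure d ≤ K := by
  obtain ⟨K, hK⟩ := h.bounded T
  refine ⟨(K : ℝ) ^ 2, fun t ht => ?_⟩
  have hm : MemLp (θ t) 2 (torusMeasure d) :=
    ⟨(h.measurable.comp measurable_prodMk_left).aestronglyMeasurable,
      (hK t ht).trans_lt ENNReal.coe_lt_top⟩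
  refine ⟨hm, ?_⟩
  have h1 := hK t ht
  rw [l2Norm_eq hm, ← ENNReal.ofReal_coe_nnreal, ENNReal.ofReal_le_ofReal_iff K.coe_nonneg] at h1
  exact (Real.sqrt_le_left K.coe_nonneg).1 h1

lemma memLp (h : IsSolution κ u θ₀ θ) {t : ℝ} (ht : 0 ≤ t) :
    MemLp (θ t) 2 (torusMeasure d) := by
  obtain ⟨K, hK⟩ := h.exists_bound t
  exact (hK t ⟨ht, le_rfl⟩).1

/-- The weak equation fixes the initial value only through its pairings with test functions;
equality of coefficients is all that is used later. -/
lemma waveCoeff_zero (h : IsSolution κ u θ₀ θ) (j : WaveIndex d) :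
    waveCoeff (θ 0) j = waveCoeff θ₀ j := by
  have := h.equation _ (isTestFunction_wave j) 0 le_rfl
  simpa [waveCoeff] using this

lemma isForcedSolution (hu : IsAdmissibleVelocity s u) (h : IsSolution κ u θ₀ θ) :
    IsForcedSolution κ u θ θ := by
  refine ⟨h.measurable, h.measurable, fun T => ?_, fun j t ht => ?_⟩
  · obtain ⟨K, hK⟩ := h.exists_bound T
    exact ⟨K, fun t ht => ⟨hK t ht, hK t ht⟩⟩
  · rw [h.waveCoeff_zero]
    have e := h.equation _ (isTestFunction_wave j) t ht
    rw [waveCoeff, waveCoeff, e]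
    congr 1
    refine intervalIntegral.integral_congr_ae ?_
    filter_upwards [ae_uIoc_of_ae_Ioi ht hu.ae_norm_le] with τ h1 hτ
    have hτ' : τ ∈ Ioc 0 t := uIoc_of_le ht ▸ hτ
    have hm := h.memLp hτ'.1.le
    have hum : Measurable (u τ) := hu.measurable.comp measurable_prodMk_left
    have i1 := integrable_mul_inner_gradient_wave hum (h1 hτ) hm j
    have i2 := (integrable_mul_wave (hm.integrable (by norm_num)) j).const_mul
      (κ * waveEigenvalue j)
    have e1 : ∀ x, θ τ x * (⟪u τ x, gradient (wave j) x⟫_ℝ +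
        κ * Laplacian.laplacian (wave j) x) = θ τ x * ⟪u τ x, gradient (wave j) x⟫_ℝ -
        κ * waveEigenvalue j * (θ τ x * wave j x) := fun x => by
      rw [laplacian_wave]; ring
    simp only [e1]
    rw [integral_sub i1 i2, integral_const_mul, waveFlux, waveCoeff]
    ring

/-- The difference of a diffusive and a non-diffusive solution. -/
lemma isForcedSolution_sub (hu : IsAdmissibleVelocity s u) (hκ : IsSolution κ u θ₀ θκ)
    (h : IsSolution 0 u θ₀ θ) :
    IsForcedSolution κ u (fun t x => θκ t x - θ t x) θκ := by
  have hF := hκ.isForcedSolution hu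
  have hF0 := h.isForcedSolution hu
  refine ⟨hκ.measurable.sub h.measurable, hκ.measurable, fun T => ?_, fun j t ht => ?_⟩
  · obtain ⟨K, hK⟩ := hκ.exists_bound T
    obtain ⟨K', hK'⟩ := h.exists_bound T
    refine ⟨max K (2 * K + 2 * K'), fun t ht => ⟨⟨(hK t ht).1.sub (hK' t ht).1, ?_⟩,
      (hK t ht).1, (hK t ht).2.trans (le_max_left _ _)⟩⟩
    refine le_trans ?_ (le_max_right _ _)
    have i1 := (hK t ht).1.integrable_sq
    have i2 := (hK' t ht).1.integrable_sq
    calc ∫ x, (θκ t x - θ t x) ^ 2 ∂torusMeasure d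
        ≤ ∫ x, (2 * θκ t x ^ 2 + 2 * θ t x ^ 2) ∂torusMeasure d := by
          refine integral_mono ((hK t ht).1.sub (hK' t ht).1).integrable_sq
            ((i1.const_mul 2).add (i2.const_mul 2)) fun x => ?_
          beta_reduce
          nlinarith [sq_nonneg (θκ t x + θ t x)]
      _ ≤ _ := by
          rw [integral_add (i1.const_mul 2) (i2.const_mul 2), integral_const_mul,
            integral_const_mul]
          linarith [(hK t ht).2, (hK' t ht).2]
  · rw [waveCoeff_sub (hκ.memLp ht) (h.memLp ht), waveCoeff_sub (hκ.memLp le_rfl)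
      (h.memLp le_rfl), hF.coeff_eq j t ht, hF0.coeff_eq j t ht]
    obtain ⟨K, hK⟩ := hκ.exists_bound t
    have i1 := hF.intervalIntegrable_waveFlux hu ht j
    have i2 := hF0.intervalIntegrable_waveFlux hu ht j
    have i3 : IntervalIntegrable (fun τ => κ * (waveEigenvalue j * waveCoeff (θκ τ) j))
        volume 0 t := by
      refine ((intervalIntegrable_of_measurable_of_bounded (K := √K)
        (measurable_waveCoeff hκ.measurable j) ht fun τ hτ => ?_).const_mul _).const_mul _
      exact Real.abs_le_sqrt ((waveCoeff_sq_le (hK τ hτ).1 j).trans (hK τ hτ).2)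
    have e : ∫ τ in (0 : ℝ)..t, (waveFlux u (fun t x => θκ t x - θ t x) j τ -
        κ * (waveEigenvalue j * waveCoeff (θκ τ) j)) = ∫ τ in (0 : ℝ)..t,
        ((waveFlux u θκ j τ - κ * (waveEigenvalue j * waveCoeff (θκ τ) j)) -
          waveFlux u θ j τ) := by
      refine intervalIntegral.integral_congr_ae ?_
      filter_upwards [ae_uIoc_of_ae_Ioi ht hu.ae_norm_le] with τ h1 hτ
      have hτ' : τ ∈ Ioc 0 t := uIoc_of_le ht ▸ hτ
      have hum : Measurable (u τ) := hu.measurable.comp measurable_prodMk_left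
      have : waveFlux u (fun t x => θκ t x - θ t x) j τ
          = waveFlux u θκ j τ - waveFlux u θ j τ := by
        unfold waveFlux
        rw [← integral_sub (integrable_mul_inner_gradient_wave hum (h1 hτ)
          (hκ.memLp hτ'.1.le) j) (integrable_mul_inner_gradient_wave hum (h1 hτ)
          (h.memLp hτ'.1.le) j)]
        simp only [sub_mul]
      rw [this]; ring
    rw [e, intervalIntegral.integral_sub (i1.sub i3) i2]
    simp only [zero_mul, sub_zero]
    ring

lemma integral_sq_zero (h : IsSolution κ u θ₀ θ) (h₀ : MemLp θ₀ 2 (torusMeasure d)) :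
    ∫ x, θ 0 x ^ 2 ∂torusMeasure d = ∫ x, θ₀ x ^ 2 ∂torusMeasure d := by
  rw [← (hasSum_waveCoeff_sq h₀).tsum_eq, ← (hasSum_waveCoeff_sq (h.memLp le_rfl)).tsum_eq]
  simp only [h.waveCoeff_zero]

lemma integral_sq_le (hs : 1 ≤ s) (hu : IsAdmissibleVelocity s u) (hκ : 0 ≤ κ) {M : ℝ}
    (hM : 0 < M) (h₀ : IsInitialDatum M θ₀) (h : IsSolution κ u θ₀ θ) {t : ℝ} (ht : 0 ≤ t) :
    ∫ x, θ t x ^ 2 ∂torusMeasure d ≤ M ^ 2 :=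
  ((h.isForcedSolution hu).integral_sq_le hs hu hκ ht).trans
    ((h.integral_sq_zero h₀.memLp).le.trans (h₀.integral_sq_le hM))

/-- The `Ḣ⁻¹` distance of the diffusive and the non-diffusive solution. -/
theorem weightedEnergy_sub_le (hs : 1 ≤ s) (hu : IsAdmissibleVelocity s u) (hκ : 0 ≤ κ) {M : ℝ}
    (hM : 0 < M) (h₀ : IsInitialDatum M θ₀) (hθ : IsSolution 0 u θ₀ θ)
    (hθκ : IsSolution κ u θ₀ θκ) {t : ℝ} (ht : 0 ≤ t) :
    weightedEnergy negSobolevWeight (fun x => θκ t x - θ t x)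
      ≤ 4 * M ^ 2 * (κ * t) * Real.exp (2 * t ^ timeExponent s) := by
  have h := hθκ.isForcedSolution_sub hu hθ
  set w : ℝ → Space d → ℝ := fun t x => θκ t x - θ t x with hw
  have hwc : ∀ τ, 0 ≤ τ → ∀ j, waveCoeff (w τ) j = waveCoeff (θκ τ) j - waveCoeff (θ τ) j :=
    fun τ hτ j => waveCoeff_sub (hθκ.memLp hτ) (hθ.memLp hτ) j
  have hw0 : ∀ j, waveCoeff (w 0) j = 0 := fun j => by
    rw [hwc 0 le_rfl, hθκ.waveCoeff_zero, hθ.waveCoeff_zero, sub_self]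
  -- The mean is conserved by both equations, so the difference has no zero mode and `-Δ` can be
  -- inverted on it.
  have hmean : ∀ τ, 0 ≤ τ → ∀ j, waveEigenvalue j = 0 → waveCoeff (w τ) j = 0 := by
    intro τ hτ j hj
    have hk : latticePoint j.1 = 0 := latticePoint_eq_zero_iff.2 ((waveEigenvalue_eq_zero_iff j).1 hj)
    have hfl : ∀ r, waveFlux u w j r = 0 := fun r => by
      simp [waveFlux, gradient_wave, hk]
    rw [h.coeff_eq j τ hτ, hw0]
    simp [hfl, hj]
  -- The two derivatives of the diffusion cancel against the `Ḣ⁻¹` weight, leaving `⟨θκ - θ, θκ⟩`.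
  -- Termwise `|(a - b)a| ≤ 3a²/2 + b²/2`, and both `L²` norms are at most M.
  have hcross : ∀ τ ∈ Icc 0 t, |∑' j, waveEigenvalue j * negSobolevWeight j *
      (waveCoeff (w τ) j * waveCoeff (θκ τ) j)| ≤ 2 * M ^ 2 := by
    intro τ hτ
    have s1 := hasSum_waveCoeff_sq (hθκ.memLp hτ.1)
    have s2 := hasSum_waveCoeff_sq (hθ.memLp hτ.1)
    have s3 := (s1.mul_left (3 / 2)).add (s2.mul_left (1 / 2))
    have hb : ∀ j, ‖waveEigenvalue j * negSobolevWeight j *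
        (waveCoeff (w τ) j * waveCoeff (θκ τ) j)‖
        ≤ 3 / 2 * waveCoeff (θκ τ) j ^ 2 + 1 / 2 * waveCoeff (θ τ) j ^ 2 := fun j => by
      rw [norm_mul, Real.norm_of_nonneg (mul_nonneg (waveEigenvalue_nonneg j)
        (negSobolevWeight_nonneg j))]
      refine (mul_le_of_le_one_left (norm_nonneg _)
        (waveEigenvalue_mul_negSobolevWeight_le_one j)).trans ?_
      rw [hwc τ hτ.1, Real.norm_eq_abs]
      refine abs_le.2 ⟨?_, ?_⟩ <;>
        nlinarith [sq_nonneg (waveCoeff (θκ τ) j - waveCoeff (θ τ) j),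
          sq_nonneg (waveCoeff (θκ τ) j + waveCoeff (θ τ) j),
          sq_nonneg (waveCoeff (θκ τ) j), sq_nonneg (waveCoeff (θ τ) j)]
    have := tsum_of_norm_bounded s3 hb
    rw [Real.norm_eq_abs] at this
    refine this.trans ?_
    have b1 := hθκ.integral_sq_le hs hu hκ hM h₀ hτ.1
    have b2 := hθ.integral_sq_le hs hu le_rfl hM h₀ hτ.1
    linarith
  have hE0 : weightedEnergy negSobolevWeight (w 0) = 0 := by simp [weightedEnergy, hw0]
  have hstep : ∀ r ∈ Icc 0 t, weightedEnergy negSobolevWeight (w r) ≤ 4 * M ^ 2 * (κ * t) +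
      ∫ τ in (0 : ℝ)..r, 2 * (gradSupNorm (u τ)).toReal *
        weightedEnergy negSobolevWeight (w τ) := by
    intro r hr
    have key := (abs_le.1 (h.abs_energy_balance_le hs hu (m := negSobolevWeight) (a := 0)
      (ε := 1) (B := 1) zero_le_one negSobolevWeight_nonneg negSobolevWeight_le_one
      waveEigenvalue_mul_negSobolevWeight_le_one (fun τ hτ j => by
        by_cases hj : waveEigenvalue j = 0
        · rw [hmean τ hτ j hj]; simp
        · rw [zero_add, one_mul, ← mul_assoc, negSobolevWeight, mul_inv_cancel₀ hj, one_mul])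
      hr.1)).2
    -- The commutator weight `λm²` with `m = λ⁻¹` is the `Ḣ⁻¹` weight again, so Grönwall applies
    -- directly.
    have e1 : (fun j : WaveIndex d => waveEigenvalue j * negSobolevWeight j ^ 2)
        = negSobolevWeight := by
      funext j
      by_cases hj : waveEigenvalue j = 0
      · simp [negSobolevWeight, hj]
      · rw [negSobolevWeight]; field_simp
    rw [e1, hE0] at key
    have h2 : |∫ τ in (0 : ℝ)..r, ∑' j, waveEigenvalue j * negSobolevWeight j *
        (waveCoeff (w τ) j * waveCoeff (θκ τ) j)| ≤ 2 * M ^ 2 * t := by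
      have := intervalIntegral.norm_integral_le_of_norm_le_const (a := 0) (b := r)
        (C := 2 * M ^ 2) (f := fun τ => ∑' j, waveEigenvalue j * negSobolevWeight j *
        (waveCoeff (w τ) j * waveCoeff (θκ τ) j)) (fun τ hτ => by
          rw [uIoc_of_le hr.1] at hτ
          exact hcross τ ⟨hτ.1.le, hτ.2.trans hr.2⟩)
      rw [sub_zero, abs_of_nonneg hr.1, Real.norm_eq_abs] at this
      exact this.trans (by gcongr; exact hr.2)
    have h3 := (abs_le.1 h2).1
    have h4 := mul_le_mul_of_nonneg_left h3 (by positivity : 0 ≤ 2 * κ)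
    simp only [one_mul] at key
    simp only [mul_assoc 2 (ENNReal.toReal _)]
    rw [intervalIntegral.integral_const_mul]
    nlinarith
  have key := le_mul_exp_integral_of_le (T := t)
    (y := fun r => weightedEnergy negSobolevWeight (w r))
    (g := fun τ => 2 * (gradSupNorm (u τ)).toReal) (c := 4 * M ^ 2 * (κ * t))
    (fun r _ => weightedEnergy_nonneg negSobolevWeight_nonneg _)
    (fun r => mul_nonneg zero_le_two ENNReal.toReal_nonneg)
    ((hu.integrableOn_gradSupNorm hs ht).const_mul 2)
    (by
      have := (h.integrableOn_rate_mul_weightedEnergy hs hu negSobolevWeight_nonneg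
        negSobolevWeight_le_one ht).const_mul 2
      simpa only [mul_assoc, IntegrableOn] using this)
    hstep t ⟨ht, le_rfl⟩
  refine key.trans (mul_le_mul_of_nonneg_left ?_ (by positivity))
  rw [intervalIntegral.integral_const_mul]
  gcongr
  exact hu.integral_gradSupNorm_le hs ht

/-- A lower bound for the energy of the diffusive solution. -/
theorem le_integral_sq (hs : 1 ≤ s) (hu : IsAdmissibleVelocity s u) (hκ : 0 ≤ κ) {M : ℝ}
    (hM : 0 < M) (h₀ : IsInitialDatum M θ₀) (h : IsSolution κ u θ₀ θ) {t : ℝ} (ht : 0 ≤ t) :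
    M⁻¹ ^ 2 - 2 * M ^ 2 * (κ * t * Real.exp (2 * t ^ timeExponent s))
      ≤ ∫ x, θ t x ^ 2 ∂torusMeasure d := by
  have h1 := (h.isForcedSolution hu).le_integral_sq hs hu hκ (D := M ^ 2) (fun ε hε => by
    have : dirichletEnergy ε (θ 0) = dirichletEnergy ε θ₀ := by
      simp only [dirichletEnergy, weightedEnergy, h.waveCoeff_zero]
    rw [this]
    exact h₀.dirichletEnergy_le hM hε) ht
  rw [h.integral_sq_zero h₀.memLp] at h1
  have h2 := h₀.le_integral_sq hM
  linarith

end IsSolution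

/-! ### Comparison of the diffusive and the non-diffusive solution. -/

lemma weightedEnergy_le_two_mul_add {w : WaveIndex d → ℝ} {B : ℝ} (hw0 : ∀ j, 0 ≤ w j)
    (hwB : ∀ j, w j ≤ B) {f g h : Space d → ℝ} (hf : MemLp f 2 (torusMeasure d))
    (hg : MemLp g 2 (torusMeasure d)) (hh : MemLp h 2 (torusMeasure d))
    (hle : ∀ j, waveCoeff f j ^ 2 ≤ 2 * waveCoeff g j ^ 2 + 2 * waveCoeff h j ^ 2) :
    weightedEnergy w f ≤ 2 * weightedEnergy w g + 2 * weightedEnergy w h := by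
  have s1 := (summable_weightedEnergy hw0 hwB hg).mul_left 2
  have s2 := (summable_weightedEnergy hw0 hwB hh).mul_left 2
  unfold weightedEnergy
  rw [← tsum_mul_left, ← tsum_mul_left, ← s1.tsum_add s2]
  refine (summable_weightedEnergy hw0 hwB hf).tsum_le_tsum (fun j => ?_) (s1.add s2)
  have := mul_le_mul_of_nonneg_left (hle j) (hw0 j)
  linarith

/-- The regularity functional of the diffusive and the non-diffusive solution agree up to the
effect of the diffusion. -/
lemma IsSolution.weightedEnergy_le_and_le {s : ℝ≥0∞} {u : ℝ → Space d → Space d} {κ : ℝ}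
    {θ₀ : Space d → ℝ} {θ θκ : ℝ → Space d → ℝ} (hs : 1 ≤ s) (hu : IsAdmissibleVelocity s u)
    (hκ : 0 ≤ κ) {M : ℝ} (hM : 0 < M) (h₀ : IsInitialDatum M θ₀) (hθ : IsSolution 0 u θ₀ θ)
    (hθκ : IsSolution κ u θ₀ θκ) {t : ℝ} (ht : 0 ≤ t) {A η : ℝ}
    (hη : κ * t * Real.exp ((2 + 2 * A) * t ^ timeExponent s) ≤ η) :
    weightedEnergy negSobolevWeight (θκ t) ≤ 2 * weightedEnergy negSobolevWeight (θ t) +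
        8 * M ^ 2 * η * Real.exp (-(A * t ^ timeExponent s)) ^ 2 ∧
      weightedEnergy negSobolevWeight (θ t) ≤ 2 * weightedEnergy negSobolevWeight (θκ t) +
        8 * M ^ 2 * η * Real.exp (-(A * t ^ timeExponent s)) ^ 2 := by
  have h1 := hθκ.memLp ht
  have h2 := hθ.memLp ht
  have h3 : MemLp (fun x => θκ t x - θ t x) 2 (torusMeasure d) := h1.sub h2
  have hw := IsSolution.weightedEnergy_sub_le hs hu hκ hM h₀ hθ hθκ ht
  set p := t ^ timeExponent s
  -- The rate `2 + 2A` splits into the growth `2` of the difference and the squared decay `exp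
  -- (-2Ap)` with which it is compared.
  have he : κ * t * Real.exp (2 * p) ≤ η * Real.exp (-(A * p)) ^ 2 := by
    have e : Real.exp (2 * p) = Real.exp ((2 + 2 * A) * p) * Real.exp (-(A * p)) ^ 2 := by
      rw [← Real.exp_nat_mul, ← Real.exp_add]
      congr 1; push_cast; ring
    rw [e, ← mul_assoc]
    exact mul_le_mul_of_nonneg_right hη (sq_nonneg _)
  have hw' : weightedEnergy negSobolevWeight (fun x => θκ t x - θ t x)
      ≤ 4 * M ^ 2 * (η * Real.exp (-(A * p)) ^ 2) := by
    refine hw.trans ?_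
    rw [mul_assoc (4 * M ^ 2)]
    exact mul_le_mul_of_nonneg_left he (by positivity)
  have k1 := weightedEnergy_le_two_mul_add negSobolevWeight_nonneg negSobolevWeight_le_one h1 h2 h3
    (fun j => by
      rw [waveCoeff_sub h1 h2]
      nlinarith [sq_nonneg (2 * waveCoeff (θ t) j - waveCoeff (θκ t) j)])
  have k2 := weightedEnergy_le_two_mul_add negSobolevWeight_nonneg negSobolevWeight_le_one h2 h1 h3
    (fun j => by
      rw [waveCoeff_sub h1 h2]
      nlinarith [sq_nonneg (2 * waveCoeff (θκ t) j - waveCoeff (θ t) j)])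
  constructor <;> linarith

end

end PassiveScalar

end

/-! ### Choice of constants and conclusion. -/

theorem theorem1p1 (d : ℕ) (s : ℝ≥0∞) (hs : 1 ≤ s) (M : ℝ) (hM : 0 < M) :
    (∀ A C c : ℝ, 0 < A → 0 < C → 0 < c → ∃ c' C' : ℝ, 0 < c' ∧ 0 < C' ∧
      ∀ κ : ℝ, 0 < κ → κ < 1 →
      ∀ (u : ℝ → Space d → Space d) (θ₀ : Space d → ℝ) (θ θκ : ℝ → Space d → ℝ),
        IsAdmissibleVelocity s u → IsInitialDatum M θ₀ →
        IsSolution 0 u θ₀ θ → IsSolution κ u θ₀ θκ →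
        HNegOneUpperBound s A C (c * timeScale κ s) θ →
        HNegOneUpperBound s A C' (c' * timeScale κ s) θκ) ∧
    (∀ A C c : ℝ, 0 < A → 0 < C → 0 < c → ∃ c' C' : ℝ, 0 < c' ∧ 0 < C' ∧
      ∀ κ : ℝ, 0 < κ → κ < 1 →
      ∀ (u : ℝ → Space d → Space d) (θ₀ : Space d → ℝ) (θ θκ : ℝ → Space d → ℝ),
        IsAdmissibleVelocity s u → IsInitialDatum M θ₀ →
        IsSolution 0 u θ₀ θ → IsSolution κ u θ₀ θκ →
        HNegOneLowerBound s A C (c * timeScale κ s) θ →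
        HNegOneLowerBound s A C' (c' * timeScale κ s) θκ) ∧
    (∃ c C : ℝ, 0 < c ∧ 0 < C ∧
      ∀ κ : ℝ, 0 < κ → κ < 1 →
      ∀ (u : ℝ → Space d → Space d) (θ₀ : Space d → ℝ) (θκ : ℝ → Space d → ℝ),
        IsAdmissibleVelocity s u → IsInitialDatum M θ₀ → IsSolution κ u θ₀ θκ →
        ∀ t, 0 ≤ t → t ≤ c * timeScale κ s → 1 ≤ ENNReal.ofReal C * l2Norm (θκ t)) := by
  refine ⟨fun A C c hA hC hc => ?_, fun A C c hA hC hc => ?_, ?_⟩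
  · obtain ⟨c₁, hc₁, hscale⟩ := exists_mul_exp_le_of_le_timeScale hs
      (by positivity : 0 < 2 + 2 * A) one_pos
    -- With `η = 1` the squared norm is at most `(2C² + 8M²) e²`, which is below `(2C + 4M)² e²`.
    refine ⟨min c c₁, 2 * C + 4 * M, lt_min hc hc₁, by positivity,
      fun κ hκ hκ1 u θ₀ θ θκ hu h₀ hθ hθκ hup t ht htT => ?_⟩
    have hT := timeScale_nonneg hκ hκ1 s
    have h1 := hup t ht (htT.trans (by gcongr; exact min_le_left _ _))
    have h2 := (IsSolution.weightedEnergy_le_and_le hs hu hκ.le hM h₀ hθ hθκ ht (hscale κ hκ hκ1 t ht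
      (htT.trans (by gcongr; exact min_le_right _ _)))).1
    set e := Real.exp (-(A * t ^ timeExponent s))
    have he : 0 < e := Real.exp_pos _
    rw [hNegOneNorm_eq (hθ.memLp ht), ENNReal.ofReal_le_ofReal_iff (by positivity),
      Real.sqrt_le_left (by positivity)] at h1
    rw [hNegOneNorm_eq (hθκ.memLp ht)]
    refine ENNReal.ofReal_le_ofReal ?_
    rw [Real.sqrt_le_left (by positivity)]
    have h3 : 0 < C * M * e ^ 2 := by positivity
    have h4 : 0 < C ^ 2 * e ^ 2 := by positivity
    have h5 : 0 < M ^ 2 * e ^ 2 := by positivity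
    nlinarith
  · obtain ⟨c₁, hc₁, hscale⟩ := exists_mul_exp_le_of_le_timeScale hs
      (by positivity : 0 < 2 + 2 * A) (by positivity : 0 < 1 / (16 * C ^ 2 * M ^ 2))
    refine ⟨min c c₁, 2 * C, lt_min hc hc₁, by positivity,
      fun κ hκ hκ1 u θ₀ θ θκ hu h₀ hθ hθκ hlow t ht htT => ?_⟩
    have hT := timeScale_nonneg hκ hκ1 s
    have h1 := hlow t ht (htT.trans (by gcongr; exact min_le_left _ _))
    have h2 := (IsSolution.weightedEnergy_le_and_le hs hu hκ.le hM h₀ hθ hθκ ht (hscale κ hκ hκ1 t ht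
      (htT.trans (by gcongr; exact min_le_right _ _)))).2
    set e := Real.exp (-(A * t ^ timeExponent s))
    have he : 0 < e := Real.exp_pos _
    rw [hNegOneNorm_eq (hθ.memLp ht), ← ENNReal.ofReal_mul hC.le,
      ENNReal.ofReal_le_ofReal_iff (by positivity)] at h1
    rw [hNegOneNorm_eq (hθκ.memLp ht), ← ENNReal.ofReal_mul (by positivity)]
    refine ENNReal.ofReal_le_ofReal ?_
    have n1 := weightedEnergy_nonneg negSobolevWeight_nonneg (θ t)
    have n2 := weightedEnergy_nonneg negSobolevWeight_nonneg (θκ t)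
    have h3 := pow_le_pow_left₀ he.le h1 2
    rw [mul_pow, Real.sq_sqrt n1] at h3
    refine (sq_le_sq₀ (by positivity) (by positivity)).1 ?_
    rw [mul_pow, Real.sq_sqrt n2]
    have h4 := mul_le_mul_of_nonneg_left h2 (sq_nonneg C)
    -- The choice of `η` makes the diffusive error at most half of `e²`, which is absorbed on the
    -- left; the remaining half costs the factor 2 in the constant.
    have h5 : C ^ 2 * (8 * M ^ 2 * (1 / (16 * C ^ 2 * M ^ 2)) * e ^ 2) = e ^ 2 / 2 := by
      field_simp; norm_num
    rw [mul_add, h5] at h4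
    linarith
  · obtain ⟨c, hc, hscale⟩ := exists_mul_exp_le_of_le_timeScale hs two_pos
      (by positivity : 0 < M⁻¹ ^ 2 / (4 * M ^ 2))
    refine ⟨c, 2 * M, hc, by positivity, fun κ hκ hκ1 u θ₀ θκ hu h₀ hθκ t ht htT => ?_⟩
    have h1 := hscale κ hκ hκ1 t ht htT
    have h2 := hθκ.le_integral_sq hs hu hκ.le hM h₀ ht
    rw [l2Norm_eq (hθκ.memLp ht), ← ENNReal.ofReal_mul (by positivity), ← ENNReal.ofReal_one]
    refine ENNReal.ofReal_le_ofReal ?_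
    -- The smallness parameter is such that at most half of the lower bound `M⁻²` for the initial
    -- energy is dissipated.
    have h3 : M⁻¹ ^ 2 / 2 ≤ ∫ x, θκ t x ^ 2 ∂torusMeasure d := by
      have h4 := mul_le_mul_of_nonneg_left h1 (by positivity : 0 ≤ 2 * M ^ 2)
      have h5 : 2 * M ^ 2 * (M⁻¹ ^ 2 / (4 * M ^ 2)) = M⁻¹ ^ 2 / 2 := by field_simp; norm_num
      rw [h5] at h4
      linarith
    refine (sq_le_sq₀ (by positivity) (by positivity)).1 ?_
    rw [mul_pow, Real.sq_sqrt ((by positivity : 0 ≤ M⁻¹ ^ 2 / 2).trans h3)]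
    have h6 := mul_le_mul_of_nonneg_left h3 (by positivity : 0 ≤ (2 * M) ^ 2)
    have h7 : (2 * M) ^ 2 * (M⁻¹ ^ 2 / 2) = 2 := by field_simp
    linarith
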